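/- **Setting.** Let $\Omega\subset\mathbb R^2$ be open, partitioned into finitely many closed, strictly convex quadrilaterals $K_j$ (coarse elements) that form a conforming mesh, let $\chi_k$ be the bilinear nodal functions of the mesh (bilinear on the reference square), and let finitely many straight fractures $D_{f,l}\subset\Omega$ be given that meet the boundaries of the coarse elements in sets of length zero. Let $\kappa_i$, $\kappa_{l,i}$ ($i=1,2$) be measurable with $0<\underline\kappa\le\kappa_i,\kappa_{l,i}\le\overline\kappa$, and let $\rho,\sigma\ge 0$. For pairs $p=(p_1,p_2)$, $v=(v_1,v_2)$ and $S\subset\overline\Omega$ put $$a_Q^S(p,v)=\sum_i\Big(\int_S\kappa_i\nabla p_i\cdot\nabla v_i\,dx+\sum_l\int_{D_{f,l}\cap S}\kappa_{l,i}\nabla_fp_i\cdot\nabla_fv_i\,ds\Big)+\sum_{i,l}\rho\sigma\int_S(p_i-p_l)v_i\,dx ,$$ where the last sum is over $i,l\in\{1,2\}$, $a_Q=a_Q^{\Omega}$, $a_Q^{(j)}=a_Q^{K_j}$, $\|p\|_{a_Q}^2=a_Q(p,p)$, and $$s^{(j)}(p,v)=\sum_i\Big(\int_{K_j}\kappa_i\sum_k|\nabla\chi_k|^2\,p_iv_i\,dx+\sum_l\int_{D_{f,l}\cap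 K_j}\kappa_{l,i}\sum_k|\nabla_f\chi_k|^2\,p_iv_i\,ds\Big),\qquad \|p\|_{s(K_j)}^2=s^{(j)}(p,p).$$ Let $V=[H^1_0(\Omega)]^2$, where traces on the fractures have square integrable tangential derivatives (the closure of smooth compactly supported functions in the $H^1$ norm over $\Omega$ and the fractures); $V(K_j)$ is the space of restrictions of $V$ to $K_j$ (closed in the corresponding norm on $K_j$). For $m\ge 0$ let $K_{j,m}$ be $K_j$ enlarged by $m$ layers of coarse elements, a layer consisting of all elements that touch the region, and let $V_0(K_{j,m})$ be the functions of $V$ with zero trace on $\partial K_{j,m}$, extended by zero. For each $j$ let $\lambda^{(j)}_1\le\lambda^{(j)}_2\le\dots$ be all the eigenvalues, repeated with multiplicity, of the problem: find $\phi\in V(K_j)$ with $a_Q^{(j)}(\phi,v)=\lambda s^{(j)}(\phi,v)$ for all $v\in V(K_j)$, with $s^{(j)}$-orthonormal eigenfunctions $\phi^{(j)}_1,\phi^{(j)}_2,\dots$. Let $L_j\ge 0$ be integers, $V_{aux}^{(j)}=\mathrm{span}\{\phi_k^{(j)}:1\le k\le L_j\}$, and $$\Lambda=\min_j\lambda^{(j)}_{L_j+1},\qquad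 \lambda_{max}=\max_j\max_{1\le k\le L_j}\lambda^{(j)}_k,\qquad C_\pi=\sup_j\ \sup_{0\ne\nu\in V_{aux}^{(j)}}\frac{s^{(j)}(\nu,\nu)}{s^{(j)}(B_j\nu,\nu)},$$ where $B_j$ is the product of the functions $\chi_k$ over the vertices $k$ of $K_j$. Assume $\Lambda>0$. Let $C_p$ be a Poincaré constant of the elements, i.e. $\|f\|_{L^2(K_j)}\le C_p\|\nabla f\|_{L^2(K_j)}$ for all $j$ and $f\in H^1_0(K_j)$, and let, with $C_{\mathcal T}=4^2$ (the square of the number of vertices of an element), $$D=2\,(1+2C_p^2\rho\sigma\underline\kappa^{-1})\,(C_{\mathcal T}+\lambda_{max}^2)\,C_\pi^2 .$$ **Lemma.** Let $1\le k\le L_j$ and $m\ge 2$. Let $\psi_k^{(j)}$ minimize $a_Q(\psi,\psi)$ over all $\psi\in V$ with $s^{(j')}(\psi,\phi^{(j')}_{k'})=\delta_{jj'}\delta_{kk'}$ for all $j'$ and all $1\le k'\le L_{j'}$, and let $\psi_{k,ms}^{(j)}$ minimize $a_Q(\psi,\psi)$ over all $\psi\in V_0(K_{j,m})$ under the same constraints.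 Then $$\|\psi_k^{(j)}-\psi_{k,ms}^{(j)}\|_{a_Q}^2\le E\,\|\phi_k^{(j)}\|_{s(K_j)}^2,\qquad E=24D^2(1+\Lambda^{-1})\Big(1+\frac{\Lambda^{1/2}}{3D^{1/2}}\Big)^{1-m}.$$ -/

import Mathlib

open MeasureTheory Set

noncomputable section

/-- The Euclidean plane. -/
abbrev Plane : Type := EuclideanSpace ℝ (Fin 2)

/-- The planar cross product. -/
def cross (u v : Plane) : ℝ := u 0 * v 1 - u 1 * v 0

/-! ### Coarse mesh, fractures, coefficients -/

/-- The four bilinear shape functions on the reference square `[0,1] × [0,1]`, attached to the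
corners `(0,0), (1,0), (1,1), (0,1)` in this (counterclockwise) order. -/
def shape (a : Fin 4) (ξ : ℝ × ℝ) : ℝ :=
  ![(1 - ξ.1) * (1 - ξ.2), ξ.1 * (1 - ξ.2), ξ.1 * ξ.2, (1 - ξ.1) * ξ.2] a

/-- The closed reference square. -/
def refSquare : Set (ℝ × ℝ) := Icc 0 1 ×ˢ Icc 0 1

/-- The convex hull of the four vertices `p 0, …, p 3`. -/
def quad (p : Fin 4 → Plane) : Set Plane := convexHull ℝ (range p)

/-- A planar domain `Ω` with a conforming coarse partition into strictly convex quadrilaterals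
(elements indexed by `J`, nodes by `N`), and finitely many straight fractures (indexed by `ι`). -/
structure Geometry (J N ι : Type*) where
  /-- the computational domain -/
  Ω : Set Plane
  isOpen_Ω : IsOpen Ω
  /-- positions of the coarse nodes -/
  pos : N → Plane
  pos_injective : Function.Injective pos
  /-- the vertices of each element, in counterclockwise order -/
  vert : J → Fin 4 → N
  strictly_convex : ∀ j a,
    0 < cross (pos (vert j (a + 1)) - pos (vert j a))
      (pos (vert j (a + 2)) - pos (vert j (a + 1)))
  interior_disjoint : ∀ i j, i ≠ j →
    Disjoint (interior (quad (pos ∘ vert i))) (interior (quad (pos ∘ vert j)))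
  /-- distinct elements meet in nothing, in a common vertex, or in a common edge -/
  conforming : ∀ i j, i ≠ j →
    quad (pos ∘ vert i) ∩ quad (pos ∘ vert j) =
      convexHull ℝ (pos '' (range (vert i) ∩ range (vert j)))
  cover : ⋃ j, quad (pos ∘ vert j) = closure Ω
  interior_subset : ∀ j, interior (quad (pos ∘ vert j)) ⊆ Ω
  /-- end points of the fractures -/
  src : ι → Plane
  /-- end points of the fractures -/
  tgt : ι → Plane
  src_ne_tgt : ∀ l, src l ≠ tgt l
  fracture_subset : ∀ l, openSegment ℝ (src l) (tgt l) ⊆ Ω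
  /-- no fracture runs along the boundary of a coarse element -/
  fracture_transversal : ∀ l j,
    volume {t : ℝ | t ∈ Ioo 0 (dist (src l) (tgt l)) ∧
      src l + (t / dist (src l) (tgt l)) • (tgt l - src l) ∈
        frontier (quad (pos ∘ vert j))} = 0

namespace Geometry

variable {J N ι : Type*} (G : Geometry J N ι)

/-- The (closed) coarse element `K_j`. -/
def K (j : J) : Set Plane := quad (G.pos ∘ G.vert j)

/-- The length of the fracture `l`. -/
def len (l : ι) : ℝ := dist (G.src l) (G.tgt l)

/-- The arclength parametrization of the fracture `l`, on `(0, len l)`. -/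
def γ (l : ι) (t : ℝ) : Plane := G.src l + (t / G.len l) • (G.tgt l - G.src l)

/-- The part of the fracture `l` that lies in `S`, as a set of arclength parameters. -/
def fracIn (l : ι) (S : Set Plane) : Set ℝ := {t | t ∈ Ioo 0 (G.len l) ∧ G.γ l t ∈ S}

/-- The bilinear map from the reference square onto `K_j`. -/
def refMap (j : J) (ξ : ℝ × ℝ) : Plane := ∑ a, shape a ξ • G.pos (G.vert j a)

/-- The inverse of the bilinear map from the reference square onto `K_j`. -/
def refInv (j : J) (x : Plane) : ℝ × ℝ := Function.invFunOn (G.refMap j) refSquare x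

open Classical in
/-- The bilinear nodal (partition of unity) function `χ_k` of the node `k`. At a point that belongs
to several elements all of them give the same value, because the mesh is conforming. -/
def hat (k : N) (x : Plane) : ℝ :=
  if h : ∃ j, x ∈ G.K j then
    ∑ a, if G.vert h.choose a = k then shape a (G.refInv h.choose x) else 0
  else 0

/-- `∑_k |∇ χ_k|²`. -/
def hatGradSq [Fintype N] (x : Plane) : ℝ := ∑ k, ‖gradient (G.hat k) x‖ ^ 2

/-- `∑_k |∇_f χ_k|²` on the fracture `l`, at arclength `t`. -/
def hatFracGradSq [Fintype N] (l : ι) (t : ℝ) : ℝ :=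
  ∑ k, (deriv (fun r => G.hat k (G.γ l r)) t) ^ 2

/-- The bubble function of `K_j`: the product of the `χ_k` over the vertices `k` of `K_j`. -/
def bubble (j : J) (x : Plane) : ℝ := ∏ a, G.hat (G.vert j a) x

/-- The elements of the oversampled region `K_{j,m}`: start with `K_j` and add `m` times the
layer of all elements that touch the region. -/
def patch (j : J) : ℕ → Set J
  | 0 => {j}
  | m + 1 => {i | ∃ i' ∈ patch j m, (G.K i ∩ G.K i').Nonempty}

/-- The oversampled region `K_{j,m}`. -/
def patchSet (j : J) (m : ℕ) : Set Plane := ⋃ i ∈ G.patch j m, G.K i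

end Geometry

/-- The coefficients of the dual continuum model: permeabilities `κ i` of the two continua in the
matrix and `κf l i` on the fractures, with common bounds, and the exchange parameters. -/
structure Medium {J N ι : Type*} (G : Geometry J N ι) where
  κ : Fin 2 → Plane → ℝ
  κf : ι → Fin 2 → Plane → ℝ
  κlo : ℝ
  κhi : ℝ
  ρ : ℝ
  σ : ℝ
  κlo_pos : 0 < κlo
  ρ_nonneg : 0 ≤ ρ
  σ_nonneg : 0 ≤ σ
  measurable_κ : ∀ i, Measurable (κ i)
  measurable_κf : ∀ l i, Measurable (κf l i)
  κ_bounds : ∀ i, ∀ x ∈ G.Ω, κlo ≤ κ i x ∧ κ i x ≤ κhi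
  κf_bounds : ∀ l i, ∀ x ∈ G.Ω, κlo ≤ κf l i x ∧ κf l i x ≤ κhi

/-! ### Functions on the matrix and on the fractures -/

/-- A (scalar) function together with its gradient, in the matrix and on the fractures: value and
gradient in the plane; trace and tangential derivative on each fracture as functions of
arclength. -/
abbrev MixedFun (ι : Type*) : Type _ :=
  ((Plane → ℝ) × (Plane → Plane)) × ((ι → ℝ → ℝ) × (ι → ℝ → ℝ))

namespace MixedFun

variable {ι : Type*}

/-- The value in the matrix. -/
def val (u : MixedFun ι) : Plane → ℝ := u.1.1

/-- The gradient in the matrix. -/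
def grad (u : MixedFun ι) : Plane → Plane := u.1.2

/-- The trace on the fractures. -/
def fval (u : MixedFun ι) : ι → ℝ → ℝ := u.2.1

/-- The tangential derivative on the fractures. -/
def fgrad (u : MixedFun ι) : ι → ℝ → ℝ := u.2.2

end MixedFun

/-- A pair of functions, one for each of the two continua. -/
abbrev DualFun (ι : Type*) : Type _ := Fin 2 → MixedFun ι

namespace Geometry

variable {J N ι : Type*} (G : Geometry J N ι)

/-- A function on the plane, as a function on the matrix and the fractures. -/
def lift (f : Plane → ℝ) : MixedFun ι :=
  ((f, gradient f), (fun l t => f (G.γ l t), fun l => deriv (fun r => f (G.γ l r))))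

/-- The product `b u` with a function `b` on the plane (product rule for the gradients). -/
def mul (b : Plane → ℝ) (u : MixedFun ι) : MixedFun ι :=
  ((fun x => b x * u.val x, fun x => b x • u.grad x + u.val x • gradient b x),
    (fun l t => b (G.γ l t) * u.fval l t,
      fun l t => b (G.γ l t) * u.fgrad l t + u.fval l t * deriv (fun r => b (G.γ l r)) t))

/-- Smooth functions with compact support in `U`. -/
def IsTest (U : Set Plane) (f : Plane → ℝ) : Prop :=
  ContDiff ℝ (⊤ : ℕ∞) f ∧ HasCompactSupport f ∧ tsupport f ⊆ U

/-- The square of the `H¹` norm on the part in `S` of the matrix and of the fractures. -/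
def normSq [Fintype ι] (S : Set Plane) (u : MixedFun ι) : ℝ :=
  (∫ x in S, ((u.val x) ^ 2 + ‖u.grad x‖ ^ 2)) +
    ∑ l, ∫ t in G.fracIn l S, ((u.fval l t) ^ 2 + (u.fgrad l t) ^ 2)

/-- Square integrability on `S` of values and gradients, in the matrix and on the fractures. -/
def SqIntegrable (S : Set Plane) (u : MixedFun ι) : Prop :=
  MemLp u.val 2 (volume.restrict S) ∧ MemLp u.grad 2 (volume.restrict S) ∧
    ∀ l, MemLp (u.fval l) 2 (volume.restrict (G.fracIn l S)) ∧
      MemLp (u.fgrad l) 2 (volume.restrict (G.fracIn l S))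

/-- The closure, in the `H¹` norm on `S`, of the smooth functions with compact support in `U`. -/
def MemClosure [Fintype ι] (S U : Set Plane) (u : MixedFun ι) : Prop :=
  G.SqIntegrable S u ∧ ∀ ε > 0, ∃ f, IsTest U f ∧ G.normSq S (u - G.lift f) < ε

variable [Fintype ι]

/-- The space `V = [H¹_0(Ω)]²`; the traces on the fractures have square integrable tangential
derivatives. -/
def V : Set (DualFun ι) := {u | ∀ i, G.MemClosure G.Ω G.Ω (u i)}

/-- The space `V(K_j)` of restrictions to `K_j` of functions in `V` (closed in the `H¹` norm on
`K_j`): no boundary condition, except on `∂Ω`. -/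
def VLoc (j : J) : Set (DualFun ι) := {u | ∀ i, G.MemClosure (G.K j) G.Ω (u i)}

/-- The space `V_0(K_{j,m})` of functions with zero trace on the boundary of `K_{j,m}`, extended
by zero to `Ω`. -/
def VZero (j : J) (m : ℕ) : Set (DualFun ι) :=
  {u | ∀ i, G.MemClosure G.Ω (interior (G.patchSet j m) ∩ G.Ω) (u i)}

/-- `C` is a Poincaré constant for all coarse elements:
`‖f‖_{L²(K_j)} ≤ C ‖∇ f‖_{L²(K_j)}` for functions that vanish on the boundary of `K_j`. -/
def IsPoincareConst {J N ι : Type*} (G : Geometry J N ι) (C : ℝ) : Prop :=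
  0 ≤ C ∧ ∀ j f, IsTest (interior (G.K j)) f →
    ∫ x in G.K j, (f x) ^ 2 ≤ C ^ 2 * ∫ x in G.K j, ‖gradient f x‖ ^ 2

end Geometry

/-! ### Bilinear forms -/

namespace Medium

variable {J N ι : Type*} {G : Geometry J N ι} (M : Medium G)

/-- The energy form, over the part in `S` of the matrix and of the fractures. -/
def aForm [Fintype ι] (S : Set Plane) (p v : DualFun ι) : ℝ :=
  ∑ i, ((∫ x in S, M.κ i x * inner ℝ ((p i).grad x) ((v i).grad x)) +
    ∑ l, ∫ t in G.fracIn l S, M.κf l i (G.γ l t) * ((p i).fgrad l t * (v i).fgrad l t))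

/-- The mass exchange form over `S`. -/
def qForm (S : Set Plane) (p v : DualFun ι) : ℝ :=
  ∑ i, ∑ i', M.ρ * M.σ * ∫ x in S, ((p i).val x - (p i').val x) * (v i).val x

/-- The form `a_Q = a + q` over `S`. -/
def aQForm [Fintype ι] (S : Set Plane) (p v : DualFun ι) : ℝ :=
  M.aForm S p v + M.qForm S p v

/-- The global form `a_Q`. -/
def aQ [Fintype ι] (p v : DualFun ι) : ℝ := M.aQForm G.Ω p v

/-- The local form `a_Q^{(j)}`. -/
def aQLoc [Fintype ι] (j : J) (p v : DualFun ι) : ℝ := M.aQForm (G.K j) p v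

/-- The local form `s^{(j)}`, with the weights `κ_i ∑_k |∇ χ_k|²` in the matrix and
`κ_{l,i} ∑_k |∇_f χ_k|²` on the fractures. -/
def sLoc [Fintype N] [Fintype ι] (j : J) (p v : DualFun ι) : ℝ :=
  ∑ i, ((∫ x in G.K j, M.κ i x * G.hatGradSq x * ((p i).val x * (v i).val x)) +
    ∑ l, ∫ t in G.fracIn l (G.K j),
      M.κf l i (G.γ l t) * G.hatFracGradSq l t * ((p i).fval l t * (v i).fval l t))

variable [Fintype N] [Fintype ι]

/-! ### Auxiliary functions and multiscale basis functions -/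

/-- `u ∈ V(K_j)` satisfies the equation of the local spectral problem with the number `μ`. -/
def IsEigenpair (j : J) (μ : ℝ) (u : DualFun ι) : Prop :=
  u ∈ G.VLoc j ∧ ∀ v ∈ G.VLoc j, M.aQLoc j u v = μ * M.sLoc j u v

/-- `lam 0 ≤ lam 1 ≤ …` are all the eigenvalues of the local spectral problem on `K_j`, repeated
according to multiplicity, with `s^{(j)}`-orthonormal eigenfunctions `φ 0, φ 1, …`. -/
structure IsEigenSystem (j : J) (lam : ℕ → ℝ) (φ : ℕ → DualFun ι) : Prop where
  eigenpair : ∀ k, M.IsEigenpair j (lam k) (φ k)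
  orthonormal : ∀ k k', M.sLoc j (φ k) (φ k') = if k = k' then 1 else 0
  ascending : Monotone lam
  /-- no eigenfunction is left out -/
  exhaustive : ∀ μ u, M.IsEigenpair j μ u → (∀ k, M.sLoc j u (φ k) = 0) → M.sLoc j u u = 0

/-- The local auxiliary space, spanned by the first `n` eigenfunctions. -/
def auxSpace {ι : Type*} (φ : ℕ → DualFun ι) (n : ℕ) : Submodule ℝ (DualFun ι) :=
  Submodule.span ℝ (φ '' Iio n)

/-- `ψ` is `φ_k^{(j)}`-orthogonal: `s(ψ, φ_{k'}^{(j')}) = δ_{j,j'} δ_{k,k'}` for all auxiliary basis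
functions. Each `φ_{k'}^{(j')}` is extended by zero outside `K_{j'}`, so that
`s(ψ, φ_{k'}^{(j')}) = s^{(j')}(ψ, φ_{k'}^{(j')})`. -/
def IsPhiOrthogonal (L : J → ℕ) (φ : J → ℕ → DualFun ι) (j : J) (k : ℕ) (ψ : DualFun ι) : Prop :=
  ∀ j' k', k' < L j' →
    (j' = j ∧ k' = k → M.sLoc j' ψ (φ j' k') = 1) ∧
    (¬ (j' = j ∧ k' = k) → M.sLoc j' ψ (φ j' k') = 0)

/-- `ψ` minimizes `a_Q(ψ, ψ)` among the `φ_k^{(j)}`-orthogonal functions in `W`. -/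
def IsMultiscaleBasis (W : Set (DualFun ι)) (L : J → ℕ) (φ : J → ℕ → DualFun ι) (j : J) (k : ℕ)
    (ψ : DualFun ι) : Prop :=
  (ψ ∈ W ∧ M.IsPhiOrthogonal L φ j k ψ) ∧
    ∀ ψ' ∈ W, M.IsPhiOrthogonal L φ j k ψ' → M.aQ ψ ψ ≤ M.aQ ψ' ψ'

/-! ### Constants -/

/-- The constant `C_π`, the supremum of `s(ν, ν) / s(B ν, ν)` over all elements and all nonzero
`ν` in the local auxiliary space, where `B` is the bubble function of the element. -/
def Cpi (L : J → ℕ) (φ : J → ℕ → DualFun ι) : ℝ :=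
  sSup {r | ∃ j, ∃ ν ∈ auxSpace (φ j) (L j), M.sLoc j ν ν ≠ 0 ∧
    r = M.sLoc j ν ν / M.sLoc j (fun i => G.mul (G.bubble j) (ν i)) ν}

/-- `λ_max`, the largest of the eigenvalues that belong to auxiliary basis functions. -/
def lamMax (L : J → ℕ) (lam : J → ℕ → ℝ) : ℝ := ⨆ j, ⨆ k : Fin (L j), lam j k

/-- `Λ`, the smallest of the eigenvalues `λ_{L_j + 1}^{(j)}` (the numbering here starts at `0`). -/
def Lam (L : J → ℕ) (lam : J → ℕ → ℝ) : ℝ := ⨅ j, lam j (L j)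

/-- The constant `D`; every coarse element has `4` vertices, so that `C_𝒯 = 4²`. -/
def Dconst (Cp : ℝ) (L : J → ℕ) (lam : J → ℕ → ℝ) (φ : J → ℕ → DualFun ι) : ℝ :=
  2 * (1 + 2 * Cp ^ 2 * M.ρ * M.σ * M.κlo⁻¹) * (4 ^ 2 + lamMax L lam ^ 2) * M.Cpi L φ ^ 2

end Medium

end

open MeasureTheory Set

noncomputable section

/-! ### Strictly convex quadrilaterals and their bilinear parametrization -/

/-! Call the numbers `s^{(i)}(u, φ_l^{(i)})` with `l < L_i` the moments of `u`. Since `ψ` is a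
minimizer, `a_Q(ψ, x) = 0` for every `x ∈ V` whose moments all vanish. If `w ∈ V_0(K_{j,m})` has the
moments of `ψ`, this orthogonality and the minimality of `ψ_ms` give `‖ψ - ψ_ms‖ ≤ ‖ψ - w‖` in the
energy norm. So it suffices to construct one good competitor `w`.

Two tools act element by element. The first is a spectral gap: `Λ s(u, u) ≤ a_Q(u, u)` on `K_i` if
`u` has no moments there (`spectral_gap`, `IsEigenSystem.spectral_bound`). The eigenfunctions are
only assumed to be a list from which none is missing, so the gap is proved by the direct method: a
violation would produce a maximizer of `s / (a_Q + s)` on the complement of the first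
eigenfunctions, hence a forgotten eigenfunction. This needs completeness of `V(K_j)` and a Rellich
theorem, which follows from the Poincaré inequality on the convex cells of a fine grid. The second
tool is a lift (`exists_lift`): all moments `c` in `K_i` are attained by a function `B_i μ` with `μ`
in the auxiliary space, supported in `K_i`, with energy at most `D ∑ c²`. Here `C_π` pays for the
factor `B_i`, the weight of `s` pays for its gradient, and the Poincaré constant pays for the
exchange term.

Let `f` be the lift into `K_j` of the moments of `ψ`. Then `η = ψ - f` has no moments and energy at
most `D`. Take the cutoff `χ` that is `1` on `K_{j,n}` and `0` outside `K_{j,n+1}`, and put `x = (1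
- χ) η + v`, where the lift `v`, supported in the layer between the two regions, removes the moments
(`exists_moment_free_cutoff`). Since `x` has no moments and no energy in `K_j`, it is orthogonal to
both `ψ` and `f`, so `a_Q(η, x) = 0`. Outside `K_{j,n+1}` it coincides with `η` in energy; in the
layer the gap bounds `-a_Q(η, x)` by `c = (2 + √D) / √Λ` times the energy of `η`. With `E_n` the
energy of `η` outside `K_{j,n}` this says `E_{n+1} ≤ c (E_n - E_{n+1})`, and `E_n` decays
geometrically (`outerEnergy_succ_le`, `outerEnergy_mul_pow_le`). For `n = m - 1` the competitor is
`w = ψ - x = f + (η - x)`, and `a_Q(x, x) ≤ (16 + 2D)(1 + Λ⁻¹) E_n`.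

The matrix and the fractures are treated as one measure space `MixedPt`, in which element boundaries
are null sets, so that forms split into sums over elements and densities can be estimated pointwise.
That products with `χ` and `B_j` stay in the closures of test functions (`IsCutoff.memClosure_mul`)
is shown by truncation and mollification of piecewise smooth functions. -/

theorem exists_weights_of_mem_convexHull_image {N E : Type*} [Fintype N] [AddCommGroup E]
    [Module ℝ E] {f : N → E} {s : Set N} {x : E} (hx : x ∈ convexHull ℝ (f '' s)) :
    ∃ w : N → ℝ, (∀ k, 0 ≤ w k) ∧ (∀ k, k ∉ s → w k = 0) ∧ ∑ k, w k = 1 ∧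
      ∑ k, w k • f k = x := by
  classical
  have : convexHull ℝ (f '' s) ⊆ {x | ∃ w : N → ℝ, (∀ k, 0 ≤ w k) ∧ (∀ k, k ∉ s → w k = 0) ∧
      ∑ k, w k = 1 ∧ ∑ k, w k • f k = x} := by
    apply convexHull_min
    · rintro _ ⟨k, hk, rfl⟩
      refine ⟨Pi.single k 1, fun i => ?_, fun i hi => ?_, by simp, ?_⟩
      · by_cases h : i = k
        · subst h; simp
        · simp [h]
      · have : i ≠ k := fun h => hi (h ▸ hk)
        simp [this]
      · simp [Pi.single_apply]
    · rintro x ⟨w, h1, h2, h3, rfl⟩ y ⟨v, g1, g2, g3, rfl⟩ a b ha hb hab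
      refine ⟨fun k => a * w k + b * v k, fun k => ?_, fun k hk => ?_, ?_, ?_⟩
      · have := h1 k; have := g1 k; positivity
      · simp [h2 k hk, g2 k hk]
      · rw [Finset.sum_add_distrib, ← Finset.mul_sum, ← Finset.mul_sum, h3, g3]; linarith
      · simp only [add_smul, mul_smul, Finset.sum_add_distrib, Finset.smul_sum]
  exact this hx

theorem sum_smul_mem_quad {p : Fin 4 → Plane} {w : Fin 4 → ℝ} (h0 : ∀ a, 0 ≤ w a)
    (h1 : ∑ a, w a = 1) : ∑ a, w a • p a ∈ quad p :=
  (convex_convexHull ℝ _).sum_mem (fun a _ => h0 a) h1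
    (fun a _ => subset_convexHull ℝ _ (mem_range_self a))

theorem exists_weights_of_mem_quad {p : Fin 4 → Plane} {x : Plane} (hx : x ∈ quad p) :
    ∃ w : Fin 4 → ℝ, (∀ a, 0 ≤ w a) ∧ ∑ a, w a = 1 ∧ ∑ a, w a • p a = x := by
  rw [quad, ← image_univ] at hx
  obtain ⟨w, h0, -, h1, h2⟩ := exists_weights_of_mem_convexHull_image hx
  exact ⟨w, h0, h1, h2⟩

/-- Strict convexity of the quadrilateral with vertices `p`, in counterclockwise order. -/
def StrictlyConvexQuad (p : Fin 4 → Plane) : Prop :=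
  ∀ a, 0 < cross (p (a + 1) - p a) (p (a + 2) - p (a + 1))

/-- The affine function that vanishes on the edge `a` of the quadrilateral. -/
def quadEdge (p : Fin 4 → Plane) (a : Fin 4) (x : Plane) : ℝ := cross (p (a + 1) - p a) (x - p a)

theorem quadEdge_sum (p : Fin 4 → Plane) (b : Fin 4) (w : Fin 4 → ℝ) (h1 : ∑ a, w a = 1) :
    quadEdge p b (∑ a, w a • p a) = ∑ a, w a * quadEdge p b (p a) := by
  simp only [Fin.sum_univ_four] at h1
  have h : w 0 = 1 - w 1 - w 2 - w 3 := by linarith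
  simp only [quadEdge, cross, Fin.sum_univ_four, PiLp.sub_apply, PiLp.add_apply, PiLp.smul_apply,
    smul_eq_mul]
  rw [h]
  ring

theorem quadEdge_self (p : Fin 4 → Plane) (a : Fin 4) : quadEdge p a (p a) = 0 := by
  simp [quadEdge, cross]

theorem quadEdge_succ (p : Fin 4 → Plane) (a : Fin 4) : quadEdge p a (p (a + 1)) = 0 := by
  simp [quadEdge, cross]; ring

theorem quadEdge_add_two {p : Fin 4 → Plane} (hp : StrictlyConvexQuad p) (a : Fin 4) :
    0 < quadEdge p a (p (a + 2)) := by
  have := hp a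
  simp only [quadEdge, cross, PiLp.sub_apply] at this ⊢
  linarith

theorem quadEdge_add_three {p : Fin 4 → Plane} (hp : StrictlyConvexQuad p) (a : Fin 4) :
    0 < quadEdge p a (p (a + 3)) := by
  -- Convexity at the vertex `a`, where the edges `a + 3` and `a` meet.
  have := hp (a + 3)
  rw [show a + 3 + 1 = a by rw [add_assoc]; simp,
    show a + 3 + 2 = a + 1 by rw [add_assoc]; rfl] at this
  simp only [quadEdge, cross, PiLp.sub_apply] at this ⊢
  linarith

theorem quadEdge_vertex_nonneg {p : Fin 4 → Plane} (hp : StrictlyConvexQuad p) (b a : Fin 4) :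
    0 ≤ quadEdge p b (p a) := by
  have h0 := quadEdge_self p b
  have h1 := quadEdge_succ p b
  have h2 := quadEdge_add_two hp b
  have h3 := quadEdge_add_three hp b
  obtain h | h | h | h : a = b ∨ a = b + 1 ∨ a = b + 2 ∨ a = b + 3 := by
    clear h0 h1 h2 h3; revert a b; decide
  all_goals (subst h; linarith)

theorem quadEdge_nonneg {p : Fin 4 → Plane} (hp : StrictlyConvexQuad p) {x : Plane}
    (hx : x ∈ quad p) (b : Fin 4) : 0 ≤ quadEdge p b x := by
  obtain ⟨w, h0, h1, rfl⟩ := exists_weights_of_mem_quad hx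
  rw [quadEdge_sum p b w h1]
  exact Finset.sum_nonneg fun a _ => mul_nonneg (h0 a) (quadEdge_vertex_nonneg hp b a)

theorem quad_vertex_ne {p : Fin 4 → Plane} (hp : StrictlyConvexQuad p) (a : Fin 4) :
    p a ≠ p (a + 1) := by
  intro h
  have := hp a
  rw [h] at this
  simp [cross] at this

theorem quad_vertex_injective {p : Fin 4 → Plane} (hp : StrictlyConvexQuad p) :
    Function.Injective p := by
  intro a b h
  by_contra hab
  obtain h' | h' | h' : b = a + 1 ∨ b = a + 2 ∨ a = b + 1 := by
    clear h; revert a b; decide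
  · subst h'; exact quad_vertex_ne hp a h
  · subst h'
    have := quadEdge_add_two hp a
    rw [← h, quadEdge_self] at this
    exact lt_irrefl _ this
  · subst h'; exact quad_vertex_ne hp b h.symm

theorem shape_nonneg {ξ : ℝ × ℝ} (h : ξ ∈ refSquare) (a : Fin 4) : 0 ≤ shape a ξ := by
  obtain ⟨⟨h1, h2⟩, h3, h4⟩ := h
  have h5 : 0 ≤ 1 - ξ.1 := sub_nonneg.2 h2
  have h6 : 0 ≤ 1 - ξ.2 := sub_nonneg.2 h4
  fin_cases a <;> simp [shape] <;> positivity

theorem shape_sum (ξ : ℝ × ℝ) : ∑ a, shape a ξ = 1 := by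
  simp [Fin.sum_univ_four, shape]; ring

/-- The inverse bilinear map without solving a quadratic equation: the segments between points of
equal parameter `η` on the two opposite edges `0–3` and `1–2` sweep the quadrilateral, so one of
them passes through `x`. -/
theorem exists_shape_eq_of_quadEdge_nonneg {p : Fin 4 → Plane} (hp : StrictlyConvexQuad p)
    {x : Plane} (hx : ∀ b, 0 ≤ quadEdge p b x) :
    ∃ ξ ∈ refSquare, ∑ a, shape a ξ • p a = x := by
  have e0 := hx 0
  have e1 := hx 1
  have e2 := hx 2
  have e3 := hx 3
  have a2 := quadEdge_add_two hp 3
  have a3 := quadEdge_add_three hp 3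
  have b2 := quadEdge_add_two hp 1
  have b3 := quadEdge_add_three hp 1
  have c2 := quadEdge_add_two hp 0
  simp only [quadEdge, cross, PiLp.sub_apply, Fin.isValue, show (3 : Fin 4) + 1 = 0 from rfl,
    show (3 : Fin 4) + 2 = 1 from rfl, show (3 : Fin 4) + 3 = 2 from rfl,
    show (1 : Fin 4) + 1 = 2 from rfl, show (1 : Fin 4) + 2 = 3 from rfl,
    show (1 : Fin 4) + 3 = 0 from rfl, show (2 : Fin 4) + 1 = 3 from rfl, zero_add] at *
  set p00 := p 0 0; set p01 := p 0 1
  set p10 := p 1 0; set p11 := p 1 1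
  set p20 := p 2 0; set p21 := p 2 1
  set p30 := p 3 0; set p31 := p 3 1
  set x0 := x 0; set x1 := x 1
  -- The cross product measures on which side of the segment with parameter `η` the point lies. At
  -- `η = 0` it is the edge function `0`, at `η = 1` minus the edge function `2`.
  obtain ⟨η, ⟨hη0, hη1⟩, hη⟩ : ∃ η ∈ Icc (0 : ℝ) 1,
      (((1 - η) * p10 + η * p20) - ((1 - η) * p00 + η * p30)) * (x1 - ((1 - η) * p01 + η * p31)) -
      (((1 - η) * p11 + η * p21) - ((1 - η) * p01 + η * p31)) *
        (x0 - ((1 - η) * p00 + η * p30)) = 0 := by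
    have hc : ContinuousOn (fun η : ℝ =>
      (((1 - η) * p10 + η * p20) - ((1 - η) * p00 + η * p30)) * (x1 - ((1 - η) * p01 + η * p31)) -
      (((1 - η) * p11 + η * p21) - ((1 - η) * p01 + η * p31)) *
        (x0 - ((1 - η) * p00 + η * p30))) (Icc 0 1) := by fun_prop
    have := intermediate_value_Icc' (zero_le_one) hc
    apply this
    constructor <;> simp <;> linarith
  set d0 := ((1 - η) * p10 + η * p20) - ((1 - η) * p00 + η * p30) with hd0
  set d1 := ((1 - η) * p11 + η * p21) - ((1 - η) * p01 + η * p31) with hd1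
  set α := (p00 - p30) * d1 - (p01 - p31) * d0 with hα
  have hα0 : 0 < α := by
    have h : α = (1 - η) * ((p00 - p30) * (p11 - p31) - (p01 - p31) * (p10 - p30)) +
        η * ((p00 - p30) * (p21 - p31) - (p01 - p31) * (p20 - p30)) := by
      rw [hα, hd0, hd1]; ring
    rw [h]
    rcases hη0.eq_or_lt with h0 | h0
    · rw [← h0]; simpa using a2
    · have : 0 ≤ 1 - η := sub_nonneg.2 hη1
      have := mul_nonneg this a2.le
      have := mul_pos h0 a3
      linarith
  -- The position on the segment is read off from the edge function `3`, which vanishes at the left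
  -- end point; `α` is its increase along the segment and a convex combination of its positive
  -- values at the vertices `1` and `2`.
  set β := (p00 - p30) * (x1 - p31) - (p01 - p31) * (x0 - p30) with hβ
  have hx0 : x0 = ((1 - η) * p00 + η * p30) + β / α * d0 := by
    field_simp
    rw [hα, hβ]
    linear_combination -(p00 - p30) * hη
  have hx1 : x1 = ((1 - η) * p01 + η * p31) + β / α * d1 := by
    field_simp
    rw [hα, hβ]
    linear_combination -(p01 - p31) * hη
  have hξ0 : 0 ≤ β / α := by positivity
  have hξ1 : β / α ≤ 1 := by
    have h : (p20 - p10) * (x1 - p11) - (p21 - p11) * (x0 - p10) =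
        (1 - β / α) * ((1 - η) * ((p20 - p10) * (p01 - p11) - (p21 - p11) * (p00 - p10)) +
          η * ((p20 - p10) * (p31 - p11) - (p21 - p11) * (p30 - p10))) := by
      rw [hx0, hx1, hd0, hd1]; ring
    have hpos : 0 < (1 - η) * ((p20 - p10) * (p01 - p11) - (p21 - p11) * (p00 - p10)) +
          η * ((p20 - p10) * (p31 - p11) - (p21 - p11) * (p30 - p10)) := by
      rcases hη0.eq_or_lt with h0 | h0
      · rw [← h0]; simpa using b3
      · have : 0 ≤ 1 - η := sub_nonneg.2 hη1
        have := mul_nonneg this b3.le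
        have := mul_pos h0 b2
        linarith
    rw [h] at e1
    have := nonneg_of_mul_nonneg_left e1 hpos
    linarith
  refine ⟨(β / α, η), ⟨⟨hξ0, hξ1⟩, hη0, hη1⟩, ?_⟩
  ext i
  fin_cases i
  · simp only [Fin.sum_univ_four, shape, PiLp.add_apply, PiLp.smul_apply, smul_eq_mul]
    simp
    change _ = x0
    rw [hx0, hd0]; ring
  · simp only [Fin.sum_univ_four, shape, PiLp.add_apply, PiLp.smul_apply, smul_eq_mul]
    simp
    change _ = x1
    rw [hx1, hd1]; ring

theorem exists_shape_eq_of_mem_quad {p : Fin 4 → Plane} (hp : StrictlyConvexQuad p)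
    {x : Plane} (hx : x ∈ quad p) : ∃ ξ ∈ refSquare, ∑ a, shape a ξ • p a = x :=
  exists_shape_eq_of_quadEdge_nonneg hp (quadEdge_nonneg hp hx)

theorem mem_quad_iff {p : Fin 4 → Plane} (hp : StrictlyConvexQuad p) {x : Plane} :
    x ∈ quad p ↔ ∀ b, 0 ≤ quadEdge p b x := by
  refine ⟨fun h b => quadEdge_nonneg hp h b, fun h => ?_⟩
  obtain ⟨ξ, hξ, rfl⟩ := exists_shape_eq_of_quadEdge_nonneg hp h
  exact sum_smul_mem_quad (shape_nonneg hξ) (shape_sum ξ)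

theorem continuous_quadEdge (p : Fin 4 → Plane) (b : Fin 4) : Continuous (quadEdge p b) := by
  unfold quadEdge cross; fun_prop

theorem mem_interior_quad_iff {p : Fin 4 → Plane} (hp : StrictlyConvexQuad p) {x : Plane} :
    x ∈ interior (quad p) ↔ ∀ b, 0 < quadEdge p b x := by
  constructor
  · intro hx b
    refine (quadEdge_nonneg hp (interior_subset hx) b).lt_of_ne' fun h0 => ?_
    -- A point of the quadrilateral on the line of edge `b` leaves the half plane when moved away
    -- from the vertex `b + 2`, which lies strictly inside it.
    have hc : Filter.Tendsto (fun t : ℝ => x + t • (x - p (b + 2))) (nhds 0) (nhds x) := by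
      have : Continuous (fun t : ℝ => x + t • (x - p (b + 2))) := by fun_prop
      simpa using this.tendsto 0
    have hev := hc.eventually (mem_interior_iff_mem_nhds.1 hx)
    obtain ⟨ε, hε, hball⟩ := Metric.eventually_nhds_iff.1 hev
    have h1 : x + (ε / 2) • (x - p (b + 2)) ∈ quad p := by
      apply hball; simp [abs_of_pos hε, hε]
    have h2 := quadEdge_nonneg hp h1 b
    have h3 := quadEdge_add_two hp b
    simp only [quadEdge, cross, PiLp.sub_apply, PiLp.add_apply, PiLp.smul_apply,
      smul_eq_mul] at h0 h2 h3
    nlinarith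
  · intro h
    have ho : IsOpen {y | ∀ b, 0 < quadEdge p b y} := by
      simp only [ofPred_forall]
      exact isOpen_iInter_of_finite fun b => isOpen_lt continuous_const (continuous_quadEdge p b)
    exact interior_maximal (fun y hy => (mem_quad_iff hp).2 fun b => (hy b).le) ho h

/-- If a coordinate of `ξ` were `0` or `1`, the shape functions of two adjacent vertices would
vanish and `x` would lie on the opposite edge. -/
theorem shape_pos_of_mem_interior {p : Fin 4 → Plane} (hp : StrictlyConvexQuad p) {ξ : ℝ × ℝ}
    (hξ : ξ ∈ refSquare) (hx : ∑ a, shape a ξ • p a ∈ interior (quad p)) (a : Fin 4) :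
    0 < shape a ξ := by
  have h := (mem_interior_quad_iff hp).1 hx
  simp only [quadEdge_sum p _ _ (shape_sum ξ)] at h
  have key : ∀ b, ¬ (shape (b + 2) ξ = 0 ∧ shape (b + 3) ξ = 0) := by
    rintro b ⟨h2, h3⟩
    have := h b
    have hs : ∑ a, shape a ξ * quadEdge p b (p a) = 0 := by
      refine Finset.sum_eq_zero fun a _ => ?_
      obtain h | h | h | h : a = b ∨ a = b + 1 ∨ a = b + 2 ∨ a = b + 3 := by
        clear * -; revert a b; decide
      · rw [h, quadEdge_self, mul_zero]
      · rw [h, quadEdge_succ, mul_zero]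
      · rw [h, h2, zero_mul]
      · rw [h, h3, zero_mul]
    linarith
  have k0 := key 0
  have k1 := key 1
  have k2 := key 2
  have k3 := key 3
  simp only [shape, Fin.isValue, show (3 : Fin 4) + 2 = 1 from rfl,
    show (3 : Fin 4) + 3 = 2 from rfl, show (1 : Fin 4) + 2 = 3 from rfl,
    show (1 : Fin 4) + 3 = 0 from rfl, show (2 : Fin 4) + 2 = 0 from rfl,
    show (2 : Fin 4) + 3 = 1 from rfl, zero_add] at k0 k1 k2 k3
  simp at k0 k1 k2 k3
  obtain ⟨⟨h1, h2⟩, h3, h4⟩ := hξ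
  have q1 : 0 < ξ.1 := h1.lt_of_ne fun h => by simp_all
  have q2 : 0 < 1 - ξ.1 := (sub_nonneg.2 h2).lt_of_ne fun h => by simp_all
  have q3 : 0 < ξ.2 := h3.lt_of_ne fun h => by simp_all
  have q4 : 0 < 1 - ξ.2 := (sub_nonneg.2 h4).lt_of_ne fun h => by simp_all
  fin_cases a <;> simp [shape] <;> positivity

/-- On the boundary some edge function vanishes; this kills the weights of the two opposite
vertices, and on a segment weights are unique. In the interior four weights are not unique. This is
what makes the nodal functions of neighbouring elements agree. -/
theorem weights_eq_of_notMem_interior {p : Fin 4 → Plane} (hp : StrictlyConvexQuad p)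
    {w v : Fin 4 → ℝ} (hw : ∀ a, 0 ≤ w a) (hv : ∀ a, 0 ≤ v a) (hw1 : ∑ a, w a = 1)
    (hv1 : ∑ a, v a = 1) (h : ∑ a, w a • p a = ∑ a, v a • p a)
    (hx : ∑ a, w a • p a ∉ interior (quad p)) : w = v := by
  obtain ⟨b, hb⟩ : ∃ b, quadEdge p b (∑ a, w a • p a) = 0 := by
    by_contra! hcon
    exact hx ((mem_interior_quad_iff hp).2 fun b =>
      (quadEdge_nonneg hp (sum_smul_mem_quad hw hw1) b).lt_of_ne' (hcon b))
  have main : ∀ u : Fin 4 → ℝ, (∀ a, 0 ≤ u a) → ∑ a, u a = 1 →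
      quadEdge p b (∑ a, u a • p a) = 0 → u (b + 2) = 0 ∧ u (b + 3) = 0 := by
    intro u hu hu1 hub
    rw [quadEdge_sum p b u hu1] at hub
    have := (Finset.sum_eq_zero_iff_of_nonneg fun a _ =>
      mul_nonneg (hu a) (quadEdge_vertex_nonneg hp b a)).1 hub
    exact ⟨(mul_eq_zero.1 (this (b + 2) (Finset.mem_univ _))).resolve_right
      (quadEdge_add_two hp b).ne', (mul_eq_zero.1 (this (b + 3) (Finset.mem_univ _))).resolve_right
      (quadEdge_add_three hp b).ne'⟩
  obtain ⟨w2, w3⟩ := main w hw hw1 hb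
  obtain ⟨v2, v3⟩ := main v hv hv1 (h ▸ hb)
  have hne := quad_vertex_ne hp b
  have split : ∀ {E : Type} [AddCommMonoid E] (f : Fin 4 → E),
      ∑ a, f a = f b + f (b + 1) + f (b + 2) + f (b + 3) := by
    intro E _ f
    rw [Fin.sum_univ_four]
    clear * -
    fin_cases b <;> simp <;> abel
  rw [split, w2, w3] at hw1
  rw [split, v2, v3] at hv1
  rw [split, split, w2, w3, v2, v3] at h
  have h0 : w b = v b := by
    have h5 : (w b - v b) • (p b - p (b + 1)) = 0 := by
      have e1 : w (b + 1) = 1 - w b := by linarith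
      have e2 : v (b + 1) = 1 - v b := by linarith
      rw [e1, e2] at h
      simp only [zero_smul, add_zero] at h
      have : (w b - v b) • (p b - p (b + 1)) =
        (w b • p b + (1 - w b) • p (b + 1)) - (v b • p b + (1 - v b) • p (b + 1)) := by module
      rw [this, h, sub_self]
    rcases smul_eq_zero.1 h5 with h6 | h6
    · linarith
    · exact absurd (sub_eq_zero.1 h6) hne
  funext a
  obtain h | h | h | h : a = b ∨ a = b + 1 ∨ a = b + 2 ∨ a = b + 3 := by
    clear * -; revert a b; decide
  all_goals (subst h; linarith)


theorem abs_cross_le (u v : Plane) : |cross u v| ≤ ‖u‖ * ‖v‖ := by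
  rw [EuclideanSpace.norm_eq, EuclideanSpace.norm_eq, ← Real.sqrt_mul (by positivity)]
  apply Real.abs_le_sqrt
  simp only [cross, Fin.sum_univ_two, Real.norm_eq_abs, sq_abs]
  nlinarith [sq_nonneg (u 0 * v 0 + u 1 * v 1)]

/-- The bilinear map from the reference square onto a quadrilateral. -/
def quadMap (p : Fin 4 → Plane) (ξ : ℝ × ℝ) : Plane := ∑ a, shape a ξ • p a

/-- First column of the Jacobian of the bilinear map. -/
def quadCol₁ (p : Fin 4 → Plane) (ξ : ℝ × ℝ) : Plane :=
  (1 - ξ.2) • (p 1 - p 0) + ξ.2 • (p 2 - p 3)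

/-- Second column of the Jacobian of the bilinear map. -/
def quadCol₂ (p : Fin 4 → Plane) (ξ : ℝ × ℝ) : Plane :=
  (1 - ξ.1) • (p 3 - p 0) + ξ.1 • (p 2 - p 1)

/-- For a polynomial of degree two, the derivative at the midpoint gives increments exactly. A lower
bound of the Jacobian determinant thus yields a global Lipschitz bound of the inverse. -/
theorem quadMap_sub (p : Fin 4 → Plane) (ξ η : ℝ × ℝ) :
    quadMap p ξ - quadMap p η =
      (ξ.1 - η.1) • quadCol₁ p ((1 / 2 : ℝ) • (ξ + η)) +
        (ξ.2 - η.2) • quadCol₂ p ((1 / 2 : ℝ) • (ξ + η)) := by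
  simp only [quadMap, quadCol₁, quadCol₂, Fin.sum_univ_four, shape]
  simp
  module

/-- Both columns vary along the same vector `p 0 - p 1 + p 2 - p 3`, so the mixed term of the
determinant cancels. It is affine, and therefore interpolated from its corner values, which
convexity makes positive. -/
theorem cross_quadCol (p : Fin 4 → Plane) (ξ : ℝ × ℝ) :
    cross (quadCol₁ p ξ) (quadCol₂ p ξ) =
      ∑ a, shape a ξ * cross (p (a + 1) - p a) (p (a + 3) - p a) := by
  simp only [quadCol₁, quadCol₂, Fin.sum_univ_four, shape, cross, PiLp.sub_apply, PiLp.add_apply,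
    PiLp.smul_apply, smul_eq_mul, Fin.isValue, show (3 : Fin 4) + 1 = 0 from rfl,
    show (3 : Fin 4) + 3 = 2 from rfl, show (1 : Fin 4) + 1 = 2 from rfl,
    show (1 : Fin 4) + 3 = 0 from rfl, show (2 : Fin 4) + 1 = 3 from rfl,
    show (2 : Fin 4) + 3 = 1 from rfl, zero_add]
  simp
  ring

theorem exists_le_cross_quadCol {p : Fin 4 → Plane} (hp : StrictlyConvexQuad p) :
    ∃ c > 0, ∀ ξ ∈ refSquare, c ≤ cross (quadCol₁ p ξ) (quadCol₂ p ξ) := by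
  have hc : ∀ a, 0 < cross (p (a + 1) - p a) (p (a + 3) - p a) := quadEdge_add_three hp
  obtain ⟨a0, -, ha0⟩ := Finset.exists_min_image Finset.univ
    (fun a => cross (p (a + 1) - p a) (p (a + 3) - p a)) ⟨0, Finset.mem_univ _⟩
  refine ⟨_, hc a0, fun ξ hξ => ?_⟩
  rw [cross_quadCol, ← one_mul (cross _ _), ← shape_sum ξ, Finset.sum_mul]
  exact Finset.sum_le_sum fun a _ =>
    mul_le_mul_of_nonneg_left (ha0 a (Finset.mem_univ a)) (shape_nonneg hξ a)

theorem midpoint_mem_refSquare {ξ η : ℝ × ℝ} (hξ : ξ ∈ refSquare) (hη : η ∈ refSquare) :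
    (1 / 2 : ℝ) • (ξ + η) ∈ refSquare := by
  obtain ⟨⟨h1, h2⟩, h3, h4⟩ := hξ
  obtain ⟨⟨g1, g2⟩, g3, g4⟩ := hη
  refine ⟨⟨?_, ?_⟩, ?_, ?_⟩ <;> simp <;> linarith

/-- The inverse of the bilinear map is Lipschitz continuous. -/
theorem exists_abs_sub_le_quadMap {p : Fin 4 → Plane} (hp : StrictlyConvexQuad p) :
    ∃ C, 0 ≤ C ∧ ∀ ξ ∈ refSquare, ∀ η ∈ refSquare,
      |ξ.1 - η.1| ≤ C * ‖quadMap p ξ - quadMap p η‖ ∧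
      |ξ.2 - η.2| ≤ C * ‖quadMap p ξ - quadMap p η‖ := by
  obtain ⟨c, hc0, hc⟩ := exists_le_cross_quadCol hp
  set R := ‖p 1 - p 0‖ + ‖p 2 - p 3‖ + ‖p 3 - p 0‖ + ‖p 2 - p 1‖ with hR
  have bound : ∀ (t : ℝ) (u v : Plane), t ∈ Icc (0 : ℝ) 1 → ‖(1 - t) • u + t • v‖ ≤ ‖u‖ + ‖v‖ := by
    intro t u v ht
    refine (norm_add_le _ _).trans (add_le_add ?_ ?_)
    · rw [norm_smul, Real.norm_eq_abs, abs_of_nonneg (sub_nonneg.2 ht.2)]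
      exact mul_le_of_le_one_left (norm_nonneg _) (by linarith [ht.1])
    · rw [norm_smul, Real.norm_eq_abs, abs_of_nonneg ht.1]
      exact mul_le_of_le_one_left (norm_nonneg _) ht.2
  refine ⟨R / c, by positivity, fun ξ hξ η hη => ?_⟩
  have hm := midpoint_mem_refSquare hξ hη
  have hdet := hc _ hm
  have hsub := quadMap_sub p ξ η
  set μ := (1 / 2 : ℝ) • (ξ + η)
  have hb1 : ‖quadCol₁ p μ‖ ≤ R := (bound _ _ _ hm.2).trans (by
    rw [hR]; linarith [norm_nonneg (p 3 - p 0), norm_nonneg (p 2 - p 1)])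
  have hb2 : ‖quadCol₂ p μ‖ ≤ R := (bound _ _ _ hm.1).trans (by
    rw [hR]; linarith [norm_nonneg (p 1 - p 0), norm_nonneg (p 2 - p 3)])
  -- Cramer's rule: the cross product of the increment with one column isolates the coefficient of
  -- the other.
  have key : ∀ (s : ℝ) (v : Plane), ‖v‖ ≤ R →
      |s * cross (quadCol₁ p μ) (quadCol₂ p μ)| = |cross (quadMap p ξ - quadMap p η) v| →
      |s| ≤ R / c * ‖quadMap p ξ - quadMap p η‖ := by
    intro s v hv hs
    rw [abs_mul, abs_of_pos (hc0.trans_le hdet)] at hs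
    have h1 := mul_le_mul_of_nonneg_left hdet (abs_nonneg s)
    have h2 := abs_cross_le (quadMap p ξ - quadMap p η) v
    have h3 := mul_le_mul_of_nonneg_left hv (norm_nonneg (quadMap p ξ - quadMap p η))
    rw [div_mul_eq_mul_div, le_div_iff₀ hc0]
    linarith
  constructor
  · apply key _ _ hb2
    rw [hsub]; congr 1
    simp only [cross, PiLp.add_apply, PiLp.smul_apply, smul_eq_mul]; ring
  · apply key _ _ hb1
    rw [hsub, ← abs_neg]; congr 1
    simp only [cross, PiLp.add_apply, PiLp.smul_apply, smul_eq_mul]; ring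

theorem abs_shape_sub_le {ξ η : ℝ × ℝ} (hξ : ξ ∈ refSquare) (hη : η ∈ refSquare) (a : Fin 4) :
    |shape a ξ - shape a η| ≤ |ξ.1 - η.1| + |ξ.2 - η.2| := by
  have main : ∀ s t s' t' : ℝ, s ∈ Icc (0 : ℝ) 1 → t' ∈ Icc (0 : ℝ) 1 →
      |s * t - s' * t'| ≤ |s - s'| + |t - t'| := by
    intro s t s' t' hs ht
    have : s * t - s' * t' = (s - s') * t' + s * (t - t') := by ring
    rw [this]
    refine (abs_add_le _ _).trans (add_le_add ?_ ?_)
    · rw [abs_mul, abs_of_nonneg ht.1]; exact mul_le_of_le_one_right (abs_nonneg _) ht.2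
    · rw [abs_mul, abs_of_nonneg hs.1]; exact mul_le_of_le_one_left (abs_nonneg _) hs.2
  have e1 : |(1 - ξ.1) - (1 - η.1)| = |ξ.1 - η.1| := by rw [← abs_neg]; congr 1; ring
  have e2 : |(1 - ξ.2) - (1 - η.2)| = |ξ.2 - η.2| := by rw [← abs_neg]; congr 1; ring
  obtain ⟨⟨h1, h2⟩, h3, h4⟩ := hξ
  obtain ⟨⟨g1, g2⟩, g3, g4⟩ := hη
  have i1 : ξ.1 ∈ Icc (0 : ℝ) 1 := ⟨h1, h2⟩
  have i2 : 1 - ξ.1 ∈ Icc (0 : ℝ) 1 := ⟨by simpa using h2, by simpa using h1⟩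
  have i3 : η.2 ∈ Icc (0 : ℝ) 1 := ⟨g3, g4⟩
  have i4 : 1 - η.2 ∈ Icc (0 : ℝ) 1 := ⟨by simpa using g4, by simpa using g3⟩
  fin_cases a
  · have := main (1 - ξ.1) (1 - ξ.2) (1 - η.1) (1 - η.2) i2 i4
    rwa [e1, e2] at this
  · have := main (ξ.1) (1 - ξ.2) (η.1) (1 - η.2) i1 i4
    rwa [e2] at this
  · exact main (ξ.1) (ξ.2) (η.1) (η.2) i1 i3
  · have := main (1 - ξ.1) (ξ.2) (1 - η.1) (η.2) i2 i3
    rwa [e1] at this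

theorem contDiff_shape (a : Fin 4) : ContDiff ℝ (⊤ : ℕ∞) (shape a) := by
  fin_cases a
  · change ContDiff ℝ _ fun ξ : ℝ × ℝ => (1 - ξ.1) * (1 - ξ.2); fun_prop
  · change ContDiff ℝ _ fun ξ : ℝ × ℝ => ξ.1 * (1 - ξ.2); fun_prop
  · change ContDiff ℝ _ fun ξ : ℝ × ℝ => ξ.1 * ξ.2; fun_prop
  · change ContDiff ℝ _ fun ξ : ℝ × ℝ => (1 - ξ.1) * ξ.2; fun_prop

/-- The derivative has to be an equivalence for `refInv`, known to be a continuous local inverse, to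
inherit strict differentiability. -/
theorem quadMap_hasStrictFDerivAt {p : Fin 4 → Plane} (hp : StrictlyConvexQuad p) {ξ : ℝ × ℝ}
    (hξ : ξ ∈ refSquare) :
    ∃ e : (ℝ × ℝ) ≃L[ℝ] Plane, HasStrictFDerivAt (quadMap p) (e : (ℝ × ℝ) →L[ℝ] Plane) ξ := by
  set A : (ℝ × ℝ) →L[ℝ] Plane :=
    (ContinuousLinearMap.fst ℝ ℝ ℝ).smulRight (quadCol₁ p ξ) +
      (ContinuousLinearMap.snd ℝ ℝ ℝ).smulRight (quadCol₂ p ξ) with hA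
  have hinj : Function.Injective A := by
    rw [injective_iff_map_eq_zero]
    rintro ⟨h1, h2⟩ h
    obtain ⟨c, hc0, hc⟩ := exists_le_cross_quadCol hp
    have hd := hc0.trans_le (hc ξ hξ)
    have k0 := congrArg (fun v : Plane => cross v (quadCol₂ p ξ)) h
    have k1 := congrArg (fun v : Plane => cross v (quadCol₁ p ξ)) h
    simp only [hA, cross, add_apply, ContinuousLinearMap.smulRight_apply,
      ContinuousLinearMap.coe_fst', ContinuousLinearMap.coe_snd', PiLp.add_apply, PiLp.smul_apply,
      smul_eq_mul, PiLp.zero_apply, zero_mul, sub_zero] at k0 k1 hd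
    have e1 : h1 * cross (quadCol₁ p ξ) (quadCol₂ p ξ) = 0 := by
      simp only [cross]; linear_combination k0
    have e2 : h2 * cross (quadCol₁ p ξ) (quadCol₂ p ξ) = 0 := by
      simp only [cross]; linear_combination -k1
    have hne : cross (quadCol₁ p ξ) (quadCol₂ p ξ) ≠ 0 := by simp only [cross]; exact hd.ne'
    ext
    · simpa [hne] using e1
    · simpa [hne] using e2
  have hfin : Module.finrank ℝ (ℝ × ℝ) = Module.finrank ℝ Plane := by simp
  refine ⟨(LinearEquiv.ofInjectiveOfFinrankEq A.toLinearMap hinj hfin).toContinuousLinearEquiv, ?_⟩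
  have hA' : ((LinearEquiv.ofInjectiveOfFinrankEq A.toLinearMap hinj hfin).toContinuousLinearEquiv
      : (ℝ × ℝ) →L[ℝ] Plane) = A := by
    ext <;> rfl
  rw [hA']
  have hcd : ContDiff ℝ (⊤ : ℕ∞) (quadMap p) := by
    unfold quadMap
    exact ContDiff.sum fun a _ => (contDiff_shape a).smul contDiff_const
  have hs := hcd.contDiffAt.hasStrictFDerivAt (x := ξ) (by simp)
  have hder : fderiv ℝ (quadMap p) ξ = A := by
    apply HasFDerivAt.fderiv
    have h1 : HasFDerivAt (fun ζ : ℝ × ℝ => ζ.1) (ContinuousLinearMap.fst ℝ ℝ ℝ) ξ := hasFDerivAt_fst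
    have h2 : HasFDerivAt (fun ζ : ℝ × ℝ => ζ.2) (ContinuousLinearMap.snd ℝ ℝ ℝ) ξ := hasFDerivAt_snd
    have h3 := ((((h1.const_sub 1).mul (h2.const_sub 1)).smul_const (p 0)).add
      ((h1.mul (h2.const_sub 1)).smul_const (p 1))).add
      (((h1.mul h2).smul_const (p 2)).add (((h1.const_sub 1).mul h2).smul_const (p 3)))
    have h4 : HasFDerivAt (quadMap p) _ ξ := h3.congr_of_eventuallyEq <|
      Filter.Eventually.of_forall fun ζ => by
        simp only [quadMap, Fin.sum_univ_four, shape]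
        simp
        abel
    refine h4.congr_fderiv ?_
    rw [hA]
    ext <;> simp [quadCol₁, quadCol₂] <;> ring
  rwa [hder] at hs


/-! ### Nodal functions of the mesh: consistency, partition of unity, regularity -/

namespace Geometry

variable {J N ι : Type*} (G : Geometry J N ι)

theorem strictlyConvexQuad (j : J) : StrictlyConvexQuad (G.pos ∘ G.vert j) := G.strictly_convex j

theorem vert_injective (j : J) : Function.Injective (G.vert j) :=
  fun a b h => quad_vertex_injective (G.strictlyConvexQuad j) (congrArg G.pos h)

theorem convex_K (j : J) : Convex ℝ (G.K j) := convex_convexHull ℝ _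

theorem isCompact_K (j : J) : IsCompact (G.K j) :=
  Set.Finite.isCompact_convexHull ℝ (finite_range _)

theorem isClosed_K (j : J) : IsClosed (G.K j) := (G.isCompact_K j).isClosed

theorem interior_K_nonempty (j : J) : (interior (G.K j)).Nonempty := by
  have hp := G.strictlyConvexQuad j
  have h1 : ∑ _a : Fin 4, (1 / 4 : ℝ) = 1 := by norm_num
  refine ⟨∑ a : Fin 4, (1 / 4 : ℝ) • (G.pos ∘ G.vert j) a,
    (mem_interior_quad_iff hp).2 fun b => ?_⟩
  rw [quadEdge_sum _ b _ h1]
  refine Finset.sum_pos' (fun a _ => mul_nonneg (by norm_num) (quadEdge_vertex_nonneg hp b a))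
    ⟨b + 2, Finset.mem_univ _, mul_pos (by norm_num) (quadEdge_add_two hp b)⟩

theorem closure_interior_K (j : J) : closure (interior (G.K j)) = G.K j := by
  rw [(G.convex_K j).closure_interior_eq_closure_of_nonempty_interior (G.interior_K_nonempty j),
    (G.isClosed_K j).closure_eq]

/-- `K_j` is the closure of its interior, so an open set that contains `x` also meets the interior
of `K_j`, which is disjoint from that of `K_i`. -/
theorem notMem_interior_of_mem {i j : J} (hij : i ≠ j) {x : Plane} (hx : x ∈ G.K j) :
    x ∉ interior (G.K i) := by
  intro hi
  rw [← G.closure_interior_K j] at hx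
  obtain ⟨y, hyi, hyj⟩ := mem_closure_iff.1 hx _ isOpen_interior hi
  exact (Set.disjoint_left.1 (G.interior_disjoint i j hij)) hyi hyj

theorem refInv_mem {j : J} {x : Plane} (hx : x ∈ G.K j) : G.refInv j x ∈ refSquare := by
  obtain ⟨ξ, hξ, h⟩ := exists_shape_eq_of_mem_quad (G.strictlyConvexQuad j) hx
  exact Function.invFunOn_mem ⟨ξ, hξ, h⟩

theorem quadMap_refInv {j : J} {x : Plane} (hx : x ∈ G.K j) :
    quadMap (G.pos ∘ G.vert j) (G.refInv j x) = x := by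
  obtain ⟨ξ, hξ, h⟩ := exists_shape_eq_of_mem_quad (G.strictlyConvexQuad j) hx
  exact Function.invFunOn_eq (f := G.refMap j) ⟨ξ, hξ, h⟩

open Classical in
/-- The nodal function of the node `k`, computed in the element `j`. -/
def hatOn (j : J) (k : N) (x : Plane) : ℝ :=
  ∑ a, if G.vert j a = k then shape a (G.refInv j x) else 0

theorem hatOn_vert (j : J) (a : Fin 4) (x : Plane) :
    G.hatOn j (G.vert j a) x = shape a (G.refInv j x) := by
  rw [hatOn, Finset.sum_eq_single a]
  · simp
  · intro b _ hb
    rw [if_neg fun h => hb (G.vert_injective j h)]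
  · simp

theorem hatOn_eq_zero {j : J} {k : N} (hk : k ∉ range (G.vert j)) (x : Plane) :
    G.hatOn j k x = 0 :=
  Finset.sum_eq_zero fun a _ => if_neg fun h => hk ⟨a, h⟩

theorem sum_eq_sum_vert [Fintype N] {E : Type*} [AddCommMonoid E] {i : J} {f : N → E}
    (h : ∀ k, k ∉ range (G.vert i) → f k = 0) : ∑ k, f k = ∑ a, f (G.vert i a) := by
  classical
  rw [← Finset.sum_image (f := f) (s := Finset.univ) (g := G.vert i)
    fun a _ b _ h => G.vert_injective i h]
  symm
  apply Finset.sum_subset (Finset.subset_univ _)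
  intro k _ hk
  exact h k fun ⟨a, ha⟩ => hk (Finset.mem_image.2 ⟨a, Finset.mem_univ _, ha⟩)

theorem hatOn_eq_weight [Fintype N] {i : J} {x : Plane} (hx : x ∈ G.K i)
    (hxi : x ∉ interior (G.K i)) {w : N → ℝ} (h0 : ∀ k, 0 ≤ w k)
    (hw : ∀ k, k ∉ range (G.vert i) → w k = 0) (h1 : ∑ k, w k = 1)
    (h2 : ∑ k, w k • G.pos k = x) (k : N) : G.hatOn i k x = w k := by
  have key : (fun a => shape a (G.refInv i x)) = fun a => w (G.vert i a) := by
    have e := G.quadMap_refInv hx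
    rw [quadMap] at e
    have e2 : ∑ a, w (G.vert i a) • (G.pos ∘ G.vert i) a = x := by
      rw [← h2, G.sum_eq_sum_vert (i := i)]
      · rfl
      · intro k hk; rw [hw k hk, zero_smul]
    apply weights_eq_of_notMem_interior (G.strictlyConvexQuad i)
      (shape_nonneg (G.refInv_mem hx)) (fun a => h0 _) (shape_sum _)
    · rw [← h1, G.sum_eq_sum_vert hw]
    · rw [e, e2]
    · rw [e]; exact hxi
  by_cases hk : k ∈ range (G.vert i)
  · obtain ⟨a, rfl⟩ := hk
    rw [hatOn_vert]
    exact congrFun key a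
  · rw [G.hatOn_eq_zero hk, hw k hk]

/-- By conformity a common point is a convex combination of common vertices. It lies on both
boundaries, where weights are unique, so both elements compute these weights. Hence the arbitrary
choice in `hat` is harmless. -/
theorem hatOn_eq_hatOn [Fintype N] {i j : J} {x : Plane} (hi : x ∈ G.K i) (hj : x ∈ G.K j)
    (k : N) : G.hatOn i k x = G.hatOn j k x := by
  by_cases hij : i = j
  · rw [hij]
  have hmem : x ∈ convexHull ℝ (G.pos '' (range (G.vert i) ∩ range (G.vert j))) := by
    rw [← G.conforming i j hij]; exact ⟨hi, hj⟩
  obtain ⟨w, h0, hw, h1, h2⟩ := exists_weights_of_mem_convexHull_image hmem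
  rw [G.hatOn_eq_weight hi (G.notMem_interior_of_mem hij hj) h0
      (fun k hk => hw k fun h => hk h.1) h1 h2,
    G.hatOn_eq_weight hj (G.notMem_interior_of_mem (Ne.symm hij) hi) h0
      (fun k hk => hw k fun h => hk h.2) h1 h2]

theorem hat_eq_hatOn [Fintype N] {j : J} {x : Plane} (hx : x ∈ G.K j) (k : N) :
    G.hat k x = G.hatOn j k x := by
  have h : ∃ j, x ∈ G.K j := ⟨j, hx⟩
  rw [← G.hatOn_eq_hatOn h.choose_spec hx, hat, dif_pos h]
  rfl

theorem hat_vert [Fintype N] {j : J} {x : Plane} (hx : x ∈ G.K j) (a : Fin 4) :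
    G.hat (G.vert j a) x = shape a (G.refInv j x) := by
  rw [G.hat_eq_hatOn hx, hatOn_vert]

theorem hat_eq_zero_of_notMem_range [Fintype N] {j : J} {x : Plane} (hx : x ∈ G.K j) {k : N}
    (hk : k ∉ range (G.vert j)) : G.hat k x = 0 := by
  rw [G.hat_eq_hatOn hx, G.hatOn_eq_zero hk]

theorem hat_eq_zero_of_forall_notMem {x : Plane} (hx : ∀ j, x ∉ G.K j) (k : N) :
    G.hat k x = 0 := by
  rw [hat, dif_neg (by simpa using hx)]

theorem hat_nonneg [Fintype N] (k : N) (x : Plane) : 0 ≤ G.hat k x := by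
  by_cases h : ∃ j, x ∈ G.K j
  · obtain ⟨j, hj⟩ := h
    by_cases hk : k ∈ range (G.vert j)
    · obtain ⟨a, rfl⟩ := hk
      rw [G.hat_vert hj]; exact shape_nonneg (G.refInv_mem hj) a
    · rw [G.hat_eq_zero_of_notMem_range hj hk]
  · rw [G.hat_eq_zero_of_forall_notMem (by simpa using h)]

theorem sum_hat [Fintype N] {j : J} {x : Plane} (hx : x ∈ G.K j) : ∑ k, G.hat k x = 1 := by
  rw [G.sum_eq_sum_vert (i := j) fun k hk => G.hat_eq_zero_of_notMem_range hx hk,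
    ← shape_sum (G.refInv j x)]
  exact Finset.sum_congr rfl fun a _ => G.hat_vert hx a

theorem sum_hat_smul [Fintype N] {j : J} {x : Plane} (hx : x ∈ G.K j) :
    ∑ k, G.hat k x • G.pos k = x := by
  rw [G.sum_eq_sum_vert (i := j) fun k hk => by
    rw [G.hat_eq_zero_of_notMem_range hx hk, zero_smul]]
  conv_rhs => rw [← G.quadMap_refInv hx]
  exact Finset.sum_congr rfl fun a _ => by rw [G.hat_vert hx a]; rfl

theorem sum_hat_le_one [Fintype N] (s : Finset N) (x : Plane) : ∑ k ∈ s, G.hat k x ≤ 1 := by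
  by_cases h : ∃ j, x ∈ G.K j
  · obtain ⟨j, hj⟩ := h
    rw [← G.sum_hat hj]
    exact Finset.sum_le_sum_of_subset_of_nonneg (Finset.subset_univ _)
      fun k _ _ => G.hat_nonneg k x
  · simp [G.hat_eq_zero_of_forall_notMem (by simpa using h)]

theorem hat_le_one [Fintype N] (k : N) (x : Plane) : G.hat k x ≤ 1 := by
  simpa using G.sum_hat_le_one {k} x

theorem hat_pos_of_mem_interior [Fintype N] {j : J} {x : Plane} (hx : x ∈ interior (G.K j))
    (a : Fin 4) : 0 < G.hat (G.vert j a) x := by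
  have hm := _root_.interior_subset hx
  rw [G.hat_vert hm]
  apply shape_pos_of_mem_interior (G.strictlyConvexQuad j) (G.refInv_mem hm)
  have := G.quadMap_refInv hm
  rw [quadMap] at this
  rw [this]
  exact hx

theorem exists_refInv_lipschitz (j : J) : ∃ C, 0 ≤ C ∧ ∀ x ∈ G.K j, ∀ y ∈ G.K j,
    |(G.refInv j x).1 - (G.refInv j y).1| ≤ C * ‖x - y‖ ∧
    |(G.refInv j x).2 - (G.refInv j y).2| ≤ C * ‖x - y‖ := by
  obtain ⟨C, hC, h⟩ := exists_abs_sub_le_quadMap (G.strictlyConvexQuad j)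
  refine ⟨C, hC, fun x hx y hy => ?_⟩
  have := h _ (G.refInv_mem hx) _ (G.refInv_mem hy)
  rwa [G.quadMap_refInv hx, G.quadMap_refInv hy] at this

theorem exists_hat_lipschitz [Fintype J] [Fintype N] : ∃ C, 0 ≤ C ∧ ∀ j, ∀ x ∈ G.K j,
    ∀ y ∈ G.K j, ∀ k, |G.hat k x - G.hat k y| ≤ C * ‖x - y‖ := by
  choose C hC h using G.exists_refInv_lipschitz
  have hS : ∀ j, C j ≤ ∑ j, C j :=
    fun j => Finset.single_le_sum (fun i _ => hC i) (Finset.mem_univ j)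
  have hS0 : 0 ≤ ∑ j, C j := Finset.sum_nonneg fun i _ => hC i
  refine ⟨2 * ∑ j, C j, by positivity, fun j x hx y hy k => ?_⟩
  by_cases hk : k ∈ range (G.vert j)
  · obtain ⟨a, rfl⟩ := hk
    rw [G.hat_vert hx, G.hat_vert hy]
    have h1 := abs_shape_sub_le (G.refInv_mem hx) (G.refInv_mem hy) a
    have h2 := h j x hx y hy
    have h3 := mul_le_mul_of_nonneg_right (hS j) (norm_nonneg (x - y))
    linarith [h2.1, h2.2]
  · rw [G.hat_eq_zero_of_notMem_range hx hk, G.hat_eq_zero_of_notMem_range hy hk]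
    simp; positivity

theorem exists_mem_K {x : Plane} (hx : x ∈ G.Ω) : ∃ j, x ∈ G.K j := by
  have : x ∈ ⋃ j, quad (G.pos ∘ G.vert j) := by rw [G.cover]; exact subset_closure hx
  exact mem_iUnion.1 this

theorem eventually_mem_imp_mem [Finite J] (x : Plane) :
    ∀ᶠ y in nhds x, ∀ j, y ∈ G.K j → x ∈ G.K j := by
  rw [Filter.eventually_all]
  intro j
  by_cases hx : x ∈ G.K j
  · exact Filter.Eventually.of_forall fun y _ => hx
  · filter_upwards [(G.isClosed_K j).isOpen_compl.mem_nhds hx] with y hy h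
    exact absurd h hy

/-- Elements that miss `x` are closed and finite in number, so near `x` only elements through `x`
occur. Bounds inside single elements become bounds in a neighbourhood. -/
theorem eventually_exists_common_element [Finite J] {x : Plane} (hx : x ∈ G.Ω) :
    ∀ᶠ y in nhds x, ∃ j, x ∈ G.K j ∧ y ∈ G.K j := by
  filter_upwards [G.eventually_mem_imp_mem x, G.isOpen_Ω.mem_nhds hx] with y hy hyΩ
  obtain ⟨j, hj⟩ := G.exists_mem_K hyΩ
  exact ⟨j, hy j hj, hj⟩

/-- The constant is uniform but the estimate is local: `Ω` need not be convex, and two of its points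
need not be joined by a segment inside it. -/
theorem exists_hat_pointwise_lipschitz [Fintype J] [Fintype N] : ∃ C, 0 ≤ C ∧ ∀ x ∈ G.Ω,
    ∀ᶠ y in nhds x, ∀ k, |G.hat k y - G.hat k x| ≤ C * ‖y - x‖ := by
  obtain ⟨C, hC, h⟩ := G.exists_hat_lipschitz
  refine ⟨C, hC, fun x hx => ?_⟩
  filter_upwards [G.eventually_exists_common_element hx] with y ⟨j, hxj, hyj⟩ k
  exact h j y hyj x hxj k

/-- Strict differentiability is needed later because gradients of mollifications average over a
ball, and they converge pointwise where the derivative is strict. -/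
theorem exists_hasStrictFDerivAt_hat [Fintype J] [Fintype N] {j : J} {x : Plane}
    (hx : x ∈ interior (G.K j)) (k : N) : ∃ f' : Plane →L[ℝ] ℝ,
      HasStrictFDerivAt (G.hat k) f' x := by
  have hm := _root_.interior_subset hx
  have hnhds : G.K j ∈ nhds x := mem_interior_iff_mem_nhds.1 hx
  by_cases hk : k ∈ range (G.vert j)
  · obtain ⟨a, rfl⟩ := hk
    obtain ⟨e, he⟩ := quadMap_hasStrictFDerivAt (G.strictlyConvexQuad j) (G.refInv_mem hm)
    have hcont : ContinuousAt (G.refInv j) x := by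
      obtain ⟨C, hC, h⟩ := G.exists_refInv_lipschitz j
      have : LipschitzOnWith ⟨C, hC⟩ (G.refInv j) (G.K j) := by
        apply LipschitzOnWith.of_dist_le_mul
        intro y hy z hz
        rw [Prod.dist_eq, dist_eq_norm y z]
        exact max_le (h y hy z hz).1 (h y hy z hz).2
      exact this.continuousOn.continuousAt hnhds
    have h1 := he.of_local_left_inverse hcont
      (Filter.eventually_of_mem hnhds fun y hy => G.quadMap_refInv hy)
    have h2 := (contDiff_shape a).contDiffAt.hasStrictFDerivAt (x := G.refInv j x) (by simp)
    refine ⟨_, (h2.comp x h1).congr_of_eventuallyEq ?_⟩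
    filter_upwards [hnhds] with y hy
    exact (G.hat_vert hy a).symm
  · refine ⟨0, (hasStrictFDerivAt_const (0 : ℝ) x).congr_of_eventuallyEq ?_⟩
    filter_upwards [hnhds] with y hy
    exact (G.hat_eq_zero_of_notMem_range hy hk).symm

theorem hat_eventuallyEq_zero [Fintype N] {j : J} {x : Plane} (hx : x ∈ interior (G.K j)) {k : N}
    (hk : k ∉ range (G.vert j)) : G.hat k =ᶠ[nhds x] fun _ => 0 := by
  filter_upwards [mem_interior_iff_mem_nhds.1 hx] with y hy
  exact G.hat_eq_zero_of_notMem_range hy hk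

/-! ### Cutoff functions and bubble functions -/

open Classical in
/-- The nodes of the elements in `P`. -/
def nodesOf [Fintype N] (P : Set J) : Finset N :=
  Finset.univ.filter fun k => ∃ i ∈ P, k ∈ range (G.vert i)

/-- The sum of the nodal functions of the nodes of the elements in `P`. -/
def cutoff [Fintype N] (P : Set J) (x : Plane) : ℝ := ∑ k ∈ G.nodesOf P, G.hat k x

theorem mem_nodesOf [Fintype N] {P : Set J} {k : N} :
    k ∈ G.nodesOf P ↔ ∃ i ∈ P, k ∈ range (G.vert i) := by
  simp [nodesOf]

theorem cutoff_nonneg [Fintype N] (P : Set J) (x : Plane) : 0 ≤ G.cutoff P x :=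
  Finset.sum_nonneg fun k _ => G.hat_nonneg k x

theorem cutoff_le_one [Fintype N] (P : Set J) (x : Plane) : G.cutoff P x ≤ 1 :=
  G.sum_hat_le_one _ x

theorem cutoff_eq_one [Fintype N] {P : Set J} {i : J} (hi : i ∈ P) {x : Plane} (hx : x ∈ G.K i) :
    G.cutoff P x = 1 := by
  rw [← G.sum_hat hx, cutoff]
  refine Finset.sum_subset (Finset.subset_univ _) fun k _ hk =>
    G.hat_eq_zero_of_notMem_range hx fun h => hk (G.mem_nodesOf.2 ⟨i, hi, h⟩)

/-- A nodal function that does not vanish on `K_i` belongs to a vertex of `K_i`; here it also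
belongs to an element of `P`, so the two elements touch at that vertex. -/
theorem exists_common_of_cutoff_ne_zero [Fintype N] {P : Set J} {i : J} {x : Plane}
    (hx : x ∈ G.K i) (h : G.cutoff P x ≠ 0) : ∃ i' ∈ P, (G.K i ∩ G.K i').Nonempty := by
  obtain ⟨k, hk, hne⟩ := Finset.exists_ne_zero_of_sum_ne_zero h
  obtain ⟨i', hi', b, rfl⟩ := G.mem_nodesOf.1 hk
  by_cases hki : G.vert i' b ∈ range (G.vert i)
  · obtain ⟨a, ha⟩ := hki
    refine ⟨i', hi', G.pos (G.vert i' b), ?_, subset_convexHull ℝ _ ⟨b, rfl⟩⟩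
    rw [← ha]
    exact subset_convexHull ℝ _ ⟨a, rfl⟩
  · exact absurd (G.hat_eq_zero_of_notMem_range hx hki) hne

theorem mem_interior_patchSet_of_cutoff_pos [Fintype J] [Fintype N] {j : J} {m : ℕ} {x : Plane}
    (hx : x ∈ G.Ω) (h : 0 < G.cutoff (G.patch j m) x) :
    x ∈ interior (G.patchSet j (m + 1)) ∩ G.Ω := by
  refine ⟨mem_interior_iff_mem_nhds.2 ?_, hx⟩
  filter_upwards [G.eventually_exists_common_element hx] with y ⟨i, hxi, hyi⟩
  exact mem_biUnion (x := i) (G.exists_common_of_cutoff_ne_zero hxi h.ne') hyi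

theorem patch_subset_succ (j : J) (m : ℕ) : G.patch j m ⊆ G.patch j (m + 1) := by
  intro i hi
  refine ⟨i, hi, ?_⟩
  rw [inter_self]
  exact (G.interior_K_nonempty i).mono _root_.interior_subset

theorem mem_patch_self (j : J) (m : ℕ) : j ∈ G.patch j m := by
  induction m with
  | zero => exact rfl
  | succ m ih => exact G.patch_subset_succ j m ih

theorem bubble_nonneg [Fintype N] (j : J) (x : Plane) : 0 ≤ G.bubble j x :=
  Finset.prod_nonneg fun a _ => G.hat_nonneg _ x

theorem bubble_le_one [Fintype N] (j : J) (x : Plane) : G.bubble j x ≤ 1 :=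
  Finset.prod_le_one (fun a _ => G.hat_nonneg _ x) fun a _ => G.hat_le_one _ x

theorem bubble_pos_of_mem_interior [Fintype N] {j : J} {x : Plane} (hx : x ∈ interior (G.K j)) :
    0 < G.bubble j x :=
  Finset.prod_pos fun a _ => G.hat_pos_of_mem_interior hx a

/-- Otherwise `K_j ⊆ K_i`, against disjointness of the interiors. It follows that one factor of the
bubble function of `K_j` vanishes on every other element. -/
theorem exists_vert_notMem_range {i j : J} (hij : i ≠ j) : ∃ a, G.vert j a ∉ range (G.vert i) := by
  by_contra! h
  have hsub : G.K j ⊆ G.K i := by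
    apply convexHull_mono
    rintro _ ⟨a, rfl⟩
    obtain ⟨b, hb⟩ := h a
    exact ⟨b, congrArg G.pos hb⟩
  obtain ⟨x, hx⟩ := G.interior_K_nonempty j
  exact G.notMem_interior_of_mem (Ne.symm hij) (hsub (_root_.interior_subset hx)) hx

theorem bubble_eq_zero_of_mem [Fintype N] {i j : J} (hij : i ≠ j) {x : Plane} (hx : x ∈ G.K i) :
    G.bubble j x = 0 := by
  obtain ⟨a, ha⟩ := G.exists_vert_notMem_range hij
  exact Finset.prod_eq_zero (Finset.mem_univ a) (G.hat_eq_zero_of_notMem_range hx ha)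

theorem mem_interior_of_bubble_pos [Fintype J] [Fintype N] {j : J} {x : Plane} (hx : x ∈ G.Ω)
    (h : 0 < G.bubble j x) : x ∈ interior (G.K j) := by
  refine mem_interior_iff_mem_nhds.2 ?_
  filter_upwards [G.eventually_exists_common_element hx] with y ⟨i, hxi, hyi⟩
  by_cases hij : i = j
  · subst hij; exact hyi
  · exact absurd (G.bubble_eq_zero_of_mem hij hxi) h.ne'

theorem bubble_eq_zero_of_notMem [Fintype N] {j : J} {x : Plane} (hx : x ∉ G.K j) :
    G.bubble j x = 0 := by
  by_cases h : ∃ i, x ∈ G.K i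
  · obtain ⟨i, hi⟩ := h
    exact G.bubble_eq_zero_of_mem (fun hij => hx (by subst hij; exact hi)) hi
  · exact Finset.prod_eq_zero (Finset.mem_univ 0)
      (G.hat_eq_zero_of_forall_notMem (by simpa using h) _)

end Geometry


/-! ### Points of the matrix and of the fractures -/

/-- A point of the matrix, or a fracture with an arclength parameter. -/
def MixedPt (ι : Type*) : Type _ := Plane ⊕ (ι × ℝ)

namespace MixedPt

variable {ι : Type*}

/-- Fracture indices carry the discrete σ-algebra, so measurability can be checked fracture by
fracture. -/
instance : MeasurableSpace (MixedPt ι) :=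
  letI : MeasurableSpace ι := ⊤
  inferInstanceAs (MeasurableSpace (Plane ⊕ (ι × ℝ)))

/-- A point of the matrix. -/
def mat (x : Plane) : MixedPt ι := Sum.inl x

/-- A point of the fracture `l`. -/
def frac (l : ι) (t : ℝ) : MixedPt ι := Sum.inr (l, t)

/-- Case distinction for functions. -/
def elim {α : Type*} (f : Plane → α) (g : ι → ℝ → α) : MixedPt ι → α :=
  Sum.elim f fun q => g q.1 q.2

@[simp] theorem elim_mat {α : Type*} (f : Plane → α) (g : ι → ℝ → α) (x : Plane) :
    elim f g (mat x) = f x := rfl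

@[simp] theorem elim_frac {α : Type*} (f : Plane → α) (g : ι → ℝ → α) (l : ι) (t : ℝ) :
    elim f g (frac l t) = g l t := rfl

theorem measurableEmbedding_mat : MeasurableEmbedding (mat : Plane → MixedPt ι) := by
  let _ : MeasurableSpace ι := ⊤
  exact ⟨Sum.inl_injective, measurable_inl, fun _ h => measurableSet_inl_image.2 h⟩

theorem measurableEmbedding_frac (l : ι) : MeasurableEmbedding (frac l : ℝ → MixedPt ι) := by
  let _ : MeasurableSpace ι := ⊤
  have h : MeasurableEmbedding (Sum.inr : ι × ℝ → Plane ⊕ (ι × ℝ)) :=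
    ⟨Sum.inr_injective, measurable_inr, fun _ h => measurableSet_inr_image.2 h⟩
  exact h.comp (MeasurableEmbedding.prodMk_left l .id)

theorem measurable_elim [Countable ι] {α : Type*} [MeasurableSpace α] {f : Plane → α}
    {g : ι → ℝ → α} (hf : Measurable f) (hg : ∀ l, Measurable (g l)) :
    Measurable (elim f g) := by
  let _ : MeasurableSpace ι := ⊤
  refine Measurable.sumElim hf ?_
  exact measurable_from_prod_countable_right hg

end MixedPt

namespace Geometry

variable {J N ι : Type*} (G : Geometry J N ι)

open MixedPt

/-- The position in the plane. -/
def pt : MixedPt ι → Plane := MixedPt.elim id G.γ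

@[simp] theorem pt_mat (x : Plane) : G.pt (mat x) = x := rfl

@[simp] theorem pt_frac (l : ι) (t : ℝ) : G.pt (frac l t) = G.γ l t := rfl

theorem continuous_γ (l : ι) : Continuous (G.γ l) := by
  unfold γ; fun_prop

theorem measurable_pt [Countable ι] : Measurable G.pt :=
  measurable_elim measurable_id fun l => (G.continuous_γ l).measurable

/-- Area in the matrix and arclength on the fractures. -/
def mixedVol : Measure (MixedPt ι) :=
  (volume : Measure Plane).map mat +
    Measure.sum fun l => (volume.restrict (Ioo 0 (G.len l))).map (frac l)

/-- Area and arclength, restricted to `S`. -/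
def mixedMeasure (S : Set Plane) : Measure (MixedPt ι) := G.mixedVol.restrict (G.pt ⁻¹' S)

theorem mixedMeasure_eq [Countable ι] (S : Set Plane) : G.mixedMeasure S =
    (volume.restrict S).map mat +
      Measure.sum fun l => (volume.restrict (G.fracIn l S)).map (frac l) := by
  rw [mixedMeasure, mixedVol, Measure.restrict_add, Measure.restrict_sum_of_countable,
    measurableEmbedding_mat.restrict_map]
  congr 2
  funext l
  rw [(measurableEmbedding_frac l).restrict_map, Measure.restrict_restrict' measurableSet_Ioo]
  congr 2
  ext t
  exact and_comm

theorem integrable_mixedMeasure_iff [Fintype ι] {S : Set Plane} {E : Type*} [NormedAddCommGroup E]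
    {f : MixedPt ι → E} : Integrable f (G.mixedMeasure S) ↔
      Integrable (fun x => f (mat x)) (volume.restrict S) ∧
      ∀ l, Integrable (fun t => f (frac l t)) (volume.restrict (G.fracIn l S)) := by
  rw [mixedMeasure_eq, integrable_add_measure, measurableEmbedding_mat.integrable_map_iff,
    Measure.sum_fintype, integrable_finsetSum_measure]
  simp only [(measurableEmbedding_frac _).integrable_map_iff, Finset.mem_univ, true_imp_iff]
  rfl

theorem aestronglyMeasurable_mixedMeasure_iff [Countable ι] {S : Set Plane} {E : Type*}
    [NormedAddCommGroup E] {f : MixedPt ι → E} : AEStronglyMeasurable f (G.mixedMeasure S) ↔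
      AEStronglyMeasurable (fun x => f (mat x)) (volume.restrict S) ∧
      ∀ l, AEStronglyMeasurable (fun t => f (frac l t)) (volume.restrict (G.fracIn l S)) := by
  rw [mixedMeasure_eq, aestronglyMeasurable_add_measure_iff,
    measurableEmbedding_mat.aestronglyMeasurable_map_iff, aestronglyMeasurable_sum_measure_iff]
  simp only [(measurableEmbedding_frac _).aestronglyMeasurable_map_iff]
  rfl

theorem memLp_mixedMeasure_iff [Fintype ι] {S : Set Plane} {E : Type*} [NormedAddCommGroup E]
    {f : MixedPt ι → E} : MemLp f 2 (G.mixedMeasure S) ↔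
      MemLp (fun x => f (mat x)) 2 (volume.restrict S) ∧
      ∀ l, MemLp (fun t => f (frac l t)) 2 (volume.restrict (G.fracIn l S)) := by
  constructor
  · intro h
    have h1 := (G.aestronglyMeasurable_mixedMeasure_iff).1 h.1
    have h2 := (G.integrable_mixedMeasure_iff).1 ((memLp_two_iff_integrable_sq_norm h.1).1 h)
    exact ⟨(memLp_two_iff_integrable_sq_norm h1.1).2 h2.1,
      fun l => (memLp_two_iff_integrable_sq_norm (h1.2 l)).2 (h2.2 l)⟩
  · rintro ⟨h, h'⟩
    have h1 := (G.aestronglyMeasurable_mixedMeasure_iff (f := f)).2 ⟨h.1, fun l => (h' l).1⟩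
    refine (memLp_two_iff_integrable_sq_norm h1).2 ((G.integrable_mixedMeasure_iff).2 ⟨?_, ?_⟩)
    · exact (memLp_two_iff_integrable_sq_norm h.1).1 h
    · exact fun l => (memLp_two_iff_integrable_sq_norm (h' l).1).1 (h' l)

theorem integral_mixedMeasure [Fintype ι] {S : Set Plane} {f : MixedPt ι → ℝ}
    (hf : Integrable f (G.mixedMeasure S)) : ∫ z, f z ∂G.mixedMeasure S =
      (∫ x in S, f (mat x)) + ∑ l, ∫ t in G.fracIn l S, f (frac l t) := by
  have h := (G.integrable_mixedMeasure_iff).1 hf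
  rw [mixedMeasure_eq, Measure.sum_fintype, integral_add_measure,
    measurableEmbedding_mat.integral_map, integral_finsetSum_measure]
  · simp only [(measurableEmbedding_frac _).integral_map]
  · intro l _
    exact ((measurableEmbedding_frac l).integrable_map_iff).2 (h.2 l)
  · exact (measurableEmbedding_mat.integrable_map_iff).2 h.1
  · rw [integrable_finsetSum_measure]
    intro l _
    exact ((measurableEmbedding_frac l).integrable_map_iff).2 (h.2 l)

/-- Boundaries of convex sets have area zero, and `fracture_transversal` says the same for length on
the fractures. All later pointwise estimates may therefore be made in the interiors of elements. -/
theorem mixedVol_frontier_K [Countable ι] (j : J) :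
    G.mixedVol (G.pt ⁻¹' frontier (G.K j)) = 0 := by
  have hm : MeasurableSet (G.pt ⁻¹' frontier (G.K j)) :=
    G.measurable_pt isClosed_frontier.measurableSet
  rw [mixedVol, Measure.add_apply, Measure.sum_apply _ hm, measurableEmbedding_mat.map_apply]
  simp only [(measurableEmbedding_frac _).map_apply]
  rw [add_eq_zero]
  refine ⟨?_, ENNReal.tsum_eq_zero.2 fun l => ?_⟩
  · exact (G.convex_K j).addHaar_frontier volume
  · rw [Measure.restrict_apply]
    · refine measure_mono_null ?_ (G.fracture_transversal l j)
      rintro t ⟨h1, h2⟩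
      exact ⟨h2, h1⟩
    · exact (G.continuous_γ l).measurable isClosed_frontier.measurableSet

theorem mixedVol_ae_interior [Countable ι] (j : J) :
    ∀ᵐ z ∂G.mixedVol, G.pt z ∈ G.K j → G.pt z ∈ interior (G.K j) := by
  have := G.mixedVol_frontier_K j
  filter_upwards [measure_eq_zero_iff_ae_notMem.1 this] with z hz h
  by_contra hi
  exact hz ⟨subset_closure h, hi⟩

theorem ae_mem_interior [Countable ι] (j : J) :
    ∀ᵐ z ∂G.mixedMeasure (G.K j), G.pt z ∈ interior (G.K j) := by
  rw [mixedMeasure, ae_restrict_iff' (G.measurable_pt (G.isClosed_K j).measurableSet)]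
  exact G.mixedVol_ae_interior j

theorem mixedMeasure_Ω [Countable ι] [Fintype J] :
    G.mixedMeasure G.Ω = ∑ j, G.mixedMeasure (G.K j) := by
  have hae : (G.pt ⁻¹' G.Ω : Set (MixedPt ι)) =ᵐ[G.mixedVol] ⋃ j, G.pt ⁻¹' G.K j := by
    filter_upwards [ae_all_iff.2 G.mixedVol_ae_interior] with z hz
    apply propext
    constructor
    · intro h
      obtain ⟨j, hj⟩ := G.exists_mem_K h
      exact mem_iUnion.2 ⟨j, hj⟩
    · intro h
      obtain ⟨j, hj⟩ := mem_iUnion.1 h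
      exact G.interior_subset j (hz j hj)
  rw [mixedMeasure, Measure.restrict_congr_set hae, Measure.restrict_iUnion_ae, Measure.sum_fintype]
  · rfl
  · intro i j hij
    refine measure_mono_null ?_ (G.mixedVol_frontier_K i)
    rintro z ⟨h1, h2⟩
    exact ⟨subset_closure h1, G.notMem_interior_of_mem hij h2⟩
  · exact fun j => (G.measurable_pt (G.isClosed_K j).measurableSet).nullMeasurableSet

theorem mixedMeasure_K_le [Countable ι] [Fintype J] (j : J) :
    G.mixedMeasure (G.K j) ≤ G.mixedMeasure G.Ω := by
  have : (G.K j) ⊆ interior (G.K j) ∪ frontier (G.K j) := by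
    intro x hx
    by_cases h : x ∈ interior (G.K j)
    exacts [Or.inl h, Or.inr ⟨subset_closure hx, h⟩]
  rw [mixedMeasure, mixedMeasure]
  apply Measure.restrict_mono_ae
  filter_upwards [G.mixedVol_ae_interior j] with z hz h
  exact G.interior_subset j (hz h)

theorem ae_mem_Ω [Countable ι] (j : J) : ∀ᵐ z ∂G.mixedMeasure (G.K j), G.pt z ∈ G.Ω :=
  (G.ae_mem_interior j).mono fun _ h => G.interior_subset j h

theorem ae_mem_Ω' [Countable ι] : ∀ᵐ z ∂G.mixedMeasure G.Ω, G.pt z ∈ G.Ω := by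
  rw [mixedMeasure, ae_restrict_iff' (G.measurable_pt G.isOpen_Ω.measurableSet)]
  exact ae_of_all _ fun _ h => h

instance isFiniteMeasure_mixedMeasure_K [Fintype ι] (j : J) :
    IsFiniteMeasure (G.mixedMeasure (G.K j)) := by
  have : Integrable (fun _ : MixedPt ι => (1 : ℝ)) (G.mixedMeasure (G.K j)) := by
    rw [integrable_mixedMeasure_iff]
    refine ⟨integrableOn_const (G.isCompact_K j).measure_ne_top, fun l => integrableOn_const ?_⟩
    exact measure_ne_top_of_subset (fun t ht => ht.1) (by simp : volume (Ioo 0 (G.len l)) ≠ ⊤)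
  exact (integrable_const_iff.1 this).resolve_left one_ne_zero

instance isFiniteMeasure_mixedMeasure_Ω [Fintype ι] [Fintype J] :
    IsFiniteMeasure (G.mixedMeasure G.Ω) := by
  rw [G.mixedMeasure_Ω]; infer_instance

theorem len_pos (l : ι) : 0 < G.len l := dist_pos.2 (G.src_ne_tgt l)

/-- The unit tangent vector of the fracture `l`. -/
def dir (l : ι) : Plane := (G.len l)⁻¹ • (G.tgt l - G.src l)

theorem norm_dir (l : ι) : ‖G.dir l‖ = 1 := by
  rw [dir, norm_smul, norm_inv, Real.norm_eq_abs, abs_of_pos (G.len_pos l), ← dist_eq_norm,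
    dist_comm]
  exact inv_mul_cancel₀ (G.len_pos l).ne'

theorem hasDerivAt_γ (l : ι) (t : ℝ) : HasDerivAt (G.γ l) (G.dir l) t := by
  have := (((hasDerivAt_id t).div_const (G.len l)).smul_const (G.tgt l - G.src l)).const_add
    (G.src l)
  simp only [one_div] at this
  exact this

/-- The first basis vector, used to embed tangential derivatives into the plane. -/
def basisVec : Plane := EuclideanSpace.single 0 1

theorem norm_basisVec : ‖basisVec‖ = 1 := by simp [basisVec]

/-- The gradient at a point of the matrix, or the tangential derivative at a point of a fracture,
as a function of the derivative in the plane. -/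
def gradOf : MixedPt ι → (Plane →L[ℝ] ℝ) → Plane :=
  MixedPt.elim (fun _ f' => (InnerProductSpace.toDual ℝ Plane).symm f')
    fun l _ f' => f' (G.dir l) • basisVec

theorem gradOf_sub (z : MixedPt ι) (f' g' : Plane →L[ℝ] ℝ) :
    G.gradOf z (f' - g') = G.gradOf z f' - G.gradOf z g' := by
  rcases z with x | ⟨l, t⟩
  · exact map_sub _ _ _
  · change (f' - g') (G.dir l) • basisVec = f' (G.dir l) • basisVec - g' (G.dir l) • basisVec
    rw [sub_apply, sub_smul]

theorem gradOf_add (z : MixedPt ι) (f' g' : Plane →L[ℝ] ℝ) :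
    G.gradOf z (f' + g') = G.gradOf z f' + G.gradOf z g' := by
  rcases z with x | ⟨l, t⟩
  · exact map_add _ _ _
  · change (f' + g') (G.dir l) • basisVec = f' (G.dir l) • basisVec + g' (G.dir l) • basisVec
    rw [add_apply, add_smul]

theorem gradOf_smul (z : MixedPt ι) (c : ℝ) (f' : Plane →L[ℝ] ℝ) :
    G.gradOf z (c • f') = c • G.gradOf z f' := by
  rcases z with x | ⟨l, t⟩
  · change (InnerProductSpace.toDual ℝ Plane).symm (c • f') =
      c • (InnerProductSpace.toDual ℝ Plane).symm f'
    rw [map_smulₛₗ]; rfl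
  · change (c • f') (G.dir l) • basisVec = c • f' (G.dir l) • basisVec
    rw [smul_apply, smul_eq_mul, mul_smul]

theorem gradOf_zero (z : MixedPt ι) : G.gradOf z 0 = 0 := by
  simpa using G.gradOf_smul z 0 0

theorem gradOf_sum (z : MixedPt ι) {α : Type*} (s : Finset α) (f' : α → Plane →L[ℝ] ℝ) :
    G.gradOf z (∑ a ∈ s, f' a) = ∑ a ∈ s, G.gradOf z (f' a) := by
  classical
  induction s using Finset.induction_on with
  | empty => simp [gradOf_zero]
  | insert a s ha ih => rw [Finset.sum_insert ha, Finset.sum_insert ha, gradOf_add, ih]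

theorem norm_gradOf_le (z : MixedPt ι) (f' : Plane →L[ℝ] ℝ) : ‖G.gradOf z f'‖ ≤ ‖f'‖ := by
  rcases z with x | ⟨l, t⟩
  · exact (LinearIsometryEquiv.norm_map _ _).le
  · change ‖f' (G.dir l) • basisVec‖ ≤ ‖f'‖
    rw [norm_smul, norm_basisVec, mul_one]
    simpa [G.norm_dir l] using f'.le_opNorm (G.dir l)

/-- At every point there is a unit vector such that derivatives in its direction are controlled by
the gradient in the mixed sense. -/
theorem exists_direction (z : MixedPt ι) : ∃ h : Plane, ‖h‖ = 1 ∧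
    ∀ f' : Plane →L[ℝ] ℝ, |f' h| ≤ ‖G.gradOf z f'‖ := by
  rcases z with x | ⟨l, t⟩
  · refine ⟨basisVec, norm_basisVec, fun f' => ?_⟩
    have h1 : ‖G.gradOf (Sum.inl x) f'‖ = ‖f'‖ := LinearIsometryEquiv.norm_map _ _
    rw [h1]
    simpa [norm_basisVec] using f'.le_opNorm basisVec
  · refine ⟨G.dir l, G.norm_dir l, fun f' => ?_⟩
    change _ ≤ ‖f' (G.dir l) • basisVec‖
    rw [norm_smul, norm_basisVec, mul_one, Real.norm_eq_abs]

end Geometry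

namespace MixedFun

variable {ι : Type*}

/-- The value at a point of the matrix or of a fracture. -/
def U (u : MixedFun ι) : MixedPt ι → ℝ := MixedPt.elim u.val u.fval

/-- The gradient in the matrix, and the tangential derivative on the fractures. -/
def D (u : MixedFun ι) : MixedPt ι → Plane :=
  MixedPt.elim u.grad fun l t => u.fgrad l t • Geometry.basisVec

theorem U_add (u v : MixedFun ι) (z : MixedPt ι) : (u + v).U z = u.U z + v.U z := by
  rcases z with x | ⟨l, t⟩ <;> rfl

theorem U_sub (u v : MixedFun ι) (z : MixedPt ι) : (u - v).U z = u.U z - v.U z := by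
  rcases z with x | ⟨l, t⟩ <;> rfl

theorem U_smul (c : ℝ) (u : MixedFun ι) (z : MixedPt ι) : (c • u).U z = c * u.U z := by
  rcases z with x | ⟨l, t⟩ <;> rfl

theorem D_add (u v : MixedFun ι) (z : MixedPt ι) : (u + v).D z = u.D z + v.D z := by
  rcases z with x | ⟨l, t⟩
  · rfl
  · exact add_smul _ _ _

theorem D_sub (u v : MixedFun ι) (z : MixedPt ι) : (u - v).D z = u.D z - v.D z := by
  rcases z with x | ⟨l, t⟩
  · rfl
  · exact sub_smul _ _ _

theorem D_smul (c : ℝ) (u : MixedFun ι) (z : MixedPt ι) : (c • u).D z = c • u.D z := by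
  rcases z with x | ⟨l, t⟩
  · rfl
  · exact mul_smul _ _ _

end MixedFun

namespace Geometry

variable {J N ι : Type*} (G : Geometry J N ι)

open MixedPt

theorem U_lift (f : Plane → ℝ) (z : MixedPt ι) : (G.lift f).U z = f (G.pt z) := by
  rcases z with x | ⟨l, t⟩ <;> rfl

theorem D_lift {f : Plane → ℝ} {f' : Plane →L[ℝ] ℝ} {z : MixedPt ι}
    (hf : HasFDerivAt f f' (G.pt z)) : (G.lift f).D z = G.gradOf z f' := by
  rcases z with x | ⟨l, t⟩
  · change (InnerProductSpace.toDual ℝ Plane).symm (fderiv ℝ f x) = _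
    have h : HasFDerivAt f f' x := hf
    rw [h.fderiv]
    rfl
  · change deriv (fun r => f (G.γ l r)) t • basisVec = f' (G.dir l) • basisVec
    congr 1
    exact (HasFDerivAt.comp_hasDerivAt t (f := G.γ l) hf (G.hasDerivAt_γ l t)).deriv

theorem U_mul (b : Plane → ℝ) (u : MixedFun ι) (z : MixedPt ι) :
    (G.mul b u).U z = b (G.pt z) * u.U z := by
  rcases z with x | ⟨l, t⟩ <;> rfl

theorem D_mul (b : Plane → ℝ) (u : MixedFun ι) (z : MixedPt ι) :
    (G.mul b u).D z = b (G.pt z) • u.D z + u.U z • (G.lift b).D z := by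
  rcases z with x | ⟨l, t⟩
  · rfl
  · change (_ * _ + _ * _) • basisVec = _ • _ • basisVec + _ • _ • basisVec
    rw [add_smul, mul_smul, mul_smul]
    rfl

theorem measurable_D_lift [Countable ι] (f : Plane → ℝ) : Measurable (G.lift f).D := by
  refine measurable_elim ?_ fun l => ?_
  · exact (LinearIsometryEquiv.continuous _).measurable.comp (measurable_fderiv ℝ f)
  · exact (measurable_deriv _).smul_const _

theorem sqIntegrable_iff [Fintype ι] {S : Set Plane} {u : MixedFun ι} : G.SqIntegrable S u ↔
    MemLp u.U 2 (G.mixedMeasure S) ∧ MemLp u.D 2 (G.mixedMeasure S) := by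
  rw [memLp_mixedMeasure_iff, memLp_mixedMeasure_iff]
  have h : ∀ l, MemLp (fun t => u.D (frac l t)) 2 (volume.restrict (G.fracIn l S)) ↔
      MemLp (u.fgrad l) 2 (volume.restrict (G.fracIn l S)) := by
    intro l
    constructor
    · intro h
      have := h.inner_const (𝕜 := ℝ) basisVec
      convert this using 2 with t
      change _ = inner ℝ (u.fgrad l t • basisVec) basisVec
      rw [inner_smul_left, real_inner_self_eq_norm_sq, norm_basisVec]; simp
    · intro h
      refine h.of_le (h.1.smul_const basisVec) (ae_of_all _ fun t => ?_)
      change ‖u.fgrad l t • basisVec‖ ≤ _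
      rw [norm_smul, norm_basisVec, mul_one]
  simp only [h]
  exact ⟨fun ⟨h1, h2, h3⟩ => ⟨⟨h1, fun l => (h3 l).1⟩, h2, fun l => (h3 l).2⟩,
    fun ⟨⟨h1, h2⟩, h3, h4⟩ => ⟨h1, h3, fun l => ⟨h2 l, h4 l⟩⟩⟩

variable {G} in
theorem SqIntegrable.integrable_normSq [Fintype ι] {S : Set Plane} {u : MixedFun ι}
    (hu : G.SqIntegrable S u) :
    Integrable (fun z => u.U z ^ 2 + ‖u.D z‖ ^ 2) (G.mixedMeasure S) := by
  obtain ⟨h1, h2⟩ := G.sqIntegrable_iff.1 hu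
  exact h1.integrable_sq.add ((memLp_two_iff_integrable_sq_norm h2.1).1 h2)

variable {G} in
theorem SqIntegrable.normSq_eq [Fintype ι] {S : Set Plane} {u : MixedFun ι}
    (hu : G.SqIntegrable S u) :
    G.normSq S u = ∫ z, (u.U z ^ 2 + ‖u.D z‖ ^ 2) ∂G.mixedMeasure S := by
  rw [G.integral_mixedMeasure hu.integrable_normSq, normSq]
  congr 1
  refine Finset.sum_congr rfl fun l _ => ?_
  congr 1
  funext t
  change _ = (u.fval l t) ^ 2 + ‖u.fgrad l t • basisVec‖ ^ 2
  rw [norm_smul, norm_basisVec, mul_one, Real.norm_eq_abs, sq_abs]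

end Geometry


namespace Geometry

variable {J N ι : Type*} (G : Geometry J N ι) [Fintype ι]

/-! ### Square integrable functions and closures of test functions -/

variable {G} {S T : Set Plane} {u v : MixedFun ι}

theorem SqIntegrable.add (hu : G.SqIntegrable S u) (hv : G.SqIntegrable S v) :
    G.SqIntegrable S (u + v) := by
  rw [sqIntegrable_iff] at *
  rw [show (u + v).U = u.U + v.U from funext (MixedFun.U_add u v),
    show (u + v).D = u.D + v.D from funext (MixedFun.D_add u v)]
  exact ⟨hu.1.add hv.1, hu.2.add hv.2⟩

theorem SqIntegrable.smul (c : ℝ) (hu : G.SqIntegrable S u) : G.SqIntegrable S (c • u) := by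
  rw [sqIntegrable_iff] at *
  rw [show (c • u).U = c • u.U from funext (MixedFun.U_smul c u),
    show (c • u).D = c • u.D from funext (MixedFun.D_smul c u)]
  exact ⟨hu.1.const_smul c, hu.2.const_smul c⟩

theorem SqIntegrable.sub (hu : G.SqIntegrable S u) (hv : G.SqIntegrable S v) :
    G.SqIntegrable S (u - v) := by
  have := hu.add (hv.smul (-1))
  rwa [neg_one_smul, ← sub_eq_add_neg] at this

theorem SqIntegrable.mono (h : G.mixedMeasure S ≤ G.mixedMeasure T) (hu : G.SqIntegrable T u) :
    G.SqIntegrable S u := by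
  rw [sqIntegrable_iff] at *
  exact ⟨hu.1.mono_measure h, hu.2.mono_measure h⟩

theorem SqIntegrable.normSq_add_le (hu : G.SqIntegrable S u) (hv : G.SqIntegrable S v) :
    G.normSq S (u + v) ≤ 2 * G.normSq S u + 2 * G.normSq S v := by
  rw [hu.normSq_eq, hv.normSq_eq, (hu.add hv).normSq_eq, ← integral_const_mul,
    ← integral_const_mul, ← integral_add (hu.integrable_normSq.const_mul 2)
      (hv.integrable_normSq.const_mul 2)]
  refine integral_mono (hu.add hv).integrable_normSq
    ((hu.integrable_normSq.const_mul 2).add (hv.integrable_normSq.const_mul 2)) fun z => ?_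
  simp only [MixedFun.U_add, MixedFun.D_add]
  have := parallelogram_law_with_norm ℝ (u.D z) (v.D z)
  nlinarith [sq_nonneg (u.U z - v.U z), sq_nonneg ‖u.D z - v.D z‖]

theorem SqIntegrable.normSq_smul (c : ℝ) (hu : G.SqIntegrable S u) :
    G.normSq S (c • u) = c ^ 2 * G.normSq S u := by
  rw [hu.normSq_eq, (hu.smul c).normSq_eq, ← integral_const_mul]
  congr 1
  funext z
  rw [MixedFun.U_smul, MixedFun.D_smul, norm_smul, Real.norm_eq_abs, mul_pow, mul_pow, sq_abs]
  ring

theorem SqIntegrable.normSq_congr (hu : G.SqIntegrable S u) (hv : G.SqIntegrable S v)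
    (hU : u.U =ᵐ[G.mixedMeasure S] v.U)
    (hD : u.D =ᵐ[G.mixedMeasure S] v.D) : G.normSq S u = G.normSq S v := by
  rw [hu.normSq_eq, hv.normSq_eq]
  apply integral_congr_ae
  filter_upwards [hU, hD] with z h1 h2
  rw [h1, h2]

theorem SqIntegrable.normSq_mono (h : G.mixedMeasure S ≤ G.mixedMeasure T)
    (hu : G.SqIntegrable T u) : G.normSq S u ≤ G.normSq T u := by
  rw [hu.normSq_eq, (hu.mono h).normSq_eq]
  exact integral_mono_measure h (ae_of_all _ fun z => by positivity) hu.integrable_normSq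

theorem SqIntegrable.normSq_nonneg (hu : G.SqIntegrable S u) : 0 ≤ G.normSq S u := by
  rw [hu.normSq_eq]
  exact integral_nonneg fun z => by positivity

theorem sqIntegrable_lift [IsFiniteMeasure (G.mixedMeasure S)] {f : Plane → ℝ}
    (hf : Continuous f) (hc : HasCompactSupport f) {C : ℝ}
    (hD : ∀ᵐ z ∂G.mixedMeasure S, ‖(G.lift f).D z‖ ≤ C) : G.SqIntegrable S (G.lift f) := by
  rw [sqIntegrable_iff]
  constructor
  · obtain ⟨B, hB⟩ := hc.exists_bound_of_continuous hf
    have hm : Measurable (G.lift f).U := by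
      have : (G.lift f).U = fun z => f (G.pt z) := funext fun z => G.U_lift f z
      rw [this]
      exact hf.measurable.comp G.measurable_pt
    refine MemLp.of_bound hm.aestronglyMeasurable B (ae_of_all _ fun z => ?_)
    rw [G.U_lift]; exact hB _
  · exact MemLp.of_bound (G.measurable_D_lift f).aestronglyMeasurable C hD

theorem exists_bound_fderiv {f : Plane → ℝ} {W : Set Plane} (hf : IsTest W f) :
    ∃ C, 0 ≤ C ∧ ∀ x, ‖fderiv ℝ f x‖ ≤ C := by
  obtain ⟨C, hC⟩ := (hf.2.1.fderiv (𝕜 := ℝ)).exists_bound_of_continuous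
    (hf.1.continuous_fderiv (by simp))
  exact ⟨C, (norm_nonneg _).trans (hC 0), hC⟩

theorem IsTest.differentiable {f : Plane → ℝ} {W : Set Plane} (hf : IsTest W f) :
    Differentiable ℝ f := hf.1.differentiable (by simp)

theorem IsTest.D_lift {f : Plane → ℝ} {W : Set Plane} (hf : IsTest W f) (z : MixedPt ι) :
    (G.lift f).D z = G.gradOf z (fderiv ℝ f (G.pt z)) :=
  G.D_lift (hf.differentiable _).hasFDerivAt

theorem IsTest.sqIntegrable_lift [IsFiniteMeasure (G.mixedMeasure S)] {f : Plane → ℝ}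
    {W : Set Plane} (hf : IsTest W f) : G.SqIntegrable S (G.lift f) := by
  obtain ⟨C, -, hC⟩ := exists_bound_fderiv hf
  refine Geometry.sqIntegrable_lift hf.1.continuous hf.2.1 (C := C) (ae_of_all _ fun z => ?_)
  rw [hf.D_lift]
  exact (G.norm_gradOf_le _ _).trans (hC _)

theorem isTest_zero (W : Set Plane) : IsTest W (0 : Plane → ℝ) :=
  ⟨contDiff_const, HasCompactSupport.zero, by simp [tsupport]⟩

theorem IsTest.add_smul {f g : Plane → ℝ} {W : Set Plane} (hf : IsTest W f) (hg : IsTest W g)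
    (c : ℝ) : IsTest W (f + c • g) := by
  have h2 : HasCompactSupport (c • g) := hg.2.1.smul_left (f := fun _ => c)
  refine ⟨hf.1.add (contDiff_const.smul hg.1), hf.2.1.add h2, ?_⟩
  refine (tsupport_add _ _).trans (union_subset hf.2.2 ?_)
  exact (closure_mono (Function.support_const_smul_subset c g)).trans hg.2.2

theorem IsTest.lift_add_smul {f g : Plane → ℝ} {W : Set Plane} (hf : IsTest W f)
    (hg : IsTest W g) (c : ℝ) (z : MixedPt ι) :
    (G.lift (f + c • g)).U z = (G.lift f + c • G.lift g).U z ∧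
      (G.lift (f + c • g)).D z = (G.lift f + c • G.lift g).D z := by
  constructor
  · simp [MixedFun.U_add, MixedFun.U_smul, G.U_lift]
  · rw [(hf.add_smul hg c).D_lift, MixedFun.D_add, MixedFun.D_smul, hf.D_lift, hg.D_lift,
      fderiv_add (hf.differentiable _) ((hg.differentiable _).const_smul c), gradOf_add,
      fderiv_const_smul (hg.differentiable _), gradOf_smul]

variable [IsFiniteMeasure (G.mixedMeasure S)]

theorem MemClosure.add_smul {W : Set Plane} (hu : G.MemClosure S W u) (hv : G.MemClosure S W v)
    (c : ℝ) : G.MemClosure S W (u + c • v) := by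
  refine ⟨hu.1.add (hv.1.smul c), fun ε hε => ?_⟩
  obtain ⟨f, hf, hfu⟩ := hu.2 (ε / 4) (by positivity)
  obtain ⟨g, hg, hgv⟩ := hv.2 (ε / (4 * (c ^ 2 + 1))) (by positivity)
  have h1 := hu.1.sub (hf.sqIntegrable_lift (S := S))
  have h2 := hv.1.sub (hg.sqIntegrable_lift (S := S))
  refine ⟨f + c • g, hf.add_smul hg c, ?_⟩
  have e : G.normSq S (u + c • v - G.lift (f + c • g)) =
      G.normSq S ((u - G.lift f) + c • (v - G.lift g)) := by
    refine SqIntegrable.normSq_congr ?_ (h1.add (h2.smul c)) ?_ ?_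
    · exact (hu.1.add (hv.1.smul c)).sub (hf.add_smul hg c).sqIntegrable_lift
    · refine .of_forall fun z => ?_
      rw [MixedFun.U_sub, (hf.lift_add_smul hg c z).1]
      simp only [MixedFun.U_add, MixedFun.U_smul, MixedFun.U_sub]; ring
    · refine .of_forall fun z => ?_
      rw [MixedFun.D_sub, (hf.lift_add_smul hg c z).2]
      simp only [MixedFun.D_add, MixedFun.D_smul, MixedFun.D_sub, smul_sub]; abel
  rw [e]
  refine (h1.normSq_add_le (h2.smul c)).trans_lt ?_
  rw [h2.normSq_smul]
  have h3 : c ^ 2 * G.normSq S (v - G.lift g) ≤ c ^ 2 * (ε / (4 * (c ^ 2 + 1))) :=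
    mul_le_mul_of_nonneg_left hgv.le (sq_nonneg c)
  have h4 : c ^ 2 * (ε / (4 * (c ^ 2 + 1))) ≤ ε / 4 := by
    rw [mul_div_assoc', div_le_div_iff₀ (by positivity) (by norm_num)]
    nlinarith
  linarith

theorem memClosure_zero (W : Set Plane) : G.MemClosure S W 0 := by
  have h0 : G.SqIntegrable S (0 : MixedFun ι) := by
    have := ((isTest_zero W).sqIntegrable_lift (G := G) (S := S)).smul 0
    rwa [zero_smul] at this
  refine ⟨h0, fun ε hε => ⟨0, isTest_zero W, ?_⟩⟩
  have h1 := h0.sub ((isTest_zero W).sqIntegrable_lift (G := G) (S := S))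
  have e : G.normSq S (0 - G.lift 0) = G.normSq S ((0 : ℝ) • (0 - G.lift (0 : Plane → ℝ))) := by
    refine h1.normSq_congr (h1.smul 0) ?_ ?_
    · refine .of_forall fun z => ?_
      rw [MixedFun.U_smul, MixedFun.U_sub, G.U_lift]
      rcases z with x | ⟨l, t⟩ <;> simp <;> rfl
    · refine .of_forall fun z => ?_
      rw [MixedFun.D_smul, MixedFun.D_sub, (isTest_zero W).D_lift]
      have : fderiv ℝ (0 : Plane → ℝ) (G.pt z) = 0 := by simp
      rw [this, gradOf_zero]
      rcases z with x | ⟨l, t⟩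
      · simp; rfl
      · simp; exact zero_smul ℝ basisVec
  rw [e, h1.normSq_smul]
  simpa using hε

variable (G S) in
/-- The closure, in the `H¹` norm on `S`, of pairs of test functions in `W`. -/
def dualClosure (W : Set Plane) : Submodule ℝ (DualFun ι) where
  carrier := {u | ∀ i, G.MemClosure S W (u i)}
  add_mem' {u v} hu hv i := by
    have := (hu i).add_smul (hv i) 1
    rwa [one_smul] at this
  zero_mem' i := memClosure_zero W
  smul_mem' c u hu i := by
    have := (memClosure_zero W).add_smul (hu i) c
    rwa [zero_add] at this

theorem MemClosure.sub {W : Set Plane} (hu : G.MemClosure S W u) (hv : G.MemClosure S W v) :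
    G.MemClosure S W (u - v) := by
  have := hu.add_smul hv (-1)
  rwa [neg_one_smul, ← sub_eq_add_neg] at this

theorem MemClosure.mono {W W' : Set Plane} (hW : W ⊆ W') (hu : G.MemClosure S W u) :
    G.MemClosure S W' u :=
  ⟨hu.1, fun ε hε => by
    obtain ⟨f, hf, h⟩ := hu.2 ε hε
    exact ⟨f, ⟨hf.1, hf.2.1, hf.2.2.trans hW⟩, h⟩⟩

theorem MemClosure.mono_left {W T : Set Plane} (h : G.mixedMeasure T ≤ G.mixedMeasure S)
    (hu : G.MemClosure S W u) : G.MemClosure T W u :=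
  ⟨hu.1.mono h, fun ε hε => by
    obtain ⟨f, hf, hfu⟩ := hu.2 ε hε
    exact ⟨f, hf, ((hu.1.sub hf.sqIntegrable_lift).normSq_mono h).trans_lt hfu⟩⟩

theorem MemClosure.of_approx {W : Set Plane} (hu : G.SqIntegrable S u)
    (h : ∀ ε > 0, ∃ v, G.MemClosure S W v ∧ G.normSq S (u - v) < ε) : G.MemClosure S W u := by
  refine ⟨hu, fun ε hε => ?_⟩
  obtain ⟨v, hv, huv⟩ := h (ε / 4) (by positivity)
  obtain ⟨f, hf, hfv⟩ := hv.2 (ε / 4) (by positivity)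
  refine ⟨f, hf, ?_⟩
  have := (hu.sub hv.1).normSq_add_le (hv.1.sub (hf.sqIntegrable_lift (S := S)))
  rw [sub_add_sub_cancel] at this
  linarith

/-! ### Mollification -/

open scoped Convolution in
-- An increment of the mollification is an average of the same increment of `g` based at points of
-- the ball. The case `a = 0` transfers Lipschitz bounds, the case `a = g'(h)` transfers strict
-- differentiability.
theorem abs_mollify_sub_le {φ : ContDiffBump (0 : Plane)} {g : Plane → ℝ} (hg : Continuous g)
    {x h : Plane} {a c : ℝ}
    (hc : ∀ y ∈ Metric.ball x φ.rOut, |g (y + h) - g y - a| ≤ c) :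
    |(φ.normed volume ⋆[ContinuousLinearMap.lsmul ℝ ℝ, volume] g) (x + h) -
      (φ.normed volume ⋆[ContinuousLinearMap.lsmul ℝ ℝ, volume] g) x - a| ≤ c := by
  have hex : ∀ y : Plane, ConvolutionExistsAt (φ.normed volume) g y
      (ContinuousLinearMap.lsmul ℝ ℝ) volume := fun y =>
    φ.hasCompactSupport_normed.convolutionExists_left (ContinuousLinearMap.lsmul ℝ ℝ)
      φ.continuous_normed hg.locallyIntegrable y
  have h1 := dist_convolution_le (μ := volume) (x₀ := x) (z₀ := a) (ε := c) (R := φ.rOut)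
    (f := φ.normed volume) (g := fun y => g (y + h) - g y)
    ((abs_nonneg _).trans (hc x (Metric.mem_ball_self φ.rOut_pos))) (φ.support_normed_eq).subset
    (φ.nonneg_normed) (φ.integral_normed) (by fun_prop)
    (fun y hy => by rw [Real.dist_eq]; exact hc y hy)
  rw [Real.dist_eq] at h1
  convert h1 using 3
  simp only [convolution_def, ContinuousLinearMap.lsmul_apply, smul_eq_mul]
  rw [← integral_sub]
  · congr 1
    funext t
    rw [mul_sub, show x - t + h = x + h - t by abel]
  · exact hex (x + h)
  · exact hex x

open scoped Convolution in
-- Mollifications converge uniformly, their gradients are bounded by the Lipschitz constant and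
-- converge at points of strict differentiability; dominated convergence gives `H¹` convergence.
-- Differentiability almost everywhere in the plane would not do, since fractures have area zero.
theorem memClosure_lift_of_lipschitz {W : Set Plane} (hW : IsOpen W) {g : Plane → ℝ} {C : NNReal}
    (hL : LipschitzWith C g) (hc : HasCompactSupport g) (hs : tsupport g ⊆ W)
    (hd : ∀ᵐ z ∂G.mixedMeasure S, ∃ g' : Plane →L[ℝ] ℝ, HasStrictFDerivAt g g' (G.pt z)) :
    G.MemClosure S W (G.lift g) := by
  have hgc : Continuous g := hL.continuous
  obtain ⟨r, hr0, hr⟩ := hc.exists_cthickening_subset_open hW hs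
  have hpos : ∀ n : ℕ, 0 < r / (n + 2) := fun n => by positivity
  let φ : ℕ → ContDiffBump (0 : Plane) := fun n =>
    ⟨r / (n + 2) / 2, r / (n + 2), by have := hpos n; positivity, half_lt_self (hpos n)⟩
  have hφr : ∀ n, (φ n).rOut = r / (n + 2) := fun n => rfl
  set gn : ℕ → Plane → ℝ := fun n =>
    (φ n).normed volume ⋆[ContinuousLinearMap.lsmul ℝ ℝ, volume] g with hgn
  have hsmooth : ∀ n, ContDiff ℝ (⊤ : ℕ∞) (gn n) := fun n =>
    (φ n).hasCompactSupport_normed.contDiff_convolution_left (ContinuousLinearMap.lsmul ℝ ℝ)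
      (φ n).contDiff_normed hgc.locallyIntegrable
  have hrn : ∀ n : ℕ, r / (n + 2) ≤ r := fun n =>
    div_le_self hr0.le (by have : (0 : ℝ) ≤ n := n.cast_nonneg; linarith)
  have hsupp : ∀ n, tsupport (gn n) ⊆ Metric.cthickening r (tsupport g) := by
    intro n
    refine closure_minimal ?_ Metric.isClosed_cthickening
    refine (support_convolution_subset _).trans ?_
    rintro _ ⟨a, ha, b, hb, rfl⟩
    rw [(φ n).support_normed_eq] at ha
    refine Metric.mem_cthickening_of_dist_le _ b r _ (subset_tsupport g hb) ?_
    rw [dist_eq_norm, add_sub_cancel_right]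
    rw [Metric.mem_ball, dist_zero_right] at ha
    exact ha.le.trans (hrn n)
  have htest : ∀ n, IsTest W (gn n) := fun n =>
    ⟨hsmooth n, HasCompactSupport.intro (hc.cthickening (r := r)) fun x hx =>
      image_eq_zero_of_notMem_tsupport fun h => hx (hsupp n h), (hsupp n).trans hr⟩
  have hlip : ∀ x y, |g x - g y| ≤ C * ‖x - y‖ := fun x y => by
    have := hL.dist_le_mul x y
    rwa [Real.dist_eq, dist_eq_norm] at this
  have hval : ∀ n x, |gn n x - g x| ≤ C * (r / (n + 2)) := by
    intro n x
    have := dist_convolution_le (μ := volume) (x₀ := x) (z₀ := g x)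
      (ε := C * (r / (n + 2))) (R := r / (n + 2)) (f := (φ n).normed volume) (g := g)
      (mul_nonneg C.2 (hpos n).le) ((φ n).support_normed_eq).subset
      ((φ n).nonneg_normed) ((φ n).integral_normed) hgc.aestronglyMeasurable (fun y hy => by
        rw [Real.dist_eq]
        refine (hlip y x).trans (mul_le_mul_of_nonneg_left ?_ C.2)
        rw [Metric.mem_ball, dist_eq_norm] at hy
        exact hy.le)
    rwa [Real.dist_eq] at this
  have hderiv : ∀ n x, ‖fderiv ℝ (gn n) x‖ ≤ C := by
    intro n x
    refine ((htest n).differentiable x).hasFDerivAt.le_of_lip' C.2 (.of_forall fun y => ?_)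
    have := abs_mollify_sub_le (φ := φ n) hgc (x := x) (h := y - x) (a := 0) (c := C * ‖y - x‖)
      (fun w _ => by
        rw [sub_zero]
        simpa using hlip (w + (y - x)) w)
    rw [sub_zero, add_sub_cancel] at this
    exact this
  have hconv : ∀ x g', HasStrictFDerivAt g g' x →
      Filter.Tendsto (fun n => fderiv ℝ (gn n) x) Filter.atTop (nhds g') := by
    intro x g' hg'
    rw [Metric.tendsto_atTop]
    intro ε hε
    -- The bound holds for both points varying near `x`, so it covers every base point seen by the
    -- average once the bump radius is below `δ / 2`.
    have h1 := hg'.isLittleO.bound (half_pos hε)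
    rw [nhds_prod_eq] at h1
    obtain ⟨δ, hδ, hball⟩ : ∃ δ > 0, ∀ y w, dist y x < δ → dist w x < δ →
        ‖g y - g w - g' (y - w)‖ ≤ ε / 2 * ‖y - w‖ := by
      rw [← nhds_prod_eq, Metric.eventually_nhds_iff] at h1
      obtain ⟨δ, hδ, h⟩ := h1
      exact ⟨δ, hδ, fun y w hy hw => h (y := (y, w)) (by
        rw [Prod.dist_eq]; exact max_lt hy hw)⟩
    obtain ⟨n0, hn0⟩ := exists_nat_gt (r / (δ / 2))
    refine ⟨n0, fun n hn => ?_⟩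
    have hsmall : r / (n + 2) < δ / 2 := by
      rw [div_lt_iff₀ (by positivity)] at hn0 ⊢
      have : (n0 : ℝ) ≤ n := by exact_mod_cast hn
      nlinarith
    rw [dist_eq_norm]
    refine lt_of_le_of_lt ?_ (half_lt_self hε)
    have hF : HasFDerivAt (fun y => gn n y - g' y) (fderiv ℝ (gn n) x - g') x :=
      ((htest n).differentiable x).hasFDerivAt.sub g'.hasFDerivAt
    refine hF.le_of_lip' (half_pos hε).le ?_
    filter_upwards [Metric.ball_mem_nhds x (half_pos hδ)] with y hy
    have := abs_mollify_sub_le (φ := φ n) hgc (x := x) (h := y - x) (a := g' (y - x))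
      (c := ε / 2 * ‖y - x‖) (fun w hw => by
        have hw' : dist w x < δ / 2 := (Metric.mem_ball.1 hw).trans (by rw [hφr]; exact hsmall)
        have hy' : dist y x < δ / 2 := hy
        have := hball (w + (y - x)) w (by
          rw [dist_eq_norm] at *
          calc ‖w + (y - x) - x‖ = ‖(w - x) + (y - x)‖ := by congr 1; abel
            _ ≤ ‖w - x‖ + ‖y - x‖ := norm_add_le _ _
            _ < δ := by linarith) (by linarith)
        simpa using this)
    rw [add_sub_cancel] at this
    rw [Real.norm_eq_abs]
    convert this using 2
    rw [map_sub]; ring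
  have hbD : ∀ᵐ z ∂G.mixedMeasure S, ‖(G.lift g).D z‖ ≤ C := by
    filter_upwards [hd] with z ⟨g', hg'⟩
    rw [G.D_lift hg'.hasFDerivAt]
    refine (G.norm_gradOf_le _ _).trans (hg'.hasFDerivAt.le_of_lip' C.2 (.of_forall fun y => ?_))
    exact hlip _ _
  have hsq : G.SqIntegrable S (G.lift g) := sqIntegrable_lift hgc hc hbD
  refine ⟨hsq, fun ε hε => ?_⟩
  have hsqn : ∀ n, G.SqIntegrable S (G.lift g - G.lift (gn n)) :=
    fun n => hsq.sub (htest n).sqIntegrable_lift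
  have htend : Filter.Tendsto (fun n => G.normSq S (G.lift g - G.lift (gn n))) Filter.atTop
      (nhds 0) := by
    simp only [fun n => (hsqn n).normSq_eq]
    rw [← integral_zero (MixedPt ι) ℝ (μ := G.mixedMeasure S)]
    refine tendsto_integral_of_dominated_convergence
      (fun _ => ((C : ℝ) * r) ^ 2 + ((C : ℝ) + C) ^ 2)
      (fun n => (hsqn n).integrable_normSq.1) (integrable_const _) ?_ ?_
    · intro n
      filter_upwards [hbD] with z hz
      rw [Real.norm_eq_abs, abs_of_nonneg (by positivity)]
      refine add_le_add ?_ ?_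
      · rw [MixedFun.U_sub, G.U_lift, G.U_lift, ← sq_abs]
        refine pow_le_pow_left₀ (abs_nonneg _) ?_ 2
        rw [abs_sub_comm]
        exact (hval n _).trans (mul_le_mul_of_nonneg_left (hrn n) C.2)
      · refine pow_le_pow_left₀ (norm_nonneg _) ?_ 2
        rw [MixedFun.D_sub]
        refine (norm_sub_le _ _).trans (add_le_add hz ?_)
        rw [(htest n).D_lift]
        exact (G.norm_gradOf_le _ _).trans (hderiv n _)
    · filter_upwards [hd] with z ⟨g', hg'⟩
      have h1 : Filter.Tendsto (fun n => (G.lift g - G.lift (gn n)).U z) Filter.atTop (nhds 0) := by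
        have h0 : Filter.Tendsto (fun n : ℕ => (C : ℝ) * (r / ((n : ℝ) + 2))) Filter.atTop
            (nhds 0) := by
          have : Filter.Tendsto (fun n : ℕ => r / ((n : ℝ) + 2)) Filter.atTop (nhds 0) :=
            tendsto_const_nhds.div_atTop
              (Filter.tendsto_atTop_add_const_right _ _ tendsto_natCast_atTop_atTop)
          simpa using this.const_mul (C : ℝ)
        refine squeeze_zero_norm (fun n => ?_) h0
        rw [MixedFun.U_sub, G.U_lift, G.U_lift, Real.norm_eq_abs, abs_sub_comm]
        exact hval n _
      have h2 : Filter.Tendsto (fun n => ‖(G.lift g - G.lift (gn n)).D z‖) Filter.atTop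
          (nhds 0) := by
        have h3 := (hconv _ g' hg')
        rw [tendsto_iff_norm_sub_tendsto_zero] at h3
        refine squeeze_zero (fun n => norm_nonneg _) (fun n => ?_) h3
        rw [MixedFun.D_sub, (htest n).D_lift, G.D_lift hg'.hasFDerivAt, ← gradOf_sub]
        exact (G.norm_gradOf_le _ _).trans (by rw [norm_sub_rev])
      simpa using (h1.pow 2).add (h2.pow 2)
  obtain ⟨n, hn⟩ := (htend.eventually_lt_const hε).exists
  exact ⟨gn n, htest n, hn⟩

end Geometry


/-! ### Products with piecewise smooth cutoff functions -/

theorem lipschitzWith_of_eventually_le {g : Plane → ℝ} {C : NNReal}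
    (h : ∀ x, ∀ᶠ y in nhds x, |g y - g x| ≤ C * ‖y - x‖) : LipschitzWith C g := by
  have hcont : Continuous g := by
    rw [continuous_iff_continuousAt]
    intro x
    rw [ContinuousAt, tendsto_iff_norm_sub_tendsto_zero]
    refine squeeze_zero' (.of_forall fun y => norm_nonneg _) (h x) ?_
    have : Filter.Tendsto (fun y => (C : ℝ) * ‖y - x‖) (nhds x) (nhds (C * ‖x - x‖)) :=
      Continuous.tendsto (by fun_prop) x
    simpa using this
  refine LipschitzWith.of_dist_le_mul fun y x => ?_
  rw [Real.dist_eq, dist_eq_norm]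
  set p : ℝ → Plane := fun t => x + t • (y - x) with hp
  have hpc : Continuous p := by fun_prop
  set s : Set ℝ := {t | |g (p t) - g x| ≤ C * ‖y - x‖ * t} with hs
  have hclosed : IsClosed (s ∩ Icc 0 1) :=
    (isClosed_le (by fun_prop) (by fun_prop)).inter isClosed_Icc
  -- Continuous induction along the segment from `x` to `y`: the set of good parameters is closed
  -- and can be extended to the right, and the local bounds add up with the same constant.
  have hsub : Icc (0 : ℝ) 1 ⊆ s := by
    refine hclosed.Icc_subset_of_forall_exists_gt (by simp [hs, hp]) ?_
    rintro t ⟨hts, ht⟩ t' (ht' : t < t')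
    have hev := hpc.continuousAt.eventually (h (p t))
    have hev2 : ∀ᶠ r in nhdsWithin t (Ioi t), |g (p r) - g (p t)| ≤ C * ‖p r - p t‖ :=
      hev.filter_mono nhdsWithin_le_nhds
    obtain ⟨r, hr, hr2⟩ := (hev2.and (Ioc_mem_nhdsGT ht')).exists
    refine ⟨r, ?_, hr2⟩
    have e : p r - p t = (r - t) • (y - x) := by simp only [hp]; module
    rw [e, norm_smul, Real.norm_eq_abs, abs_of_pos (sub_pos.2 hr2.1)] at hr
    have := abs_add_le (g (p r) - g (p t)) (g (p t) - g x)
    rw [sub_add_sub_cancel] at this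
    have hts' : |g (p t) - g x| ≤ C * ‖y - x‖ * t := hts
    change |g (p r) - g x| ≤ C * ‖y - x‖ * r
    nlinarith
  have := hsub (right_mem_Icc.2 zero_le_one)
  simpa [hs, hp] using this

/-- A smooth approximation of the identity on `[0, ∞)` that vanishes near `0`. -/
theorem exists_smooth_truncation : ∃ (T : ℝ → ℝ) (M : NNReal), ContDiff ℝ (⊤ : ℕ∞) T ∧
    LipschitzWith M T ∧ (∀ s ≤ 1, T s = 0) ∧ ∀ s, 2 ≤ s → T s = s := by
  set T : ℝ → ℝ := fun s => s * Real.smoothTransition (s - 1) with hT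
  have hsm : ContDiff ℝ (⊤ : ℕ∞) T :=
    contDiff_id.mul (Real.smoothTransition.contDiff.comp (contDiff_id.sub contDiff_const))
  have h0 : ∀ s ≤ 1, T s = 0 := fun s hs => by
    simp [hT, Real.smoothTransition.zero_of_nonpos (sub_nonpos.2 hs)]
  have h1 : ∀ s, 2 ≤ s → T s = s := fun s hs => by
    simp [hT, Real.smoothTransition.one_of_one_le (show 1 ≤ s - 1 by linarith)]
  obtain ⟨B, hB⟩ := (isCompact_Icc (a := (0 : ℝ)) (b := 3)).exists_bound_of_continuousOn
    (hsm.continuous_deriv (by simp)).continuousOn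
  have hd : ∀ s, ‖deriv T s‖ ≤ max B 1 := by
    intro s
    by_cases hs : s ∈ Icc (0 : ℝ) 3
    · exact (hB s hs).trans (le_max_left _ _)
    · rw [mem_Icc, not_and_or, not_le, not_le] at hs
      rcases hs with hs | hs
      · have : T =ᶠ[nhds s] fun _ => 0 := by
          filter_upwards [Iio_mem_nhds hs] with r hr
          exact h0 r (le_of_lt (lt_trans hr one_pos))
        rw [this.deriv_eq]
        simp
      · have : T =ᶠ[nhds s] fun r => r := by
          filter_upwards [Ioi_mem_nhds hs] with r hr
          exact h1 r (by have : (3 : ℝ) < r := hr; linarith)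
        rw [this.deriv_eq]
        simp
  refine ⟨T, ⟨max B 1, by positivity⟩, hsm, ?_, h0, h1⟩
  exact lipschitzWith_of_nnnorm_deriv_le (hsm.differentiable (by simp)) fun s => hd s

namespace Geometry

variable {J N ι : Type*} {G : Geometry J N ι} [Fintype ι]

/-- A piecewise smooth function with values in `[0, 1]` that vanishes in `Ω` outside of `W`. -/
structure IsCutoff (G : Geometry J N ι) (b : Plane → ℝ) (W : Set Plane) : Prop where
  nonneg : ∀ x, 0 ≤ b x
  le_one : ∀ x, b x ≤ 1
  lipschitz : ∃ C, 0 ≤ C ∧ ∀ x ∈ G.Ω, ∀ᶠ y in nhds x, |b y - b x| ≤ C * ‖y - x‖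
  strictDiff : ∀ j, ∀ x ∈ interior (G.K j), ∃ b' : Plane →L[ℝ] ℝ, HasStrictFDerivAt b b' x
  pos_or_zero : ∀ j, ∀ x ∈ interior (G.K j), 0 < b x ∨ b =ᶠ[nhds x] fun _ => 0
  support : ∀ x ∈ G.Ω, 0 < b x → x ∈ W

theorem IsTest.lipschitz {f : Plane → ℝ} {W : Set Plane} (hf : IsTest W f) :
    ∃ C, 0 ≤ C ∧ ∀ x y, |f x - f y| ≤ C * ‖x - y‖ := by
  obtain ⟨C, hC, h⟩ := exists_bound_fderiv hf
  refine ⟨C, hC, fun x y => ?_⟩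
  exact Convex.norm_image_sub_le_of_norm_fderiv_le (𝕜 := ℝ) (fun z _ => hf.differentiable z)
    (fun z _ => h z) convex_univ (mem_univ y) (mem_univ x)

/-- Nothing is known about `b` near points outside `Ω`, for instance continuity, but there `f`
vanishes in a neighbourhood. So the product has a uniform local Lipschitz bound in the whole plane,
which integrates to a global one. -/
theorem lipschitzWith_mul_test {f b : Plane → ℝ} (hf : IsTest G.Ω f) {C Cf B M : NNReal}
    (hCf : ∀ x y, |f x - f y| ≤ Cf * ‖x - y‖) (hB : ∀ x, |f x| ≤ B) (hM : ∀ x, |b x| ≤ M)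
    (hC : ∀ x ∈ G.Ω, ∀ᶠ y in nhds x, |b y - b x| ≤ C * ‖y - x‖) :
    LipschitzWith (C * B + M * Cf) (fun x => b x * f x) := by
  apply lipschitzWith_of_eventually_le
  intro x
  by_cases hx : x ∈ G.Ω
  · filter_upwards [hC x hx] with y hy
    have : b y * f y - b x * f x = (b y - b x) * f y + b x * (f y - f x) := by ring
    rw [this]
    refine (abs_add_le _ _).trans ?_
    rw [abs_mul, abs_mul, NNReal.coe_add, NNReal.coe_mul, NNReal.coe_mul]
    have h1 := mul_le_mul hy (hB y) (abs_nonneg _) (by positivity)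
    have h2 := mul_le_mul (hM x) (hCf y x) (abs_nonneg _) (by positivity)
    linarith
  · have hx' : x ∉ tsupport f := fun h => hx (hf.2.2 h)
    have h0 := (isClosed_tsupport f).isOpen_compl.mem_nhds hx'
    filter_upwards [h0] with y hy
    rw [image_eq_zero_of_notMem_tsupport hy, image_eq_zero_of_notMem_tsupport hx']
    simp; positivity

theorem IsCutoff.continuousOn {b : Plane → ℝ} {W : Set Plane} (hb : G.IsCutoff b W) :
    ContinuousOn b G.Ω := by
  obtain ⟨C, hC, h⟩ := hb.lipschitz
  intro x hx
  refine ContinuousAt.continuousWithinAt ?_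
  rw [ContinuousAt, tendsto_iff_norm_sub_tendsto_zero]
  refine squeeze_zero' (.of_forall fun y => norm_nonneg _) (h x hx) ?_
  have : Filter.Tendsto (fun y => (C : ℝ) * ‖y - x‖) (nhds x) (nhds (C * ‖x - x‖)) :=
    Continuous.tendsto (by fun_prop) x
  simpa using this

theorem IsCutoff.exists_norm_D_le {b : Plane → ℝ} {W : Set Plane} (hb : G.IsCutoff b W) :
    ∃ C, 0 ≤ C ∧ ∀ j, ∀ z : MixedPt ι, G.pt z ∈ interior (G.K j) → ‖(G.lift b).D z‖ ≤ C := by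
  obtain ⟨C, hC, h⟩ := hb.lipschitz
  refine ⟨C, hC, fun j z hz => ?_⟩
  obtain ⟨b', hb'⟩ := hb.strictDiff j _ hz
  rw [G.D_lift hb'.hasFDerivAt]
  exact (G.norm_gradOf_le _ _).trans
    (hb'.hasFDerivAt.le_of_lip' hC (h _ (G.interior_subset j hz)))

variable {S : Set Plane} [IsFiniteMeasure (G.mixedMeasure S)]

/-- The support of `b f` may touch the boundary of `W`, so `b` is replaced by `b_n = T((n+1) b) /
(n+1)`. It vanishes where `b ≤ 1/(n+1)`, which makes the support of `b_n f` a compact subset of `W`,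
and it equals `b` where `b ≥ 2/(n+1)`. Since `b` is positive or locally zero at almost every point,
`b_n = b` near such a point for large `n`, and dominated convergence applies. -/
theorem IsCutoff.memClosure_lift_mul {b : Plane → ℝ} {W : Set Plane} (hb : G.IsCutoff b W)
    (hW : IsOpen W) (hS : ∀ᵐ z ∂G.mixedMeasure S, ∃ j, G.pt z ∈ interior (G.K j))
    {f : Plane → ℝ} (hf : IsTest G.Ω f) : G.MemClosure S W (G.lift fun x => b x * f x) := by
  obtain ⟨T, M, hTs, hTl, hT0, hT1⟩ := exists_smooth_truncation
  obtain ⟨C, hC, hCb⟩ := hb.lipschitz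
  obtain ⟨Cf, hCf, hCf'⟩ := hf.lipschitz
  obtain ⟨B, hB⟩ := hf.2.1.exists_bound_of_continuous hf.1.continuous
  have hB0 : 0 ≤ B := (norm_nonneg _).trans (hB 0)
  lift C to NNReal using hC
  lift Cf to NNReal using hCf
  lift B to NNReal using hB0
  have hTT : ∀ r s, |T r - T s| ≤ M * |r - s| := fun r s => by
    have := hTl.dist_le_mul r s
    rwa [Real.dist_eq, Real.dist_eq] at this
  set bn : ℕ → Plane → ℝ := fun n x => ((n : ℝ) + 1)⁻¹ * T (((n : ℝ) + 1) * b x) with hbn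
  have hbn_sub : ∀ n x y, |bn n y - bn n x| ≤ M * |b y - b x| := by
    intro n x y
    have hn : (0 : ℝ) < (n : ℝ) + 1 := by positivity
    rw [hbn]
    simp only
    rw [← mul_sub, abs_mul, abs_of_pos (inv_pos.2 hn), inv_mul_le_iff₀ hn]
    refine (hTT _ _).trans ?_
    rw [← mul_sub, abs_mul, abs_of_pos hn]
    exact le_of_eq (by ring)
  have hbn_abs : ∀ n x, |bn n x| ≤ M := by
    intro n x
    have hn : (0 : ℝ) < (n : ℝ) + 1 := by positivity
    have h1 := hTT (((n : ℝ) + 1) * b x) 0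
    rw [hT0 0 zero_le_one, sub_zero, sub_zero, abs_mul, abs_of_pos hn,
      abs_of_nonneg (hb.nonneg x)] at h1
    rw [hbn]
    simp only
    rw [abs_mul, abs_of_pos (inv_pos.2 hn), inv_mul_le_iff₀ hn]
    have h2 := mul_le_mul_of_nonneg_left (hb.le_one x) hn.le
    have h3 := mul_le_mul_of_nonneg_left h2 M.2
    simp only [NNReal.val_eq_coe] at h3
    linarith
  set L : NNReal := M * C * B + M * Cf
  have hLn : ∀ n, LipschitzWith L (fun x => bn n x * f x) := by
    intro n
    apply lipschitzWith_mul_test hf (C := M * C) hCf' hB (hbn_abs n)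
    intro x hx
    filter_upwards [hCb x hx] with y hy
    refine (hbn_sub n x y).trans ?_
    rw [NNReal.coe_mul, mul_assoc]
    exact mul_le_mul_of_nonneg_left hy M.2
  have hLb : LipschitzWith (C * B + 1 * Cf) (fun x => b x * f x) := by
    apply lipschitzWith_mul_test hf hCf' hB _ hCb
    intro x
    rw [abs_of_nonneg (hb.nonneg x)]
    exact hb.le_one x
  have hstrict : ∀ n j, ∀ x ∈ interior (G.K j), ∃ g' : Plane →L[ℝ] ℝ,
      HasStrictFDerivAt (fun x => bn n x * f x) g' x := by
    intro n j x hx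
    obtain ⟨b', hb'⟩ := hb.strictDiff j x hx
    have h1 := (hTs.contDiffAt (x := ((n : ℝ) + 1) * b x)).hasStrictDerivAt (by simp)
    have h2 := (h1.comp_hasStrictFDerivAt x (hb'.const_mul ((n : ℝ) + 1))).const_mul
      ((n : ℝ) + 1)⁻¹
    exact ⟨_, h2.mul (hf.1.contDiffAt.hasStrictFDerivAt (by simp))⟩
  have hmem : ∀ n, G.MemClosure S W (G.lift fun x => bn n x * f x) := by
    intro n
    refine memClosure_lift_of_lipschitz hW (hLn n) hf.2.1.mul_left ?_ ?_
    · have hcl : IsClosed (tsupport f ∩ b ⁻¹' Ici ((n : ℝ) + 1)⁻¹) :=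
        (hb.continuousOn.mono hf.2.2).preimage_isClosed_of_isClosed (isClosed_tsupport f)
          isClosed_Ici
      refine (closure_minimal ?_ hcl).trans ?_
      · intro x hx
        refine ⟨subset_tsupport f (right_ne_zero_of_mul hx), ?_⟩
        have h1 : bn n x ≠ 0 := left_ne_zero_of_mul hx
        by_contra h2
        apply h1
        rw [mem_preimage, mem_Ici, not_le, inv_eq_one_div, lt_div_iff₀' (by positivity)] at h2
        simp only [hbn]
        rw [hT0 _ h2.le, mul_zero]
      · rintro x ⟨hx, hx2⟩
        exact hb.support x (hf.2.2 hx) (lt_of_lt_of_le (by positivity) hx2)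
    · filter_upwards [hS] with z ⟨j, hj⟩
      exact hstrict n j _ hj
  have hsq : G.SqIntegrable S (G.lift fun x => b x * f x) := by
    refine sqIntegrable_lift hLb.continuous hf.2.1.mul_left (C := (C * B + 1 * Cf : NNReal)) ?_
    filter_upwards [hS] with z ⟨j, hj⟩
    obtain ⟨b', hb'⟩ := hb.strictDiff j _ hj
    have : HasStrictFDerivAt (fun x => b x * f x) _ (G.pt z) :=
      hb'.mul (hf.1.contDiffAt.hasStrictFDerivAt (x := G.pt z) (by simp))
    rw [G.D_lift this.hasFDerivAt]
    refine (G.norm_gradOf_le _ _).trans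
      (this.hasFDerivAt.le_of_lip' (C * B + 1 * Cf : NNReal).2 (.of_forall fun y => ?_))
    have := hLb.dist_le_mul y (G.pt z)
    rwa [Real.dist_eq, dist_eq_norm] at this
  refine MemClosure.of_approx hsq fun ε hε => ?_
  have hsqn : ∀ n, G.SqIntegrable S ((G.lift fun x => b x * f x) -
      G.lift fun x => bn n x * f x) := fun n => hsq.sub (hmem n).1
  have hevent : ∀ᵐ z ∂G.mixedMeasure S, ∀ᶠ n in Filter.atTop,
      (fun x => bn n x * f x) =ᶠ[nhds (G.pt z)] fun x => b x * f x := by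
    filter_upwards [hS] with z ⟨j, hj⟩
    rcases hb.pos_or_zero j _ hj with h | h
    · obtain ⟨n0, hn0⟩ := exists_nat_gt (2 / (b (G.pt z) / 2))
      filter_upwards [Filter.eventually_ge_atTop n0] with n hn
      have hcont : ContinuousAt b (G.pt z) :=
        hb.continuousOn.continuousAt (G.isOpen_Ω.mem_nhds (G.interior_subset j hj))
      filter_upwards [hcont.eventually (lt_mem_nhds (half_lt_self h))] with x hx
      have h2 : 2 ≤ ((n : ℝ) + 1) * b x := by
        rw [div_lt_iff₀ (by positivity)] at hn0
        have : (n0 : ℝ) ≤ n := by exact_mod_cast hn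
        nlinarith
      have : bn n x = b x := by
        simp only [hbn]
        rw [hT1 _ h2]
        field_simp
      rw [this]
    · refine .of_forall fun n => ?_
      filter_upwards [h] with x hx
      simp [hbn, hx, hT0 0 zero_le_one]
  have htend : Filter.Tendsto (fun n => G.normSq S ((G.lift fun x => b x * f x) -
      G.lift fun x => bn n x * f x)) Filter.atTop (nhds 0) := by
    simp only [fun n => (hsqn n).normSq_eq]
    rw [← integral_zero (MixedPt ι) ℝ (μ := G.mixedMeasure S)]
    refine tendsto_integral_of_dominated_convergence
      (fun _ => ((1 + M : ℝ) * B) ^ 2 + ((C * B + 1 * Cf : NNReal) + (L : ℝ)) ^ 2)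
      (fun n => (hsqn n).integrable_normSq.1) (integrable_const _) ?_ ?_
    · intro n
      filter_upwards [hS] with z ⟨j, hj⟩
      rw [Real.norm_eq_abs, abs_of_nonneg (by positivity)]
      refine add_le_add ?_ ?_
      · rw [MixedFun.U_sub, G.U_lift, G.U_lift, ← sq_abs, ← sub_mul, abs_mul]
        refine pow_le_pow_left₀ (by positivity) ?_ 2
        refine mul_le_mul ?_ (hB _) (abs_nonneg _) (by positivity)
        refine (abs_sub _ _).trans (add_le_add ?_ (hbn_abs _ _))
        rw [abs_of_nonneg (hb.nonneg _)]
        exact hb.le_one _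
      · refine pow_le_pow_left₀ (norm_nonneg _) ?_ 2
        rw [MixedFun.D_sub]
        have key : ∀ {g : Plane → ℝ} {K : NNReal}, LipschitzWith K g →
            (∃ g' : Plane →L[ℝ] ℝ, HasStrictFDerivAt g g' (G.pt z)) →
            ‖(G.lift g).D z‖ ≤ K := by
          rintro g K hK ⟨g', hg'⟩
          rw [G.D_lift hg'.hasFDerivAt]
          refine (G.norm_gradOf_le _ _).trans
            (hg'.hasFDerivAt.le_of_lip' K.2 (.of_forall fun y => ?_))
          have := hK.dist_le_mul y (G.pt z)
          rwa [Real.dist_eq, dist_eq_norm] at this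
        obtain ⟨b', hb'⟩ := hb.strictDiff j _ hj
        exact (norm_sub_le _ _).trans (add_le_add
          (key hLb ⟨_, hb'.mul (hf.1.contDiffAt.hasStrictFDerivAt (by simp))⟩)
          (key (hLn n) (hstrict n j _ hj)))
    · filter_upwards [hS, hevent] with z ⟨j, hj⟩ hz
      refine tendsto_nhds_of_eventually_eq ?_
      filter_upwards [hz] with n hn
      obtain ⟨g', hg'⟩ := hstrict n j _ hj
      rw [MixedFun.U_sub, MixedFun.D_sub, G.U_lift, G.U_lift, G.D_lift hg'.hasFDerivAt,
        G.D_lift (hg'.hasFDerivAt.congr_of_eventuallyEq hn.symm), hn.eq_of_nhds]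
      simp
  obtain ⟨n, hn⟩ := (htend.eventually_lt_const hε).exists
  exact ⟨_, hmem n, hn⟩

theorem IsCutoff.aestronglyMeasurable {b : Plane → ℝ} {W : Set Plane} (hb : G.IsCutoff b W)
    (hS : ∀ᵐ z ∂G.mixedMeasure S, G.pt z ∈ G.Ω) :
    AEStronglyMeasurable (fun z => b (G.pt z)) (G.mixedMeasure S) := by
  have h1 : AEStronglyMeasurable b (((G.mixedMeasure S).map G.pt).restrict G.Ω) :=
    hb.continuousOn.aestronglyMeasurable G.isOpen_Ω.measurableSet
  rw [Measure.restrict_map G.measurable_pt G.isOpen_Ω.measurableSet] at h1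
  have h2 := h1.comp_measurable G.measurable_pt
  have h3 : (G.mixedMeasure S).restrict (G.pt ⁻¹' G.Ω) = G.mixedMeasure S :=
    Measure.restrict_eq_self_of_ae_mem hS
  rwa [h3] at h2

theorem SqIntegrable.mul {b : Plane → ℝ} {W : Set Plane} (hb : G.IsCutoff b W)
    (hS : ∀ᵐ z ∂G.mixedMeasure S, ∃ j, G.pt z ∈ interior (G.K j)) {u : MixedFun ι}
    (hu : G.SqIntegrable S u) : G.SqIntegrable S (G.mul b u) := by
  obtain ⟨C, hC, hCb⟩ := hb.exists_norm_D_le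
  have hbm := hb.aestronglyMeasurable (hS.mono fun z ⟨j, hj⟩ => G.interior_subset j hj)
  rw [sqIntegrable_iff] at *
  obtain ⟨h1, h2⟩ := hu
  rw [show (G.mul b u).U = fun z => b (G.pt z) * u.U z from funext (G.U_mul b u),
    show (G.mul b u).D = fun z => b (G.pt z) • u.D z + u.U z • (G.lift b).D z from
      funext (G.D_mul b u)]
  refine ⟨h1.of_le (hbm.mul h1.1) (ae_of_all _ fun z => ?_), MemLp.add ?_ ?_⟩
  · rw [norm_mul, Real.norm_eq_abs, abs_of_nonneg (hb.nonneg _)]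
    exact mul_le_of_le_one_left (norm_nonneg _) (hb.le_one _)
  · refine h2.of_le (hbm.smul h2.1) (ae_of_all _ fun z => ?_)
    rw [norm_smul, Real.norm_eq_abs, abs_of_nonneg (hb.nonneg _)]
    exact mul_le_of_le_one_left (norm_nonneg _) (hb.le_one _)
  · refine h1.of_le_mul (c := C) (h1.1.smul (G.measurable_D_lift b).aestronglyMeasurable) ?_
    filter_upwards [hS] with z ⟨j, hj⟩
    rw [norm_smul, mul_comm]
    exact mul_le_mul_of_nonneg_right (hCb j z hj) (norm_nonneg _)

/-- Multiplication with `b` is bounded for the `H¹` norm, so the case of test functions extends to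
their closure. -/
theorem IsCutoff.memClosure_mul {b : Plane → ℝ} {W : Set Plane} (hb : G.IsCutoff b W)
    (hW : IsOpen W) (hS : ∀ᵐ z ∂G.mixedMeasure S, ∃ j, G.pt z ∈ interior (G.K j))
    {u : MixedFun ι} (hu : G.MemClosure S G.Ω u) : G.MemClosure S W (G.mul b u) := by
  obtain ⟨C, hC, hCb⟩ := hb.exists_norm_D_le
  refine MemClosure.of_approx (hu.1.mul hb hS) fun ε hε => ?_
  -- `2 + 2 C²` bounds the square of the operator norm of multiplication with `b`, where `|∇b| ≤ C`.
  obtain ⟨f, hf, hfu⟩ := hu.2 (ε / (2 + 2 * C ^ 2)) (by positivity)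
  have hmem := hb.memClosure_lift_mul hW hS hf
  refine ⟨_, hmem, ?_⟩
  have h1 := hu.1.sub (hf.sqIntegrable_lift (S := S))
  have h2 := (hu.1.mul hb hS).sub hmem.1
  rw [lt_div_iff₀' (by positivity)] at hfu
  refine lt_of_le_of_lt ?_ hfu
  rw [h1.normSq_eq, h2.normSq_eq, ← integral_const_mul]
  refine integral_mono_ae h2.integrable_normSq (h1.integrable_normSq.const_mul _) ?_
  filter_upwards [hS] with z ⟨j, hj⟩
  obtain ⟨b', hb'⟩ := hb.strictDiff j _ hj
  have hf' := (hf.differentiable (G.pt z)).hasFDerivAt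
  have hbf : HasFDerivAt (fun x => b x * f x) _ (G.pt z) := hb'.hasFDerivAt.mul hf'
  have e1 : (G.mul b u - G.lift fun x => b x * f x).U z = b (G.pt z) * (u - G.lift f).U z := by
    rw [MixedFun.U_sub, MixedFun.U_sub, G.U_mul, G.U_lift, G.U_lift]; ring
  have e2 : (G.mul b u - G.lift fun x => b x * f x).D z =
      b (G.pt z) • (u - G.lift f).D z + (u - G.lift f).U z • (G.lift b).D z := by
    rw [MixedFun.U_sub, MixedFun.D_sub, MixedFun.D_sub, G.D_mul, G.U_lift,
      G.D_lift hbf, G.D_lift hb'.hasFDerivAt, G.D_lift hf', gradOf_add,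
      gradOf_smul, gradOf_smul]
    module
  simp only [e1, e2]
  set U := (u - G.lift f).U z
  set D := (u - G.lift f).D z
  have hb1 : ‖b (G.pt z) • D‖ ≤ ‖D‖ := by
    rw [norm_smul, Real.norm_eq_abs, abs_of_nonneg (hb.nonneg _)]
    exact mul_le_of_le_one_left (norm_nonneg _) (hb.le_one _)
  have hb2 : ‖U • (G.lift b).D z‖ ≤ |U| * C := by
    rw [norm_smul, Real.norm_eq_abs]
    exact mul_le_mul_of_nonneg_left (hCb j z hj) (abs_nonneg _)
  have h3 : ‖b (G.pt z) • D + U • (G.lift b).D z‖ ≤ ‖D‖ + |U| * C :=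
    (norm_add_le _ _).trans (add_le_add hb1 hb2)
  have h4 := pow_le_pow_left₀ (norm_nonneg _) h3 2
  have h5 : (b (G.pt z) * U) ^ 2 ≤ U ^ 2 := by
    rw [mul_pow]
    refine mul_le_of_le_one_left (sq_nonneg _) ?_
    exact pow_le_one₀ (hb.nonneg _) (hb.le_one _)
  have h6 : (|U| * C) ^ 2 = U ^ 2 * C ^ 2 := by rw [mul_pow, sq_abs]
  nlinarith [sq_nonneg (‖D‖ - |U| * C), mul_nonneg (sq_nonneg C) (sq_nonneg ‖D‖)]

/-- Extension by zero. -/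
theorem MemClosure.extend [Fintype J] {j : J} {u : MixedFun ι}
    (hu : G.MemClosure (G.K j) (interior (G.K j)) u)
    (h0 : ∀ z, G.pt z ∉ G.K j → u.U z = 0 ∧ u.D z = 0) :
    G.MemClosure G.Ω (interior (G.K j)) u := by
  have hm : MeasurableSet (G.pt ⁻¹' G.K j) := G.measurable_pt (G.isClosed_K j).measurableSet
  have hres : (G.mixedMeasure G.Ω).restrict (G.pt ⁻¹' G.K j) = G.mixedMeasure (G.K j) := by
    rw [mixedMeasure, mixedMeasure, Measure.restrict_restrict hm]
    refine Measure.restrict_congr_set ?_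
    filter_upwards [G.mixedVol_ae_interior j] with z hz
    apply propext
    exact ⟨fun h => h.1, fun h => ⟨h, G.interior_subset j (hz h)⟩⟩
  have hext : ∀ {v : MixedFun ι}, G.SqIntegrable (G.K j) v →
      (∀ z, G.pt z ∉ G.K j → v.U z = 0 ∧ v.D z = 0) →
      G.SqIntegrable G.Ω v ∧ G.normSq G.Ω v = G.normSq (G.K j) v := by
    intro v hv hv0
    have hsq : G.SqIntegrable G.Ω v := by
      rw [sqIntegrable_iff, ← hres] at hv
      rw [sqIntegrable_iff]
      have e1 : (G.pt ⁻¹' G.K j).indicator v.U = v.U :=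
        indicator_eq_self.2 fun z hz => by
          by_contra h
          exact hz (hv0 z h).1
      have e2 : (G.pt ⁻¹' G.K j).indicator v.D = v.D :=
        indicator_eq_self.2 fun z hz => by
          by_contra h
          exact hz (hv0 z h).2
      rw [← e1, ← e2, memLp_indicator_iff_restrict hm, memLp_indicator_iff_restrict hm]
      exact hv
    refine ⟨hsq, ?_⟩
    rw [hsq.normSq_eq, hv.normSq_eq, ← hres]
    symm
    apply setIntegral_eq_integral_of_forall_compl_eq_zero
    intro z hz
    rw [(hv0 z hz).1, (hv0 z hz).2]
    simp
  refine ⟨(hext hu.1 h0).1, fun ε hε => ?_⟩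
  obtain ⟨f, hf, hfu⟩ := hu.2 ε hε
  refine ⟨f, hf, ?_⟩
  rwa [(hext (hu.1.sub hf.sqIntegrable_lift) _).2]
  intro z hz
  have hz' : G.pt z ∉ tsupport f := fun h => hz (_root_.interior_subset (hf.2.2 h))
  rw [MixedFun.U_sub, MixedFun.D_sub, (h0 z hz).1, (h0 z hz).2, G.U_lift, hf.D_lift,
    image_eq_zero_of_notMem_tsupport hz', fderiv_of_notMem_tsupport ℝ hz', gradOf_zero]
  simp

end Geometry


namespace Geometry

variable {J N ι : Type*} (G : Geometry J N ι) [Fintype J] [Fintype N]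

/-! ### Gradients of nodal, cutoff and bubble functions -/

/-- `∑_k |∇ χ_k|²` at points of the matrix and of the fractures. -/
def hatW (z : MixedPt ι) : ℝ := ∑ k, ‖(G.lift (G.hat k)).D z‖ ^ 2

theorem hatW_nonneg (z : MixedPt ι) : 0 ≤ G.hatW z := Finset.sum_nonneg fun k _ => by positivity

theorem measurable_hatW [Countable ι] : Measurable G.hatW :=
  Finset.measurable_sum _ fun k _ => (G.measurable_D_lift _).norm.pow_const 2

/-- Cauchy–Schwarz over the four vertices. This `4`, doubled by the product rule, is the `8` of the
energy bounds below, which the summand `4²` in `D` absorbs. -/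
theorem sum_norm_D_sq_le (i : J) (z : MixedPt ι) :
    (∑ a, ‖(G.lift (G.hat (G.vert i a))).D z‖) ^ 2 ≤ 4 * G.hatW z := by
  have h1 := sq_sum_le_card_mul_sum_sq (s := (Finset.univ : Finset (Fin 4)))
    (f := fun a => ‖(G.lift (G.hat (G.vert i a))).D z‖)
  have h2 : ∑ a, ‖(G.lift (G.hat (G.vert i a))).D z‖ ^ 2 ≤ G.hatW z := by
    classical
    rw [hatW, ← Finset.sum_image (f := fun k => ‖(G.lift (G.hat k)).D z‖ ^ 2)
      (s := Finset.univ) (g := G.vert i) fun a _ b _ h => G.vert_injective i h]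
    exact Finset.sum_le_sum_of_subset_of_nonneg (Finset.subset_univ _) fun k _ _ => by positivity
  simp only [Finset.card_univ, Fintype.card_fin] at h1
  push_cast at h1
  linarith

theorem D_lift_hat_eq_zero {i : J} {z : MixedPt ι} (hz : G.pt z ∈ interior (G.K i)) {k : N}
    (hk : k ∉ range (G.vert i)) : (G.lift (G.hat k)).D z = 0 := by
  have h : HasFDerivAt (G.hat k) (0 : Plane →L[ℝ] ℝ) (G.pt z) :=
    (hasFDerivAt_const (0 : ℝ) _).congr_of_eventuallyEq (G.hat_eventuallyEq_zero hz hk)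
  rw [G.D_lift h, gradOf_zero]

theorem exists_hatW_le : ∃ C, 0 ≤ C ∧ ∀ j, ∀ z : MixedPt ι, G.pt z ∈ interior (G.K j) →
    G.hatW z ≤ C := by
  obtain ⟨C, hC, h⟩ := G.exists_hat_pointwise_lipschitz
  refine ⟨∑ _k : N, C ^ 2, by positivity, fun j z hz => Finset.sum_le_sum fun k _ => ?_⟩
  obtain ⟨f', hf'⟩ := G.exists_hasStrictFDerivAt_hat hz k
  rw [G.D_lift hf'.hasFDerivAt]
  refine pow_le_pow_left₀ (norm_nonneg _) ((G.norm_gradOf_le _ _).trans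
    (hf'.hasFDerivAt.le_of_lip' hC ?_)) 2
  filter_upwards [h _ (G.interior_subset j hz)] with y hy
  exact hy k

/-- Because `∑ χ_k pos_k` is the identity on an element, the gradients of the `χ_k` cannot be small
simultaneously; differentiating in the fracture direction shows the same for tangential derivatives.
Hence `s` controls the `L²` norm. -/
theorem exists_le_hatW : ∃ c > 0, ∀ j, ∀ z : MixedPt ι, G.pt z ∈ interior (G.K j) →
    c ≤ G.hatW z := by
  set R := ∑ k, ‖G.pos k‖ with hR
  have hR0 : 0 ≤ R := Finset.sum_nonneg fun k _ => norm_nonneg _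
  set n : ℝ := (Fintype.card N : ℝ) with hn
  have hpos : 0 < R ^ 2 * n + 1 := by positivity
  refine ⟨1 / (R ^ 2 * n + 1), by positivity, fun j z hz => ?_⟩
  choose f' hf' using G.exists_hasStrictFDerivAt_hat hz
  obtain ⟨h, hh, hdir⟩ := G.exists_direction z
  have hsum : HasFDerivAt (fun x => ∑ k, G.hat k x • G.pos k)
      (∑ k, (f' k).smulRight (G.pos k)) (G.pt z) :=
    HasFDerivAt.fun_sum fun k _ => (hf' k).hasFDerivAt.smul_const (G.pos k)
  have hid : HasFDerivAt (fun x => ∑ k, G.hat k x • G.pos k)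
      (ContinuousLinearMap.id ℝ Plane) (G.pt z) := by
    refine (hasFDerivAt_id _).congr_of_eventuallyEq ?_
    filter_upwards [mem_interior_iff_mem_nhds.1 hz] with x hx
    exact G.sum_hat_smul hx
  have e := congrArg (fun A : Plane →L[ℝ] Plane => A h) (hsum.unique hid)
  simp only [ContinuousLinearMap.coe_id', id_eq] at e
  rw [sum_apply] at e
  have hD : ∀ k, (G.lift (G.hat k)).D z = G.gradOf z (f' k) :=
    fun k => G.D_lift (hf' k).hasFDerivAt
  have hk0 : ∀ k, ‖G.pos k‖ ≤ R :=
    fun k => Finset.single_le_sum (fun k _ => norm_nonneg (G.pos k)) (Finset.mem_univ k)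
  have h1 : 1 ≤ R * ∑ k, ‖(G.lift (G.hat k)).D z‖ := by
    rw [← hh]
    conv_lhs => rw [← e]
    rw [Finset.mul_sum]
    refine (norm_sum_le _ _).trans (Finset.sum_le_sum fun k _ => ?_)
    rw [ContinuousLinearMap.smulRight_apply, norm_smul, Real.norm_eq_abs, hD, mul_comm]
    exact mul_le_mul (hk0 k) (hdir _) (abs_nonneg _) hR0
  have h2 := sq_sum_le_card_mul_sum_sq (s := (Finset.univ : Finset N))
    (f := fun k => ‖(G.lift (G.hat k)).D z‖)
  rw [Finset.card_univ] at h2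
  have h3 : (1 : ℝ) ≤ (R * ∑ k, ‖(G.lift (G.hat k)).D z‖) ^ 2 := one_le_pow₀ h1
  rw [mul_pow] at h3
  have h4 := mul_le_mul_of_nonneg_left h2 (sq_nonneg R)
  rw [div_le_iff₀ hpos]
  have h5 := G.hatW_nonneg z
  change R ^ 2 * _ ≤ R ^ 2 * (n * G.hatW z) at h4
  nlinarith

theorem abs_mul_sub_mul_le {s t s' t' : ℝ} (hs : s ∈ Icc (0 : ℝ) 1) (ht : t' ∈ Icc (0 : ℝ) 1) :
    |s * t - s' * t'| ≤ |s - s'| + |t - t'| := by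
  have : s * t - s' * t' = (s - s') * t' + s * (t - t') := by ring
  rw [this]
  refine (abs_add_le _ _).trans (add_le_add ?_ ?_)
  · rw [abs_mul, abs_of_nonneg ht.1]; exact mul_le_of_le_one_right (abs_nonneg _) ht.2
  · rw [abs_mul, abs_of_nonneg hs.1]; exact mul_le_of_le_one_left (abs_nonneg _) hs.2

theorem isCutoff_cutoff (j : J) (m : ℕ) :
    G.IsCutoff (G.cutoff (G.patch j m)) (interior (G.patchSet j (m + 1)) ∩ G.Ω) where
  nonneg := G.cutoff_nonneg _
  le_one := G.cutoff_le_one _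
  lipschitz := by
    obtain ⟨C, hC, h⟩ := G.exists_hat_pointwise_lipschitz
    refine ⟨∑ _k ∈ G.nodesOf (G.patch j m), C, by positivity, fun x hx => ?_⟩
    filter_upwards [h x hx] with y hy
    rw [cutoff, cutoff, ← Finset.sum_sub_distrib, Finset.sum_mul]
    exact (Finset.abs_sum_le_sum_abs _ _).trans (Finset.sum_le_sum fun k _ => hy k)
  strictDiff := by
    intro i x hx
    choose f' hf' using G.exists_hasStrictFDerivAt_hat hx
    exact ⟨_, HasStrictFDerivAt.fun_sum fun k _ => hf' k⟩
  pos_or_zero := by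
    intro i x hx
    by_cases h : ∃ a, G.vert i a ∈ G.nodesOf (G.patch j m)
    · obtain ⟨a, ha⟩ := h
      exact Or.inl (Finset.sum_pos' (fun k _ => G.hat_nonneg k x)
        ⟨_, ha, G.hat_pos_of_mem_interior hx a⟩)
    · right
      filter_upwards [mem_interior_iff_mem_nhds.1 hx] with y hy
      refine Finset.sum_eq_zero fun k hk => G.hat_eq_zero_of_notMem_range hy ?_
      rintro ⟨a, rfl⟩
      exact h ⟨a, hk⟩
  support := fun x hx h => G.mem_interior_patchSet_of_cutoff_pos hx h

theorem hasStrictFDerivAt_bubble {i j : J} {x : Plane} {f' : N → Plane →L[ℝ] ℝ}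
    (hf' : ∀ k, HasStrictFDerivAt (G.hat k) (f' k) x) :
    HasStrictFDerivAt (G.bubble j)
      (∑ a, (∏ b ∈ Finset.univ.erase a, G.hat (G.vert j b) x) • f' (G.vert j a)) x :=
  HasStrictFDerivAt.finsetProd fun a _ => hf' (G.vert j a)

theorem isCutoff_bubble (j : J) : G.IsCutoff (G.bubble j) (interior (G.K j)) where
  nonneg := G.bubble_nonneg _
  le_one := G.bubble_le_one _
  lipschitz := by
    obtain ⟨C, hC, h⟩ := G.exists_hat_pointwise_lipschitz
    refine ⟨4 * C, by positivity, fun x hx => ?_⟩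
    filter_upwards [h x hx] with y hy
    rw [bubble, bubble, Fin.prod_univ_four, Fin.prod_univ_four]
    have hI : ∀ a x, G.hat (G.vert j a) x ∈ Icc (0 : ℝ) 1 :=
      fun a x => ⟨G.hat_nonneg _ x, G.hat_le_one _ x⟩
    have hmul : ∀ {s t : ℝ}, s ∈ Icc (0 : ℝ) 1 → t ∈ Icc (0 : ℝ) 1 → s * t ∈ Icc (0 : ℝ) 1 :=
      fun hs ht => ⟨mul_nonneg hs.1 ht.1, mul_le_one₀ hs.2 ht.1 ht.2⟩
    have h1 := abs_mul_sub_mul_le (s' := G.hat (G.vert j 0) x) (t := G.hat (G.vert j 1) y)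
      (hI 0 y) (hI 1 x)
    have h2 := abs_mul_sub_mul_le (s' := G.hat (G.vert j 0) x * G.hat (G.vert j 1) x)
      (t := G.hat (G.vert j 2) y) (hmul (hI 0 y) (hI 1 y)) (hI 2 x)
    have h3 := abs_mul_sub_mul_le
      (s' := G.hat (G.vert j 0) x * G.hat (G.vert j 1) x * G.hat (G.vert j 2) x)
      (t := G.hat (G.vert j 3) y) (hmul (hmul (hI 0 y) (hI 1 y)) (hI 2 y)) (hI 3 x)
    linarith [hy (G.vert j 0), hy (G.vert j 1), hy (G.vert j 2), hy (G.vert j 3)]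
  strictDiff := by
    intro i x hx
    choose f' hf' using G.exists_hasStrictFDerivAt_hat hx
    exact ⟨_, G.hasStrictFDerivAt_bubble (i := i) hf'⟩
  pos_or_zero := by
    intro i x hx
    by_cases hij : i = j
    · subst hij
      exact Or.inl (G.bubble_pos_of_mem_interior hx)
    · right
      filter_upwards [mem_interior_iff_mem_nhds.1 hx] with y hy
      exact G.bubble_eq_zero_of_mem hij hy
  support := fun x hx h => G.mem_interior_of_bubble_pos hx h

theorem norm_D_cutoff_sq_le (P : Set J) {i : J} {z : MixedPt ι} (hz : G.pt z ∈ interior (G.K i)) :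
    ‖(G.lift (G.cutoff P)).D z‖ ^ 2 ≤ 4 * G.hatW z := by
  refine le_trans (pow_le_pow_left₀ (norm_nonneg _) ?_ 2) (G.sum_norm_D_sq_le i z)
  choose f' hf' using G.exists_hasStrictFDerivAt_hat hz
  have h : HasFDerivAt (G.cutoff P) (∑ k ∈ G.nodesOf P, f' k) (G.pt z) :=
    HasFDerivAt.fun_sum fun k _ => (hf' k).hasFDerivAt
  rw [G.D_lift h, gradOf_sum]
  have hD : ∀ k, (G.lift (G.hat k)).D z = G.gradOf z (f' k) :=
    fun k => G.D_lift (hf' k).hasFDerivAt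
  simp only [← hD]
  refine (norm_sum_le _ _).trans ?_
  refine (Finset.sum_le_sum_of_subset_of_nonneg (Finset.subset_univ _)
    fun k _ _ => norm_nonneg _).trans_eq ?_
  exact G.sum_eq_sum_vert fun k hk => by rw [G.D_lift_hat_eq_zero hz hk, norm_zero]

theorem norm_D_bubble_sq_le (j : J) {i : J} {z : MixedPt ι} (hz : G.pt z ∈ interior (G.K i)) :
    ‖(G.lift (G.bubble j)).D z‖ ^ 2 ≤ 4 * G.hatW z := by
  refine le_trans (pow_le_pow_left₀ (norm_nonneg _) ?_ 2) (G.sum_norm_D_sq_le j z)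
  choose f' hf' using G.exists_hasStrictFDerivAt_hat hz
  rw [G.D_lift (G.hasStrictFDerivAt_bubble (i := i) hf').hasFDerivAt, gradOf_sum]
  refine (norm_sum_le _ _).trans (Finset.sum_le_sum fun a _ => ?_)
  rw [G.D_lift (hf' _).hasFDerivAt, gradOf_smul, norm_smul, Real.norm_eq_abs,
    abs_of_nonneg (Finset.prod_nonneg fun b _ => G.hat_nonneg _ _)]
  exact mul_le_of_le_one_left (norm_nonneg _)
    (Finset.prod_le_one (fun b _ => G.hat_nonneg _ _) fun b _ => G.hat_le_one _ _)

theorem mul_bubble_eq_zero (j : J) (u : MixedFun ι) {z : MixedPt ι} (hz : G.pt z ∉ G.K j) :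
    (G.mul (G.bubble j) u).U z = 0 ∧ (G.mul (G.bubble j) u).D z = 0 := by
  have h0 := G.bubble_eq_zero_of_notMem hz
  have h1 : HasFDerivAt (G.bubble j) (0 : Plane →L[ℝ] ℝ) (G.pt z) := by
    refine (hasFDerivAt_const (0 : ℝ) _).congr_of_eventuallyEq ?_
    filter_upwards [(G.isClosed_K j).isOpen_compl.mem_nhds hz] with y hy
    exact G.bubble_eq_zero_of_notMem hy
  rw [G.U_mul, G.D_mul, h0, G.D_lift h1, gradOf_zero]
  simp

theorem D_lift_cutoff_eq_zero_of_mem {P : Set J} {i : J} (hi : i ∈ P) {z : MixedPt ι}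
    (hz : G.pt z ∈ interior (G.K i)) : (G.lift (G.cutoff P)).D z = 0 := by
  have h1 : HasFDerivAt (G.cutoff P) (0 : Plane →L[ℝ] ℝ) (G.pt z) := by
    refine (hasFDerivAt_const (1 : ℝ) _).congr_of_eventuallyEq ?_
    filter_upwards [mem_interior_iff_mem_nhds.1 hz] with y hy
    exact G.cutoff_eq_one hi hy
  rw [G.D_lift h1, gradOf_zero]

theorem cutoff_eq_zero_of_notMem {j : J} {m : ℕ} {i : J} (hi : i ∉ G.patch j (m + 1)) {x : Plane}
    (hx : x ∈ G.K i) : G.cutoff (G.patch j m) x = 0 := by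
  by_contra h
  exact hi (G.exists_common_of_cutoff_ne_zero hx h)

theorem D_lift_cutoff_eq_zero_of_notMem {j : J} {m : ℕ} {i : J} (hi : i ∉ G.patch j (m + 1))
    {z : MixedPt ι} (hz : G.pt z ∈ interior (G.K i)) :
    (G.lift (G.cutoff (G.patch j m))).D z = 0 := by
  have h1 : HasFDerivAt (G.cutoff (G.patch j m)) (0 : Plane →L[ℝ] ℝ) (G.pt z) := by
    refine (hasFDerivAt_const (0 : ℝ) _).congr_of_eventuallyEq ?_
    filter_upwards [mem_interior_iff_mem_nhds.1 hz] with y hy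
    exact G.cutoff_eq_zero_of_notMem hi hy
  rw [G.D_lift h1, gradOf_zero]

end Geometry

/-! ### The bilinear forms as integrals over the matrix and the fractures -/

namespace Medium

variable {J N ι : Type*} {G : Geometry J N ι} (M : Medium G)

/-- The permeability at a point of the matrix or of a fracture. -/
def kap (i : Fin 2) : MixedPt ι → ℝ := MixedPt.elim (M.κ i) fun l t => M.κf l i (G.γ l t)

/-- The exchange coefficient, which vanishes on the fractures. -/
def exch : MixedPt ι → ℝ := MixedPt.elim (fun _ => M.ρ * M.σ) fun _ _ => 0

theorem exch_nonneg (z : MixedPt ι) : 0 ≤ M.exch z := by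
  rcases z with x | ⟨l, t⟩
  · exact mul_nonneg M.ρ_nonneg M.σ_nonneg
  · exact le_rfl

theorem exch_le (z : MixedPt ι) : M.exch z ≤ M.ρ * M.σ := by
  rcases z with x | ⟨l, t⟩
  · exact le_rfl
  · exact mul_nonneg M.ρ_nonneg M.σ_nonneg

theorem measurable_exch [Countable ι] : Measurable M.exch :=
  MixedPt.measurable_elim measurable_const fun _ => measurable_const

theorem measurable_kap [Countable ι] (i : Fin 2) : Measurable (M.kap i) :=
  MixedPt.measurable_elim (M.measurable_κ i) fun l =>
    (M.measurable_κf l i).comp (G.continuous_γ l).measurable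

theorem kap_bounds (i : Fin 2) {z : MixedPt ι} (hz : G.pt z ∈ G.Ω) :
    M.κlo ≤ M.kap i z ∧ M.kap i z ≤ M.κhi := by
  rcases z with x | ⟨l, t⟩
  · exact M.κ_bounds i x hz
  · exact M.κf_bounds l i _ hz

theorem kap_pos (i : Fin 2) {z : MixedPt ι} (hz : G.pt z ∈ G.Ω) : 0 < M.kap i z :=
  M.κlo_pos.trans_le (M.kap_bounds i hz).1

/-- The density of the form `a_Q`. -/
def aDens (p v : DualFun ι) (z : MixedPt ι) : ℝ :=
  ∑ i, M.kap i z * inner ℝ ((p i).D z) ((v i).D z) +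
    M.exch z * (((p 0).U z - (p 1).U z) * ((v 0).U z - (v 1).U z))

variable [Fintype N]

/-- The density of the forms `s^{(j)}`. -/
def sDens (p v : DualFun ι) (z : MixedPt ι) : ℝ :=
  ∑ i, M.kap i z * G.hatW z * ((p i).U z * (v i).U z)

end Medium

namespace Geometry

variable {J N ι : Type*} (G : Geometry J N ι) [Fintype ι]

/-- Square integrability on `S` of both components. -/
def DualSqIntegrable (S : Set Plane) (p : DualFun ι) : Prop := ∀ i, G.SqIntegrable S (p i)

end Geometry

namespace Medium

open Geometry

variable {J N ι : Type*} {G : Geometry J N ι} (M : Medium G) [Fintype ι] {S : Set Plane}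
  {p v : DualFun ι}

theorem integrable_kap_inner (hS : ∀ᵐ z ∂G.mixedMeasure S, G.pt z ∈ G.Ω) (i : Fin 2)
    (hp : G.SqIntegrable S (p i)) (hv : G.SqIntegrable S (v i)) :
    Integrable (fun z => M.kap i z * inner ℝ ((p i).D z) ((v i).D z)) (G.mixedMeasure S) := by
  obtain ⟨-, hp⟩ := G.sqIntegrable_iff.1 hp
  obtain ⟨-, hv⟩ := G.sqIntegrable_iff.1 hv
  have h1 := (memLp_two_iff_integrable_sq_norm hp.1).1 hp
  have h2 := (memLp_two_iff_integrable_sq_norm hv.1).1 hv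
  refine ((h1.add h2).const_mul M.κhi).mono'
    ((M.measurable_kap i).aestronglyMeasurable.mul (hp.1.inner hv.1)) ?_
  filter_upwards [hS] with z hz
  have hk := M.kap_bounds i hz
  have hk0 := M.kap_pos i hz
  rw [norm_mul, Real.norm_eq_abs, abs_of_pos hk0]
  have h3 := norm_inner_le_norm (𝕜 := ℝ) ((p i).D z) ((v i).D z)
  refine mul_le_mul hk.2 ?_ (norm_nonneg _) (hk0.le.trans hk.2)
  simp only [Pi.add_apply]
  nlinarith [sq_nonneg (‖(p i).D z‖ - ‖(v i).D z‖), sq_nonneg ‖(p i).D z‖, sq_nonneg ‖(v i).D z‖]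

theorem integrable_exch_mul {f g : MixedPt ι → ℝ} (hf : MemLp f 2 (G.mixedMeasure S))
    (hg : MemLp g 2 (G.mixedMeasure S)) :
    Integrable (fun z => M.exch z * (f z * g z)) (G.mixedMeasure S) := by
  refine (hf.integrable_mul hg).bdd_mul (c := M.ρ * M.σ) M.measurable_exch.aestronglyMeasurable ?_
  refine ae_of_all _ fun z => ?_
  rw [Real.norm_eq_abs, abs_of_nonneg (M.exch_nonneg z)]
  exact M.exch_le z

theorem integrable_aDens (hS : ∀ᵐ z ∂G.mixedMeasure S, G.pt z ∈ G.Ω)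
    (hp : G.DualSqIntegrable S p) (hv : G.DualSqIntegrable S v) :
    Integrable (M.aDens p v) (G.mixedMeasure S) := by
  refine (integrable_finsetSum _ fun i _ => M.integrable_kap_inner hS i (hp i) (hv i)).add ?_
  exact M.integrable_exch_mul
    ((G.sqIntegrable_iff.1 (hp 0)).1.sub (G.sqIntegrable_iff.1 (hp 1)).1)
    ((G.sqIntegrable_iff.1 (hv 0)).1.sub (G.sqIntegrable_iff.1 (hv 1)).1)

theorem aQForm_eq (hS : ∀ᵐ z ∂G.mixedMeasure S, G.pt z ∈ G.Ω)
    (hp : G.DualSqIntegrable S p) (hv : G.DualSqIntegrable S v) :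
    M.aQForm S p v = ∫ z, M.aDens p v z ∂G.mixedMeasure S := by
  have hU : ∀ (u w : MixedFun ι), G.SqIntegrable S u → G.SqIntegrable S w →
      Integrable (fun x => u.val x * w.val x) (volume.restrict S) := fun u w hu hw =>
    hu.1.integrable_mul hw.1
  have hE : Integrable (fun z => M.exch z * (((p 0).U z - (p 1).U z) *
      ((v 0).U z - (v 1).U z))) (G.mixedMeasure S) := M.integrable_exch_mul
    ((G.sqIntegrable_iff.1 (hp 0)).1.sub (G.sqIntegrable_iff.1 (hp 1)).1)
    ((G.sqIntegrable_iff.1 (hv 0)).1.sub (G.sqIntegrable_iff.1 (hv 1)).1)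
  unfold aDens
  rw [integral_add (integrable_finsetSum _ fun i _ =>
      M.integrable_kap_inner hS i (hp i) (hv i)) hE,
    integral_finsetSum _ fun i _ => M.integrable_kap_inner hS i (hp i) (hv i), aQForm]
  congr 1
  · rw [aForm]
    refine Finset.sum_congr rfl fun i _ => ?_
    rw [G.integral_mixedMeasure (M.integrable_kap_inner hS i (hp i) (hv i))]
    congr 1
    refine Finset.sum_congr rfl fun l _ => ?_
    congr 1
    funext t
    change _ = _ * inner ℝ ((p i).fgrad l t • basisVec) ((v i).fgrad l t • basisVec)
    rw [inner_smul_left, inner_smul_right, real_inner_self_eq_norm_sq, norm_basisVec]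
    simp [kap]
  · rw [G.integral_mixedMeasure hE]
    have hfr : ∀ l t, M.exch (MixedPt.frac l t) = 0 := fun _ _ => rfl
    have hmt : ∀ x, M.exch (MixedPt.mat x) = M.ρ * M.σ := fun _ => rfl
    simp only [hfr, hmt, zero_mul, integral_zero, Finset.sum_const_zero, add_zero]
    rw [qForm, integral_const_mul]
    -- The diagonal terms of the double sum vanish, and the two others combine to the single product
    -- of differences `(p₀ - p₁)(v₀ - v₁)`.
    simp only [Fin.sum_univ_two, sub_self, zero_mul, integral_zero, mul_zero, zero_add, add_zero]
    rw [← mul_add, ← integral_add]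
    · congr 1
      congr 1
      funext x
      change _ = ((p 0).val x - (p 1).val x) * ((v 0).val x - (v 1).val x)
      ring
    · simp only [sub_mul]
      exact (hU _ _ (hp 0) (hv 0)).sub (hU _ _ (hp 1) (hv 0))
    · simp only [sub_mul]
      exact (hU _ _ (hp 1) (hv 1)).sub (hU _ _ (hp 0) (hv 1))

variable [Fintype J] [Fintype N]

theorem integrable_sDens_term (j : J) (i : Fin 2)
    (hp : G.SqIntegrable (G.K j) (p i)) (hv : G.SqIntegrable (G.K j) (v i)) :
    Integrable (fun z => M.kap i z * G.hatW z * ((p i).U z * (v i).U z))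
      (G.mixedMeasure (G.K j)) := by
  obtain ⟨C, hC, h⟩ := G.exists_hatW_le
  refine ((G.sqIntegrable_iff.1 hp).1.integrable_mul (G.sqIntegrable_iff.1 hv).1).bdd_mul
    (c := M.κhi * C)
    ((M.measurable_kap i).mul G.measurable_hatW).aestronglyMeasurable ?_
  filter_upwards [G.ae_mem_interior j] with z hz
  have hΩ := G.interior_subset j hz
  rw [norm_mul, Real.norm_eq_abs, Real.norm_eq_abs, abs_of_pos (M.kap_pos i hΩ),
    abs_of_nonneg (G.hatW_nonneg z)]
  exact mul_le_mul (M.kap_bounds i hΩ).2 (h j z hz) (G.hatW_nonneg z)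
    ((M.kap_pos i hΩ).le.trans (M.kap_bounds i hΩ).2)

theorem integrable_sDens (j : J)
    (hp : G.DualSqIntegrable (G.K j) p) (hv : G.DualSqIntegrable (G.K j) v) :
    Integrable (M.sDens p v) (G.mixedMeasure (G.K j)) :=
  integrable_finsetSum _ fun i _ => M.integrable_sDens_term j i (hp i) (hv i)

theorem sLoc_eq (j : J)
    (hp : G.DualSqIntegrable (G.K j) p) (hv : G.DualSqIntegrable (G.K j) v) :
    M.sLoc j p v = ∫ z, M.sDens p v z ∂G.mixedMeasure (G.K j) := by
  unfold sDens
  rw [integral_finsetSum _ fun i _ => M.integrable_sDens_term j i (hp i) (hv i), sLoc]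
  refine Finset.sum_congr rfl fun i _ => ?_
  rw [G.integral_mixedMeasure (M.integrable_sDens_term j i (hp i) (hv i))]
  congr 1
  refine Finset.sum_congr rfl fun l _ => ?_
  congr 1
  funext t
  have : G.hatW (MixedPt.frac l t) = G.hatFracGradSq l t := by
    refine Finset.sum_congr rfl fun k _ => ?_
    change ‖deriv (fun r => G.hat k (G.γ l r)) t • basisVec‖ ^ 2 = _
    rw [norm_smul, norm_basisVec, mul_one, Real.norm_eq_abs, sq_abs]
  rw [this]
  rfl

theorem aQLoc_eq (j : J)
    (hp : G.DualSqIntegrable (G.K j) p) (hv : G.DualSqIntegrable (G.K j) v) :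
    M.aQLoc j p v = ∫ z, M.aDens p v z ∂G.mixedMeasure (G.K j) :=
  M.aQForm_eq (G.ae_mem_Ω j) hp hv

theorem aQ_eq_sum (hp : G.DualSqIntegrable G.Ω p) (hv : G.DualSqIntegrable G.Ω v) :
    M.aQ p v = ∑ j, M.aQLoc j p v := by
  have hpj : ∀ j, G.DualSqIntegrable (G.K j) p := fun j i => (hp i).mono (G.mixedMeasure_K_le j)
  have hvj : ∀ j, G.DualSqIntegrable (G.K j) v := fun j i => (hv i).mono (G.mixedMeasure_K_le j)
  rw [aQ, M.aQForm_eq G.ae_mem_Ω' hp hv, G.mixedMeasure_Ω, integral_finsetSum_measure]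
  · exact Finset.sum_congr rfl fun j _ => (M.aQLoc_eq j (hpj j) (hvj j)).symm
  · exact fun j _ => M.integrable_aDens (G.ae_mem_Ω j) (hpj j) (hvj j)

end Medium


/-! ### Positive semidefinite forms and the spectral gap -/

section Forms

variable {X : Type*} [AddCommGroup X] [Module ℝ X]

theorem form_add_self_le (B : X →ₗ[ℝ] X →ₗ[ℝ] ℝ) (h0 : ∀ u, 0 ≤ B u u) (u v : X) :
    B (u + v) (u + v) ≤ 2 * B u u + 2 * B v v := by
  have := h0 (u - v)
  simp only [map_add, map_sub, LinearMap.add_apply, LinearMap.sub_apply] at *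
  linarith

theorem form_sq_le (B : X →ₗ[ℝ] X →ₗ[ℝ] ℝ) (hB : ∀ u v, B u v = B v u) (h0 : ∀ u, 0 ≤ B u u)
    (u v : X) : B u v ^ 2 ≤ B u u * B v v := by
  have key : ∀ t : ℝ, 0 ≤ B v v * (t * t) + (2 * B u v) * t + B u u := by
    intro t
    have := h0 (u + t • v)
    simp only [map_add, map_smul, LinearMap.add_apply, LinearMap.smul_apply, smul_eq_mul, hB v u] at this
    linarith
  have := discrim_le_zero key
  rw [discrim] at this
  linarith

open Filter in
-- The direct method for semidefinite forms. With `b = a + s`, let `τ` be the supremum of `s / b` on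
-- the space `Y` of vectors `s`-orthogonal to the first `L` eigenvectors. The form `q = τ b - s` is
-- semidefinite on `Y` and tends to zero along a maximizing sequence, so by the parallelogram law a
-- subsequence that is nearly constant for `s` is Cauchy for `b`. Its limit `x` satisfies `q(x, ·) =
-- 0`, so it is an eigenvector for `1/τ - 1`. If the gap fails this number is below `lam L`, so `x`
-- is orthogonal to all `φ k`, against `hexh`. Compactness is phrased with one ultrafilter, whose
-- sets can be intersected freely.
theorem spectral_gap (a s : X →ₗ[ℝ] X →ₗ[ℝ] ℝ) (ha : ∀ u v, a u v = a v u)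
    (hs : ∀ u v, s u v = s v u) (ha0 : ∀ u, 0 ≤ a u u) (hs0 : ∀ u, 0 ≤ s u u)
    (hcomplete : ∀ u : ℕ → X, (∀ ε > 0, ∃ K, ∀ m ≥ K, ∀ n ≥ K,
      (a + s) (u m - u n) (u m - u n) < ε) →
      ∃ v, Tendsto (fun n => (a + s) (u n - v) (u n - v)) atTop (nhds 0))
    (hcompact : ∀ u : ℕ → X, (∀ n, (a + s) (u n) (u n) ≤ 1) → ∀ ε > 0,
      ∃ A ∈ hyperfilter ℕ, ∀ m ∈ A, ∀ n ∈ A, s (u m - u n) (u m - u n) < ε)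
    {lam : ℕ → ℝ} {φ : ℕ → X} (heig : ∀ k v, a (φ k) v = lam k * s (φ k) v)
    (horth : ∀ k k', s (φ k) (φ k') = if k = k' then 1 else 0) (hmono : Monotone lam)
    (hexh : ∀ μ u, (∀ v, a u v = μ * s u v) → (∀ k, s u (φ k) = 0) → s u u = 0)
    {L : ℕ} {w : X} (hw : ∀ k < L, s w (φ k) = 0) : lam L * s w w ≤ a w w := by
  by_contra! hcon
  set b := a + s with hb
  have hbv : ∀ u v, b u v = a u v + s u v := fun u v => rfl
  have hb0 : ∀ u, 0 ≤ b u u := fun u => add_nonneg (ha0 u) (hs0 u)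
  have hsb : ∀ u, s u u ≤ b u u := fun u => le_add_of_nonneg_left (ha0 u)
  have hlam0 : 0 ≤ lam L := by
    have := heig L (φ L)
    rw [horth, if_pos rfl, mul_one] at this
    rw [← this]; exact ha0 _
  have hsw : 0 < s w w := by
    refine (hs0 w).lt_of_ne fun h => ?_
    rw [← h, mul_zero] at hcon
    exact absurd (ha0 w) (not_le.2 hcon)
  have hbw : 0 < b w w := hsw.trans_le (hsb w)
  let Y : Submodule ℝ X :=
    { carrier := {v | ∀ k < L, s v (φ k) = 0}
      add_mem' := fun {u v} hu hv k hk => by rw [map_add, LinearMap.add_apply, hu k hk, hv k hk, add_zero]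
      zero_mem' := fun k _ => by rw [map_zero]; rfl
      smul_mem' := fun c u hu k hk => by rw [map_smul, LinearMap.smul_apply, hu k hk, smul_zero] }
  set T : Set ℝ := {r | ∃ v ∈ Y, b v v ≤ 1 ∧ r = s v v} with hT
  have hTb : BddAbove T := ⟨1, by rintro r ⟨v, -, h1, rfl⟩; exact (hsb v).trans h1⟩
  have hTne : T.Nonempty := ⟨0, 0, Y.zero_mem, by simp, by simp⟩
  set τ := sSup T with hτ
  have hle : ∀ v ∈ Y, s v v ≤ τ * b v v := by
    intro v hv
    rcases (hb0 v).eq_or_lt with h | h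
    · rw [← h, mul_zero, h]; exact hsb v
    · have hr : √(b v v) ≠ 0 := (Real.sqrt_pos.2 h).ne'
      have hsq : √(b v v) * √(b v v) = b v v := Real.mul_self_sqrt h.le
      have hmem : s v v / b v v ∈ T := by
        refine ⟨(√(b v v))⁻¹ • v, Y.smul_mem _ hv, ?_, ?_⟩
        · simp only [map_smul, LinearMap.smul_apply, smul_eq_mul]
          rw [← mul_assoc, ← mul_inv, hsq, inv_mul_cancel₀ h.ne']
        · simp only [map_smul, LinearMap.smul_apply, smul_eq_mul]
          rw [← mul_assoc, ← mul_inv, hsq, div_eq_inv_mul]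
      have := le_csSup hTb hmem
      rwa [div_le_iff₀ h] at this
  -- The vector `w` that violates the gap has `b(w, w) < (1 + lam L) s(w, w)`, so its quotient
  -- exceeds `1 / (1 + lam L)`.
  have hτL : 1 < τ * (1 + lam L) := by
    have h1 := hle w hw
    have h2 : b w w < (1 + lam L) * s w w := by rw [hbv]; linarith
    by_contra! h3
    have hτ0 : 0 ≤ τ := by
      by_contra! h
      have := mul_neg_of_neg_of_pos h hbw
      linarith
    have h4 := mul_le_mul_of_nonneg_left h2.le hτ0
    have h5 := mul_le_mul_of_nonneg_right h3 (hs0 w)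
    rcases hτ0.eq_or_lt with h6 | h6
    · rw [← h6, zero_mul] at h1; linarith
    · have := mul_lt_mul_of_pos_left h2 h6
      nlinarith
  have hτ0 : 0 < τ := by
    by_contra! h
    have := mul_nonpos_of_nonpos_of_nonneg h (by linarith : 0 ≤ 1 + lam L)
    linarith
  have hseq : ∀ n : ℕ, ∃ v ∈ Y, b v v ≤ 1 ∧ τ - 1 / ((n : ℝ) + 1) < s v v := by
    intro n
    have : τ - 1 / ((n : ℝ) + 1) < sSup T := by
      rw [← hτ]; have : (0 : ℝ) < 1 / ((n : ℝ) + 1) := by positivity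
      linarith
    obtain ⟨r, ⟨v, hv, h1, rfl⟩, hr⟩ := exists_lt_of_lt_csSup hTne this
    exact ⟨v, hv, h1, hr⟩
  choose v hvY hvb hvs using hseq
  set q := τ • b - s with hq
  have hqv : ∀ x y, q x y = τ * b x y - s x y := fun x y => rfl
  have hq0 : ∀ x ∈ Y, 0 ≤ q x x := fun x hx => sub_nonneg.2 (hle x hx)
  have hqsub : ∀ x ∈ Y, ∀ y ∈ Y, q (x - y) (x - y) ≤ 2 * q x x + 2 * q y y := by
    intro x hx y hy
    have := hq0 _ (Y.add_mem hx hy)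
    simp only [map_add, map_sub, LinearMap.add_apply, LinearMap.sub_apply] at *
    linarith
  have hqn : ∀ n, q (v n) (v n) ≤ 1 / ((n : ℝ) + 1) := by
    intro n
    rw [hqv]
    have := mul_le_of_le_one_right hτ0.le (hvb n)
    linarith [hvs n]
  have hA : ∀ k : ℕ, ∃ A ∈ hyperfilter ℕ, ∀ m ∈ A, ∀ n ∈ A,
      s (v m - v n) (v m - v n) < 1 / ((k : ℝ) + 1) :=
    fun k => hcompact v hvb _ (by positivity)
  choose A hAU hAs using hA
  -- The diagonal choice: `e k` lies in the first `k + 1` sets of the ultrafilter and beyond `k`, so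
  -- it is both nearly constant for `s` and maximizing.
  have hind : ∀ k : ℕ, ∃ n, k ≤ n ∧ ∀ i ≤ k, n ∈ A i := by
    intro k
    have h1 : (⋂ i ∈ Finset.Iic k, A i) ∈ hyperfilter ℕ :=
      (biInter_finset_mem _).2 fun i _ => hAU i
    have h2 : Ici k ∈ hyperfilter ℕ :=
      hyperfilter_le_cofinite (by rw [Nat.cofinite_eq_atTop]; exact Ici_mem_atTop k)
    obtain ⟨n, hn1, hn2⟩ := (hyperfilter ℕ).nonempty_of_mem (inter_mem h1 h2)
    refine ⟨n, hn2, fun i hi => ?_⟩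
    exact mem_iInter₂.1 hn1 i (Finset.mem_Iic.2 hi)
  choose e hek heA using hind
  have hsmall : ∀ k : ℕ, 1 / ((e k : ℝ) + 1) ≤ 1 / ((k : ℝ) + 1) := by
    intro k
    have : (k : ℝ) ≤ e k := by exact_mod_cast hek k
    exact one_div_le_one_div_of_le (by positivity) (by linarith)
  have hmonoinv : ∀ {K k : ℕ}, K ≤ k → 1 / ((k : ℝ) + 1) ≤ 1 / ((K : ℝ) + 1) := by
    intro K k h
    have : (K : ℝ) ≤ k := by exact_mod_cast h
    exact one_div_le_one_div_of_le (by positivity) (by linarith)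
  have hcauchy : ∀ ε > 0, ∃ K, ∀ m ≥ K, ∀ n ≥ K,
      b (v (e m) - v (e n)) (v (e m) - v (e n)) < ε := by
    intro ε hε
    obtain ⟨K, hK⟩ := exists_nat_one_div_lt (show 0 < ε * τ / 5 by positivity)
    refine ⟨K, fun m hm n hn => ?_⟩
    have h1 := hqsub _ (hvY (e m)) _ (hvY (e n))
    rw [hqv] at h1
    have h2 := (hqn (e m)).trans ((hsmall m).trans (hmonoinv hm))
    have h3 := (hqn (e n)).trans ((hsmall n).trans (hmonoinv hn))
    have h4 := hAs K _ (heA m K hm) _ (heA n K hn)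
    have h5 : τ * b (v (e m) - v (e n)) (v (e m) - v (e n)) < τ * ε := by linarith
    exact lt_of_mul_lt_mul_left h5 hτ0.le
  obtain ⟨x, hx⟩ := hcomplete (fun k => v (e k)) hcauchy
  have hsx : Tendsto (fun k => s (v (e k) - x) (v (e k) - x)) atTop (nhds 0) :=
    squeeze_zero (fun k => hs0 _) (fun k => hsb _) hx
  have hinv : Tendsto (fun k : ℕ => 1 / ((k : ℝ) + 1)) atTop (nhds 0) :=
    tendsto_one_div_add_atTop_nhds_zero_nat
  have hxY : x ∈ Y := by
    intro i hi
    have h1 : ∀ k, s x (φ i) ^ 2 ≤ s (v (e k) - x) (v (e k) - x) := by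
      intro k
      have := form_sq_le s hs hs0 (v (e k) - x) (φ i)
      rw [horth i i, if_pos rfl, mul_one, map_sub, LinearMap.sub_apply, hvY (e k) i hi] at this
      simpa using this
    have h2 := ge_of_tendsto' hsx h1
    exact pow_eq_zero_iff (two_ne_zero) |>.1 (le_antisymm h2 (sq_nonneg _))
  have hqx : q x x = 0 := by
    refine le_antisymm ?_ (hq0 x hxY)
    have h1 : ∀ k : ℕ, q x x ≤ 2 * (1 / ((k : ℝ) + 1)) + 2 * (τ * b (v (e k) - x) (v (e k) - x)) := by
      intro k
      have h2 := hqsub _ (hvY (e k)) _ (Y.sub_mem (hvY (e k)) hxY)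
      rw [sub_sub_cancel] at h2
      have h3 : q (v (e k) - x) (v (e k) - x) ≤ τ * b (v (e k) - x) (v (e k) - x) := by
        rw [hqv]; linarith [hs0 (v (e k) - x)]
      linarith [(hqn (e k)).trans (hsmall k)]
    have h4 := (hinv.const_mul 2).add ((hx.const_mul τ).const_mul 2)
    simp only [mul_zero, add_zero] at h4
    exact ge_of_tendsto' h4 h1
  -- The maximizing values of `s` tend to at least `τ > 0`; the limit is not null for `s`.
  have hsx0 : 0 < s x x := by
    have h1 : ∀ k : ℕ, τ ≤ 1 / ((k : ℝ) + 1) + (2 * s x x +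
        2 * s (v (e k) - x) (v (e k) - x)) := by
      intro k
      have h2 := form_add_self_le s hs0 x (v (e k) - x)
      rw [add_sub_cancel] at h2
      linarith [hvs (e k), hsmall k]
    have h4 := hinv.add ((tendsto_const_nhds (x := 2 * s x x)).add (hsx.const_mul 2))
    simp only [mul_zero, add_zero, zero_add] at h4
    have := ge_of_tendsto' h4 h1
    linarith
  have hqY : ∀ y ∈ Y, q x y = 0 := by
    intro y hy
    have key : ∀ t : ℝ, 0 ≤ q y y * (t * t) + (2 * q x y) * t + 0 := by
      intro t
      have h1 := hq0 (x + t • y) (Y.add_mem hxY (Y.smul_mem t hy))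
      have hsym : q y x = q x y := by
        rw [hqv, hqv, hbv, hbv, ha y x, hs y x]
      simp only [map_add, map_smul, LinearMap.add_apply, LinearMap.smul_apply, smul_eq_mul, hsym, hqx] at h1
      linarith
    have h2 := discrim_le_zero key
    rw [discrim] at h2
    nlinarith
  have hxφ : ∀ k < L, s x (φ k) = 0 := hxY
  have hqφ : ∀ k < L, q x (φ k) = 0 := by
    intro k hk
    rw [hqv, hbv, ha, heig, hs (φ k), hxφ k hk]; simp
  -- `q(x, ·)` vanishes on `Y` and on the first `L` eigenvectors, and these span everything:
  -- subtracting the `s`-projection leads into `Y`.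
  have hqX : ∀ y, q x y = 0 := by
    intro y
    set y' := y - ∑ k ∈ Finset.range L, s y (φ k) • φ k with hy'
    have hy'Y : y' ∈ Y := by
      intro k hk
      rw [hy', map_sub, LinearMap.sub_apply, map_sum, LinearMap.sum_apply]
      simp only [map_smul, LinearMap.smul_apply, smul_eq_mul, horth]
      rw [Finset.sum_eq_single k]
      · simp
      · intro i _ hi; simp [hi]
      · intro h; exact absurd (Finset.mem_range.2 hk) h
    have h1 : y = y' + ∑ k ∈ Finset.range L, s y (φ k) • φ k := by rw [hy']; abel
    rw [h1, map_add, hqY y' hy'Y, map_sum, zero_add]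
    refine Finset.sum_eq_zero fun k hk => ?_
    rw [map_smul, hqφ k (Finset.mem_range.1 hk), smul_zero]
  have hax : ∀ y, a x y = (1 / τ - 1) * s x y := by
    intro y
    have h1 := hqX y
    rw [hqv, hbv] at h1
    field_simp
    linarith
  have hμ : 1 / τ - 1 < lam L := by
    rw [sub_lt_iff_lt_add, div_lt_iff₀ hτ0]
    linarith
  -- For `k < L` the vector `x ∈ Y` is orthogonal to `φ k` by construction; for `k ≥ L` because the
  -- eigenvalues differ.
  refine hsx0.ne' (hexh _ x hax fun k => ?_)
  rcases lt_or_ge k L with hk | hk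
  · exact hxφ k hk
  · have h1 := hax (φ k)
    rw [ha, heig, hs] at h1
    have h2 := hmono hk
    have h3 : (lam k - (1 / τ - 1)) * s x (φ k) = 0 := by linarith
    rcases mul_eq_zero.1 h3 with h4 | h4
    · linarith
    · exact h4

end Forms


/-! ### The Poincaré inequality on convex sets -/

section Poincare

open Module

variable {E : Type*} [NormedAddCommGroup E] [NormedSpace ℝ E]

theorem sq_sub_le_integral {f : E → ℝ} (hf : ContDiff ℝ 1 f) (x y : E) :
    (f y - f x) ^ 2 ≤
      ‖y - x‖ ^ 2 * ∫ t in (0 : ℝ)..1, ‖fderiv ℝ f (x + t • (y - x))‖ ^ 2 := by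
  have hd : ∀ t : ℝ, HasDerivAt (fun t : ℝ => f (x + t • (y - x)))
      (fderiv ℝ f (x + t • (y - x)) (y - x)) t := by
    intro t
    have h1 : HasDerivAt (fun t : ℝ => x + t • (y - x)) (y - x) t := by
      simpa using ((hasDerivAt_id t).smul_const (y - x)).const_add x
    exact ((hf.differentiable one_ne_zero _).hasFDerivAt).comp_hasDerivAt t h1
  have hc : Continuous fun t : ℝ => fderiv ℝ f (x + t • (y - x)) :=
    (hf.continuous_fderiv one_ne_zero).comp (by fun_prop)
  have hc1 : Continuous fun t : ℝ => fderiv ℝ f (x + t • (y - x)) (y - x) :=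
    hc.clm_apply continuous_const
  have h1 : ∫ t in (0 : ℝ)..1, fderiv ℝ f (x + t • (y - x)) (y - x) = f y - f x := by
    rw [intervalIntegral.integral_eq_sub_of_hasDerivAt (fun t _ => hd t)
      (hc1.intervalIntegrable _ _)]
    simp
  set g : ℝ → ℝ := fun t => fderiv ℝ f (x + t • (y - x)) (y - x) with hg
  -- Jensen's inequality for the square, from the nonnegativity of the variance of `g`.
  have h2 : (f y - f x) ^ 2 ≤ ∫ t in (0 : ℝ)..1, g t ^ 2 := by
    set m := f y - f x
    have h3 : 0 ≤ ∫ t in (0 : ℝ)..1, (g t - m) ^ 2 :=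
      intervalIntegral.integral_nonneg zero_le_one fun t _ => sq_nonneg _
    have h4 : ∫ t in (0 : ℝ)..1, (g t - m) ^ 2 =
        (∫ t in (0 : ℝ)..1, g t ^ 2) - 2 * m * (∫ t in (0 : ℝ)..1, g t) + m ^ 2 := by
      have h5 : ∀ t, (g t - m) ^ 2 = g t ^ 2 - 2 * m * g t + m ^ 2 := fun t => by ring
      simp only [h5]
      rw [intervalIntegral.integral_add, intervalIntegral.integral_sub,
        intervalIntegral.integral_const_mul]
      · simp
      all_goals exact Continuous.intervalIntegrable (by fun_prop) _ _
    rw [h4, h1] at h3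
    nlinarith
  refine h2.trans ?_
  rw [← intervalIntegral.integral_const_mul]
  refine intervalIntegral.integral_mono_on zero_le_one
    (Continuous.intervalIntegrable (by fun_prop) _ _)
    (Continuous.intervalIntegrable (by fun_prop) _ _) fun t _ => ?_
  have h6 : |g t| ≤ ‖fderiv ℝ f (x + t • (y - x))‖ * ‖y - x‖ :=
    (fderiv ℝ f (x + t • (y - x))).le_opNorm _
  rw [← sq_abs (g t)]
  calc |g t| ^ 2 ≤ (‖fderiv ℝ f (x + t • (y - x))‖ * ‖y - x‖) ^ 2 :=
        pow_le_pow_left₀ (abs_nonneg _) h6 2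
    _ = _ := by ring

variable [FiniteDimensional ℝ E] [MeasurableSpace E] [BorelSpace E]
  (μ : Measure E) [μ.IsAddHaarMeasure]

open ENNReal in
/-- Integrals over the image of a convex set under a homothety with center in the set. -/
theorem lintegral_homothety_le {C : Set E} (hC : Convex ℝ C) (hCm : MeasurableSet C)
    {g : E → ℝ≥0∞} (hg : Measurable g) {x : E} (hx : x ∈ C) {t : ℝ} (ht : 1 / 2 ≤ t)
    (ht1 : t ≤ 1) :
    ∫⁻ y in C, g (x + t • (y - x)) ∂μ ≤ 2 ^ finrank ℝ E * ∫⁻ y in C, g y ∂μ := by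
  have ht0 : 0 < t := by linarith
  have h1 : ∫⁻ y in C, g (x + t • (y - x)) ∂μ ≤
      ∫⁻ y, (C.indicator g) (x + t • (y - x)) ∂μ := by
    rw [← lintegral_indicator hCm]
    refine lintegral_mono fun y => ?_
    by_cases hy : y ∈ C
    · have : x + t • (y - x) ∈ C := by
        have := hC hx hy (sub_nonneg.2 ht1) ht0.le (by ring)
        convert this using 1
        module
      rw [indicator_of_mem hy, indicator_of_mem this]
    · rw [indicator_of_notMem hy]; exact zero_le
  refine h1.trans ?_
  have h2 : ∀ y, x + t • (y - x) = t • (y + (t⁻¹ • x - x)) := by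
    intro y
    rw [smul_add, smul_sub t (t⁻¹ • x), smul_smul t t⁻¹, mul_inv_cancel₀ ht0.ne', one_smul,
      smul_sub]
    abel
  simp only [h2]
  rw [lintegral_add_right_eq_self (μ := μ) (fun y => C.indicator g (t • y)) (t⁻¹ • x - x)]
  have h3 : ∫⁻ y, C.indicator g (t • y) ∂μ = ∫⁻ y, C.indicator g y ∂(μ.map (t • ·)) := by
    rw [lintegral_map (hg.indicator hCm) (measurable_const_smul t)]
  rw [h3, Measure.map_addHaar_smul μ ht0.ne', lintegral_smul_measure, lintegral_indicator hCm,
    smul_eq_mul]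
  gcongr
  rw [← ENNReal.ofReal_ofNat, ← ENNReal.ofReal_pow (by norm_num)]
  refine ENNReal.ofReal_le_ofReal ?_
  rw [abs_of_pos (by positivity), ← inv_pow]
  exact pow_le_pow_left₀ (by positivity) (inv_le_of_inv_le₀ (by norm_num) (by linarith)) _

open ENNReal in
-- A point of the segment at parameter `t` is a homothetic image of `y` with ratio `t` and of `x`
-- with ratio `1 - t`. One of the ratios is at least `1/2`, so the change of variables in that
-- variable costs at most `2 ^ dim`.
theorem lintegral_lintegral_segment_le {C : Set E} (hC : Convex ℝ C) (hCm : MeasurableSet C)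
    (hCf : μ C ≠ ∞) {g : E → ℝ≥0∞} (hg : Measurable g) :
    ∫⁻ x in C, ∫⁻ y in C, ∫⁻ t in Ioc (0 : ℝ) 1, g (x + t • (y - x)) ∂volume ∂μ ∂μ ≤
      2 ^ finrank ℝ E * μ C * ∫⁻ y in C, g y ∂μ := by
  have hfin : IsFiniteMeasure (μ.restrict C) := ⟨by
    rw [Measure.restrict_apply_univ]; exact hCf.lt_top⟩
  have hm : Measurable fun q : E × E × ℝ => g (q.1 + q.2.2 • (q.2.1 - q.1)) :=
    hg.comp (by fun_prop)
  have e1 : ∀ x, ∫⁻ y in C, ∫⁻ t in Ioc (0 : ℝ) 1, g (x + t • (y - x)) ∂volume ∂μ =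
      ∫⁻ t in Ioc (0 : ℝ) 1, ∫⁻ y in C, g (x + t • (y - x)) ∂μ ∂volume := by
    intro x
    refine lintegral_lintegral_swap ?_
    exact (hg.comp (f := fun q : E × ℝ => x + q.2 • (q.1 - x)) (by fun_prop)).aemeasurable
  simp only [e1]
  rw [lintegral_lintegral_swap]
  swap
  · refine Measurable.aemeasurable ?_
    have : Measurable fun q : (E × ℝ) × E => g (q.1.1 + q.1.2 • (q.2 - q.1.1)) :=
      hg.comp (by fun_prop)
    exact this.lintegral_prod_right'
  have key : ∀ t ∈ Ioc (0 : ℝ) 1, ∫⁻ x in C, ∫⁻ y in C, g (x + t • (y - x)) ∂μ ∂μ ≤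
      2 ^ finrank ℝ E * μ C * ∫⁻ y in C, g y ∂μ := by
    intro t ht
    have hconst : ∫⁻ x in C, (2 ^ finrank ℝ E * ∫⁻ y in C, g y ∂μ) ∂μ =
        2 ^ finrank ℝ E * μ C * ∫⁻ y in C, g y ∂μ := by
      rw [setLIntegral_const]; ring
    rw [← hconst]
    rcases le_total (1 / 2) t with h | h
    · exact setLIntegral_mono' hCm fun x hx => lintegral_homothety_le μ hC hCm hg hx h ht.2
    · rw [lintegral_lintegral_swap]
      · refine setLIntegral_mono' hCm fun y hy => ?_
        have := lintegral_homothety_le μ hC hCm hg hy (t := 1 - t) (by linarith)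
          (by linarith [ht.1])
        have e : ∀ x, x + t • (y - x) = y + (1 - t) • (x - y) := fun x => by module
        simpa only [e] using this
      · exact (hg.comp (f := fun q : E × E => q.1 + t • (q.2 - q.1))
          (by fun_prop)).aemeasurable
  calc _ ≤ ∫⁻ t in Ioc (0 : ℝ) 1, 2 ^ finrank ℝ E * μ C * ∫⁻ y in C, g y ∂μ :=
        setLIntegral_mono' measurableSet_Ioc key
    _ = _ := by rw [setLIntegral_const]; simp

theorem Continuous.integrableOn_isBounded {F : Type*} [NormedAddCommGroup F] {f : E → F}
    (hf : Continuous f) {C : Set E} (hC : Bornology.IsBounded C) : IntegrableOn f C μ :=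
  (hf.continuousOn.integrableOn_compact hC.isCompact_closure).mono_set subset_closure

/-- The double integral of `(f y - f x)²` equals `2 |C| ∫ f² - 2 (∫ f)²`, and it is bounded by
integrating the gradient over segments. The constant depends on the diameter only, not on the shape
of `C`, so thin grid cells cut by the boundary do no harm. -/
theorem poincare_of_convex {C : Set E} (hC : Convex ℝ C) (hCm : MeasurableSet C)
    (hCb : Bornology.IsBounded C) {δ : ℝ} (hδ : ∀ x ∈ C, ∀ y ∈ C, ‖y - x‖ ≤ δ)
    {f : E → ℝ} (hf : ContDiff ℝ 1 f) :
    ∫ x in C, f x ^ 2 ∂μ ≤ (μ.real C)⁻¹ * (∫ x in C, f x ∂μ) ^ 2 +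
      2 ^ finrank ℝ E * δ ^ 2 * ∫ x in C, ‖fderiv ℝ f x‖ ^ 2 ∂μ := by
  have hCf : μ C ≠ ⊤ := hCb.measure_lt_top.ne
  have hfin : IsFiniteMeasure (μ.restrict C) := ⟨by
    rw [Measure.restrict_apply_univ]; exact hCf.lt_top⟩
  have hcf' : Continuous (fderiv ℝ f) := hf.continuous_fderiv one_ne_zero
  have hcf := hf.continuous
  set S := ∫ x in C, f x ^ 2 ∂μ with hS
  set I := ∫ x in C, f x ∂μ with hI
  set m := μ.real C with hm
  set Q := ∫ x in C, ‖fderiv ℝ f x‖ ^ 2 ∂μ with hQ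
  have hQ0 : 0 ≤ Q := integral_nonneg fun x => by positivity
  have hif : IntegrableOn f C μ := hcf.integrableOn_isBounded μ hCb
  have hif2 : IntegrableOn (fun x => f x ^ 2) C μ :=
    (hcf.pow 2).integrableOn_isBounded μ hCb
  have hinner : ∀ x, ∫ y in C, (f y - f x) ^ 2 ∂μ = S - 2 * f x * I + m * f x ^ 2 := by
    intro x
    have h5 : ∀ y, (f y - f x) ^ 2 = f y ^ 2 - 2 * f x * f y + f x ^ 2 := fun y => by ring
    simp only [h5]
    have h6 : Integrable (fun y => 2 * f x * f y) (μ.restrict C) := hif.const_mul _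
    have h7 : Integrable (fun y => f y ^ 2 - 2 * f x * f y) (μ.restrict C) := hif2.sub h6
    rw [integral_add h7 (integrable_const _), integral_sub hif2 h6, integral_const_mul]
    simp [hS, hI, hm, Measure.real]
  have houter : ∫ x in C, ∫ y in C, (f y - f x) ^ 2 ∂μ ∂μ = 2 * m * S - 2 * I ^ 2 := by
    simp only [hinner]
    have h5 : ∀ x, S - 2 * f x * I + m * f x ^ 2 = S - (2 * I) * f x + m * f x ^ 2 :=
      fun x => by ring
    simp only [h5]
    have h6 : Integrable (fun x => 2 * I * f x) (μ.restrict C) := hif.const_mul _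
    have h7 : Integrable (fun x => S - 2 * I * f x) (μ.restrict C) := (integrable_const _).sub h6
    have h8 : Integrable (fun x => m * f x ^ 2) (μ.restrict C) := hif2.const_mul _
    rw [integral_add h7 h8, integral_sub (integrable_const _) h6, integral_const_mul,
      integral_const_mul]
    simp only [integral_const, smul_eq_mul, measureReal_restrict_apply_univ]
    rw [← hm, ← hS, ← hI]; ring
  have hbound : 2 * m * S - 2 * I ^ 2 ≤ δ ^ 2 * (2 ^ finrank ℝ E * m * Q) := by
    rw [← houter]
    have hi : ∀ x, Integrable (fun y => (f y - f x) ^ 2) (μ.restrict C) := fun x =>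
      ((hcf.sub continuous_const).pow 2).integrableOn_isBounded μ hCb
    have hio : Integrable (fun x => ∫ y in C, (f y - f x) ^ 2 ∂μ) (μ.restrict C) := by
      simp only [hinner]
      refine Continuous.integrableOn_isBounded μ ?_ hCb
      fun_prop
    have hnn : 0 ≤ δ ^ 2 * (2 ^ finrank ℝ E * m * Q) := by
      have : 0 ≤ m := measureReal_nonneg
      positivity
    rw [← ENNReal.ofReal_le_ofReal_iff hnn, ofReal_integral_eq_lintegral_ofReal hio
      (Filter.Eventually.of_forall fun x => integral_nonneg fun y => sq_nonneg _)]
    have hg : Measurable fun z => ENNReal.ofReal (‖fderiv ℝ f z‖ ^ 2) := by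
      exact ENNReal.measurable_ofReal.comp ((hcf'.norm.pow 2).measurable)
    have hpt : ∀ x ∈ C, ENNReal.ofReal (∫ y in C, (f y - f x) ^ 2 ∂μ) ≤
        ENNReal.ofReal (δ ^ 2) * ∫⁻ y in C, ∫⁻ t in Ioc (0 : ℝ) 1,
          ENNReal.ofReal (‖fderiv ℝ f (x + t • (y - x))‖ ^ 2) ∂volume ∂μ := by
      intro x hx
      rw [ofReal_integral_eq_lintegral_ofReal (hi x)
        (Filter.Eventually.of_forall fun y => sq_nonneg _), ← lintegral_const_mul]
      swap
      · exact (hg.comp (f := fun q : E × ℝ => x + q.2 • (q.1 - x))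
          (by fun_prop)).lintegral_prod_right'
      refine setLIntegral_mono' hCm fun y hy => ?_
      have h1 := sq_sub_le_integral hf x y
      have hc : Continuous fun t : ℝ => ‖fderiv ℝ f (x + t • (y - x))‖ ^ 2 := by fun_prop
      rw [← ofReal_integral_eq_lintegral_ofReal
        ((hc.intervalIntegrable 0 1).1) (Filter.Eventually.of_forall fun t => by positivity),
        ← ENNReal.ofReal_mul (by positivity), ← intervalIntegral.integral_of_le zero_le_one]
      refine ENNReal.ofReal_le_ofReal (h1.trans ?_)
      have h2 : 0 ≤ ∫ t in (0 : ℝ)..1, ‖fderiv ℝ f (x + t • (y - x))‖ ^ 2 :=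
        intervalIntegral.integral_nonneg zero_le_one fun t _ => by positivity
      gcongr
      exact hδ x hx y hy
    refine (setLIntegral_mono' hCm hpt).trans ?_
    rw [lintegral_const_mul]
    swap
    · have : Measurable fun q : (E × E) × ℝ =>
          ENNReal.ofReal (‖fderiv ℝ f (q.1.1 + q.2 • (q.1.2 - q.1.1))‖ ^ 2) :=
        hg.comp (f := fun q : (E × E) × ℝ => q.1.1 + q.2 • (q.1.2 - q.1.1)) (by fun_prop)
      exact this.lintegral_prod_right'.lintegral_prod_right'
    rw [ENNReal.ofReal_mul (by positivity)]
    gcongr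
    refine (lintegral_lintegral_segment_le μ hC hCm hCf hg).trans_eq ?_
    have hiQ : IntegrableOn (fun x => ‖fderiv ℝ f x‖ ^ 2) C μ :=
      (hcf'.norm.pow 2).integrableOn_isBounded μ hCb
    rw [ENNReal.ofReal_mul (by positivity), ENNReal.ofReal_mul (by positivity), hQ,
      ofReal_integral_eq_lintegral_ofReal hiQ
      (Filter.Eventually.of_forall fun y => by positivity), ENNReal.ofReal_pow (by norm_num),
      ENNReal.ofReal_ofNat, hm, Measure.real, ENNReal.ofReal_toReal hCf]
  -- On a null set all integrals vanish, so the value of the inverse of `0` does not matter.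
  rcases (measureReal_nonneg (μ := μ) (s := C)).eq_or_lt with h0 | h0
  · have : μ C = 0 := by
      rw [Measure.real, eq_comm, ENNReal.toReal_eq_zero_iff] at h0
      exact h0.resolve_right hCf
    have hr : μ.restrict C = 0 := Measure.restrict_eq_zero.2 this
    rw [hS, hI, hQ, hr]; simp
  · rw [← hm] at h0
    have h1 : 0 ≤ δ ^ 2 * (2 ^ finrank ℝ E * Q) := by positivity
    have h2 : m * S ≤ m * (m⁻¹ * I ^ 2 + 2 ^ finrank ℝ E * δ ^ 2 * Q) := by
      rw [mul_add, mul_inv_cancel_left₀ h0.ne']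
      nlinarith [mul_nonneg h0.le h1]
    exact le_of_mul_le_mul_left h2 h0

end Poincare


/-! ### Rellich compactness on convex sets -/

section Rellich

open Module Filter

/-- Bounded sequences converge along an ultrafilter. With the fixed ultrafilter `hyperfilter ℕ`,
finitely many such selections are made at once by intersecting sets instead of passing to
subsequences. -/
theorem exists_mem_hyperfilter_abs_sub_lt {x : ℕ → ℝ} {M : ℝ} (hx : ∀ n, |x n| ≤ M) {η : ℝ}
    (hη : 0 < η) : ∃ A ∈ hyperfilter ℕ, ∀ m ∈ A, ∀ n ∈ A, |x m - x n| < η := by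
  have h1 : ((hyperfilter ℕ).map x : Filter ℝ) ≤ 𝓟 (Icc (-M) M) := by
    rw [le_principal_iff]
    exact Filter.mem_map.2 (Filter.univ_mem' fun n => abs_le.1 (hx n))
  obtain ⟨y, -, hy⟩ := isCompact_Icc.ultrafilter_le_nhds _ h1
  refine ⟨x ⁻¹' Metric.ball y (η / 2), hy (Metric.ball_mem_nhds _ (half_pos hη)), ?_⟩
  intro m hm n hn
  have h2 : |x m - y| < η / 2 := hm
  have h3 : |x n - y| < η / 2 := hn
  rw [abs_lt] at *
  constructor <;> linarith

theorem exists_pos_mul_sq_lt (S : ℝ) {ε : ℝ} (hε : 0 < ε) : ∃ η > 0, S * η ^ 2 < ε := by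
  have h : ContinuousAt (fun η : ℝ => S * η ^ 2) 0 := by fun_prop
  have h1 : ∀ᶠ η in nhds (0 : ℝ), S * η ^ 2 < ε := h.eventually_lt continuousAt_const (by simpa)
  obtain ⟨η, h2, h3⟩ := ((h1.filter_mono nhdsWithin_le_nhds).and
    (self_mem_nhdsWithin : Ioi (0 : ℝ) ∈ nhdsWithin 0 (Ioi 0))).exists
  exact ⟨η, h3, h2⟩

variable {E : Type*} [NormedAddCommGroup E] [NormedSpace ℝ E] {α : Type*} [Fintype α]

/-- A cell of the grid of mesh width `δ`. -/
def gridCell (e : α → E →L[ℝ] ℝ) (δ : ℝ) (k : α → ℤ) : Set E := {x | ∀ i, ⌊e i x / δ⌋ = k i}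

theorem gridCell_eq (e : α → E →L[ℝ] ℝ) {δ : ℝ} (hδ : 0 < δ) (k : α → ℤ) :
    gridCell e δ k = ⋂ i, e i ⁻¹' Ico (k i * δ) ((k i + 1) * δ) := by
  ext x
  simp only [gridCell, mem_ofPred_eq, mem_iInter, mem_preimage, mem_Ico, Int.floor_eq_iff,
    le_div_iff₀ hδ, div_lt_iff₀ hδ]

theorem convex_gridCell (e : α → E →L[ℝ] ℝ) {δ : ℝ} (hδ : 0 < δ) (k : α → ℤ) :
    Convex ℝ (gridCell e δ k) := by
  rw [gridCell_eq e hδ]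
  exact convex_iInter fun i => (convex_Ico _ _).is_linear_preimage (e i).toLinearMap.isLinear

theorem norm_sub_le_of_mem_gridCell {e : α → E →L[ℝ] ℝ} (he : ∀ x, ‖x‖ ≤ ∑ i, |e i x|) {δ : ℝ}
    (hδ : 0 < δ) {k : α → ℤ} {x y : E} (hx : x ∈ gridCell e δ k) (hy : y ∈ gridCell e δ k) :
    ‖y - x‖ ≤ Fintype.card α * δ := by
  rw [gridCell_eq e hδ, mem_iInter] at hx hy
  refine (he _).trans ?_
  rw [← nsmul_eq_mul, ← Finset.card_univ]
  refine Finset.sum_le_card_nsmul _ _ _ fun i _ => ?_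
  have h1 := hx i
  have h2 := hy i
  simp only [mem_preimage, mem_Ico] at h1 h2
  rw [map_sub, abs_le]
  constructor <;> linarith

variable [FiniteDimensional ℝ E] [MeasurableSpace E] [BorelSpace E]
  (μ : Measure E) [μ.IsAddHaarMeasure]

theorem measurableSet_gridCell (e : α → E →L[ℝ] ℝ) {δ : ℝ} (hδ : 0 < δ) (k : α → ℤ) :
    MeasurableSet (gridCell e δ k) := by
  rw [gridCell_eq e hδ]
  exact MeasurableSet.iInter fun i => (e i).continuous.measurable measurableSet_Ico

open Classical in
theorem exists_finset_gridCell_cover (e : α → E →L[ℝ] ℝ) {K : Set E}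
    (hK : Bornology.IsBounded K) {δ : ℝ} (hδ : 0 < δ) :
    ∃ T : Finset (α → ℤ), K = ⋃ k ∈ T, K ∩ gridCell e δ k := by
  obtain ⟨R, hR⟩ := hK.exists_norm_le
  have hb : ∀ i, ∃ n : ℕ, ∀ x ∈ K, |e i x / δ| ≤ n := by
    intro i
    obtain ⟨n, hn⟩ := exists_nat_ge (‖e i‖ * R / δ)
    refine ⟨n, fun x hx => ?_⟩
    rw [abs_div, abs_of_pos hδ]
    refine le_trans ?_ hn
    gcongr
    exact (e i).le_opNorm_of_le (hR x hx)
  choose n hn using hb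
  refine ⟨Fintype.piFinset fun i => Finset.Icc (-(n i : ℤ)) (n i), ?_⟩
  ext x
  simp only [mem_iUnion, mem_inter_iff, exists_prop]
  refine ⟨fun hx => ⟨fun i => ⌊e i x / δ⌋, ?_, hx, fun i => rfl⟩, fun ⟨_, _, h, _⟩ => h⟩
  rw [Fintype.mem_piFinset]
  intro i
  have := abs_le.1 (hn i x hx)
  rw [Finset.mem_Icc]
  constructor
  · rw [Int.le_floor]; push_cast; exact this.1
  · rw [← Int.cast_le (R := ℝ)]; exact (Int.floor_le _).trans (by simpa using this.2)

open Classical in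
/-- Sequences bounded in `H¹` of a convex set have nearly constant subsequences in `L²`. -/
theorem exists_mem_hyperfilter_integral_sub_sq_lt {e : α → E →L[ℝ] ℝ}
    (he : ∀ x, ‖x‖ ≤ ∑ i, |e i x|) {K : Set E} (hK : Convex ℝ K) (hKm : MeasurableSet K)
    (hKb : Bornology.IsBounded K) {f : ℕ → E → ℝ} (hf : ∀ n, ContDiff ℝ 1 (f n)) {M : ℝ}
    (hM : ∀ n, ∫ x in K, (f n x ^ 2 + ‖fderiv ℝ (f n) x‖ ^ 2) ∂μ ≤ M) {ε : ℝ} (hε : 0 < ε) :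
    ∃ A ∈ hyperfilter ℕ, ∀ m ∈ A, ∀ n ∈ A, ∫ x in K, (f m x - f n x) ^ 2 ∂μ < ε := by
  have hfin : IsFiniteMeasure (μ.restrict K) := ⟨by
    rw [Measure.restrict_apply_univ]; exact hKb.measure_lt_top⟩
  have hc := fun n => (hf n).continuous
  have hc' := fun n => (hf n).continuous_fderiv one_ne_zero
  have hi : ∀ n, IntegrableOn (fun x => f n x ^ 2 + ‖fderiv ℝ (f n) x‖ ^ 2) K μ := fun n =>
    (((hc n).pow 2).add ((hc' n).norm.pow 2)).integrableOn_isBounded μ hKb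
  have hI : ∀ C ⊆ K, ∀ n, |∫ x in C, f n x ∂μ| ≤ μ.real K + M := by
    intro C hC n
    calc |∫ x in C, f n x ∂μ| ≤ ∫ x in C, |f n x| ∂μ := abs_integral_le_integral_abs
      _ ≤ ∫ x in K, |f n x| ∂μ := setIntegral_mono_set
          ((hc n).abs.integrableOn_isBounded μ hKb)
          (Eventually.of_forall fun x => abs_nonneg _) (Eventually.of_forall hC)
      _ ≤ ∫ x in K, (1 + (f n x ^ 2 + ‖fderiv ℝ (f n) x‖ ^ 2)) ∂μ := by
          refine integral_mono ((hc n).abs.integrableOn_isBounded μ hKb)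
            ((integrable_const _).add (hi n)) fun x => ?_
          have := sq_nonneg (|f n x| - 1)
          have h2 := sq_abs (f n x)
          have h3 := sq_nonneg ‖fderiv ℝ (f n) x‖
          change |f n x| ≤ 1 + (f n x ^ 2 + ‖fderiv ℝ (f n) x‖ ^ 2)
          nlinarith [abs_nonneg (f n x)]
      _ ≤ μ.real K + M := by
          rw [integral_add (integrable_const _) (hi n)]
          simpa using hM n
  -- The mesh width makes the gradient terms at most `ε / 2`. The tolerance `η` for the cell
  -- integrals comes afterwards, since it depends on the inverse measures of the finitely many
  -- cells.
  obtain ⟨δ, hδ, hδε⟩ := exists_pos_mul_sq_lt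
    (2 ^ finrank ℝ E * (Fintype.card α : ℝ) ^ 2 * (4 * M)) (half_pos hε)
  obtain ⟨T, hT⟩ := exists_finset_gridCell_cover e hKb hδ
  obtain ⟨η, hη, hηε⟩ := exists_pos_mul_sq_lt
    (∑ k ∈ T, (μ.real (K ∩ gridCell e δ k))⁻¹) (half_pos hε)
  have hA : ∀ k, ∃ A ∈ hyperfilter ℕ, ∀ m ∈ A, ∀ n ∈ A,
      |(∫ x in K ∩ gridCell e δ k, f m x ∂μ) - ∫ x in K ∩ gridCell e δ k, f n x ∂μ| < η :=
    fun k => exists_mem_hyperfilter_abs_sub_lt (hI _ inter_subset_left) hη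
  choose A hAU hAs using hA
  refine ⟨⋂ k ∈ T, A k, (biInter_finset_mem _).2 fun k _ => hAU k, fun m hm n hn => ?_⟩
  have hg : ContDiff ℝ 1 fun x => f m x - f n x := (hf m).sub (hf n)
  have hmeas : ∀ k, MeasurableSet (K ∩ gridCell e δ k) := fun k =>
    hKm.inter (measurableSet_gridCell e hδ k)
  have hdisj : (T : Set (α → ℤ)).Pairwise (Function.onFun Disjoint fun k => K ∩ gridCell e δ k) := by
    intro k _ k' _ hkk'
    refine Set.disjoint_left.2 fun x hx hx' => hkk' ?_
    funext i
    rw [← hx.2 i, ← hx'.2 i]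
  have hsplit : ∀ h : E → ℝ, Continuous h →
      ∫ x in K, h x ∂μ = ∑ k ∈ T, ∫ x in K ∩ gridCell e δ k, h x ∂μ := by
    intro h hh
    conv_lhs => rw [hT]
    exact integral_biUnion_finset T (fun k _ => hmeas k) hdisj
      fun k _ => (hh.integrableOn_isBounded μ hKb).mono_set inter_subset_left
  have hcell : ∀ k ∈ T, ∫ x in K ∩ gridCell e δ k, (f m x - f n x) ^ 2 ∂μ ≤
      (μ.real (K ∩ gridCell e δ k))⁻¹ * η ^ 2 + 2 ^ finrank ℝ E * (Fintype.card α * δ) ^ 2 *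
        ∫ x in K ∩ gridCell e δ k, ‖fderiv ℝ (fun x => f m x - f n x) x‖ ^ 2 ∂μ := by
    intro k hk
    refine (poincare_of_convex μ (hK.inter (convex_gridCell e hδ k)) (hmeas k)
      (hKb.subset inter_subset_left)
      (fun x hx y hy => norm_sub_le_of_mem_gridCell he hδ hx.2 hy.2) hg).trans ?_
    have h1 := hAs k m (mem_iInter₂.1 hm k hk) n (mem_iInter₂.1 hn k hk)
    rw [integral_sub (((hc m).integrableOn_isBounded μ hKb).mono_set inter_subset_left)
      (((hc n).integrableOn_isBounded μ hKb).mono_set inter_subset_left)]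
    gcongr ?_ * ?_ + _
    rw [← sq_abs]
    gcongr
  have hD : ∫ x in K, ‖fderiv ℝ (fun x => f m x - f n x) x‖ ^ 2 ∂μ ≤ 4 * M := by
    have hle : ∀ x, ‖fderiv ℝ (fun x => f m x - f n x) x‖ ^ 2 ≤
        2 * (f m x ^ 2 + ‖fderiv ℝ (f m) x‖ ^ 2) + 2 * (f n x ^ 2 + ‖fderiv ℝ (f n) x‖ ^ 2) := by
      intro x
      rw [fderiv_fun_sub ((hf m).differentiable one_ne_zero x)
        ((hf n).differentiable one_ne_zero x)]
      have := norm_sub_le (fderiv ℝ (f m) x) (fderiv ℝ (f n) x)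
      have h2 := pow_le_pow_left₀ (norm_nonneg _) this 2
      nlinarith [sq_nonneg (‖fderiv ℝ (f m) x‖ - ‖fderiv ℝ (f n) x‖), sq_nonneg (f m x),
        sq_nonneg (f n x)]
    have h3 := integral_mono (μ := μ.restrict K)
      (((hg.continuous_fderiv one_ne_zero).norm.pow 2).integrableOn_isBounded μ hKb)
      (((hi m).const_mul 2).add ((hi n).const_mul 2)) hle
    refine h3.trans ?_
    simp only [Pi.add_apply]
    rw [integral_add ((hi m).const_mul 2) ((hi n).const_mul 2), integral_const_mul,
      integral_const_mul]
    linarith [hM m, hM n]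
  rw [hsplit (fun x => (f m x - f n x) ^ 2) (hg.continuous.pow 2)]
  refine (Finset.sum_le_sum hcell).trans_lt ?_
  rw [Finset.sum_add_distrib, ← Finset.sum_mul, ← Finset.mul_sum,
    ← hsplit (fun x => ‖fderiv ℝ (fun x => f m x - f n x) x‖ ^ 2)
      ((hg.continuous_fderiv one_ne_zero).norm.pow 2)]
  have h5 : 2 ^ finrank ℝ E * (Fintype.card α * δ) ^ 2 *
      ∫ x in K, ‖fderiv ℝ (fun x => f m x - f n x) x‖ ^ 2 ∂μ ≤
      2 ^ finrank ℝ E * (Fintype.card α * δ) ^ 2 * (4 * M) := by gcongr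
  have h6 : (2 : ℝ) ^ finrank ℝ E * (Fintype.card α * δ) ^ 2 * (4 * M) =
      2 ^ finrank ℝ E * (Fintype.card α : ℝ) ^ 2 * (4 * M) * δ ^ 2 := by ring
  linarith

end Rellich


open Filter in
theorem exists_tendsto_integral_norm_sub_sq {α E : Type*} [MeasurableSpace α] {μ : Measure α}
    [NormedAddCommGroup E] [InnerProductSpace ℝ E] [CompleteSpace E] {F : ℕ → α → E}
    (hF : ∀ n, MemLp (F n) 2 μ)
    (hC : ∀ ε > 0, ∃ K, ∀ m ≥ K, ∀ n ≥ K, ∫ z, ‖F m z - F n z‖ ^ 2 ∂μ < ε) :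
    ∃ f, MemLp f 2 μ ∧ Tendsto (fun n => ∫ z, ‖F n z - f z‖ ^ 2 ∂μ) atTop (nhds 0) := by
  have hnorm : ∀ {f : α → E} (hf : MemLp f 2 μ), ‖hf.toLp f‖ ^ 2 = ∫ z, ‖f z‖ ^ 2 ∂μ := by
    intro f hf
    rw [← real_inner_self_eq_norm_sq, L2.inner_def]
    refine integral_congr_ae ?_
    filter_upwards [hf.coeFn_toLp] with z hz
    rw [hz, real_inner_self_eq_norm_sq]
  have hdist : ∀ {f g : α → E} (hf : MemLp f 2 μ) (hg : MemLp g 2 μ),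
      dist (hf.toLp f) (hg.toLp g) ^ 2 = ∫ z, ‖f z - g z‖ ^ 2 ∂μ := by
    intro f g hf hg
    rw [dist_eq_norm, ← MemLp.toLp_sub, hnorm]
    rfl
  have hcs : CauchySeq fun n => (hF n).toLp (F n) := by
    rw [Metric.cauchySeq_iff]
    intro ε hε
    obtain ⟨K, hK⟩ := hC (ε ^ 2) (by positivity)
    refine ⟨K, fun m hm n hn => ?_⟩
    have := hK m hm n hn
    rw [← hdist (hF m) (hF n)] at this
    exact lt_of_pow_lt_pow_left₀ 2 hε.le this
  obtain ⟨f, hf⟩ := cauchySeq_tendsto_of_complete hcs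
  refine ⟨f, Lp.memLp f, ?_⟩
  have h1 := ((tendsto_iff_dist_tendsto_zero.1 hf).pow 2)
  rw [zero_pow two_ne_zero] at h1
  refine h1.congr fun n => ?_
  have := hdist (hF n) (Lp.memLp f)
  rwa [Lp.toLp_coeFn] at this

namespace Geometry

variable {J N ι : Type*} {G : Geometry J N ι} [Fintype ι]

open MixedPt

/-! ### Completeness and compactness of the local spaces -/

theorem SqIntegrable.integrable_U_sq {S : Set Plane} {u : MixedFun ι} (hu : G.SqIntegrable S u) :
    Integrable (fun z => u.U z ^ 2) (G.mixedMeasure S) := (G.sqIntegrable_iff.1 hu).1.integrable_sq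

theorem SqIntegrable.integrable_norm_D_sq {S : Set Plane} {u : MixedFun ι}
    (hu : G.SqIntegrable S u) : Integrable (fun z => ‖u.D z‖ ^ 2) (G.mixedMeasure S) :=
  (memLp_two_iff_integrable_sq_norm (G.sqIntegrable_iff.1 hu).2.1).1 (G.sqIntegrable_iff.1 hu).2

theorem SqIntegrable.integral_U_sq_le {S : Set Plane} {u : MixedFun ι}
    (hu : G.SqIntegrable S u) : ∫ z, u.U z ^ 2 ∂G.mixedMeasure S ≤ G.normSq S u := by
  rw [hu.normSq_eq]
  exact integral_mono hu.integrable_U_sq hu.integrable_normSq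
    fun z => le_add_of_nonneg_right (by positivity)

theorem SqIntegrable.integral_norm_D_sq_le {S : Set Plane} {u : MixedFun ι}
    (hu : G.SqIntegrable S u) : ∫ z, ‖u.D z‖ ^ 2 ∂G.mixedMeasure S ≤ G.normSq S u := by
  rw [hu.normSq_eq]
  exact integral_mono hu.integrable_norm_D_sq hu.integrable_normSq
    fun z => le_add_of_nonneg_left (by positivity)

open Filter in
theorem MemClosure.exists_tendsto {S W : Set Plane} [IsFiniteMeasure (G.mixedMeasure S)]
    {u : ℕ → MixedFun ι} (hu : ∀ n, G.MemClosure S W (u n))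
    (hC : ∀ ε > 0, ∃ K, ∀ m ≥ K, ∀ n ≥ K, G.normSq S (u m - u n) < ε) :
    ∃ v, G.MemClosure S W v ∧ Tendsto (fun n => G.normSq S (u n - v)) atTop (nhds 0) := by
  have hs : ∀ n, G.SqIntegrable S (u n) := fun n => (hu n).1
  have hss : ∀ m n, G.SqIntegrable S (u m - u n) := fun m n => (hs m).sub (hs n)
  obtain ⟨f, hf, hft⟩ := exists_tendsto_integral_norm_sub_sq (F := fun n => (u n).U)
    (fun n => (G.sqIntegrable_iff.1 (hs n)).1) (fun ε hε => by
      obtain ⟨K, hK⟩ := hC ε hε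
      refine ⟨K, fun m hm n hn => lt_of_le_of_lt ?_ (hK m hm n hn)⟩
      refine le_trans (le_of_eq ?_) (hss m n).integral_U_sq_le
      refine integral_congr_ae (ae_of_all _ fun z => ?_)
      simp only [MixedFun.U_sub, Real.norm_eq_abs, sq_abs])
  obtain ⟨g, hg, hgt⟩ := exists_tendsto_integral_norm_sub_sq (F := fun n => (u n).D)
    (fun n => (G.sqIntegrable_iff.1 (hs n)).2) (fun ε hε => by
      obtain ⟨K, hK⟩ := hC ε hε
      refine ⟨K, fun m hm n hn => lt_of_le_of_lt ?_ (hK m hm n hn)⟩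
      refine le_trans (le_of_eq ?_) (hss m n).integral_norm_D_sq_le
      refine integral_congr_ae (ae_of_all _ fun z => ?_)
      simp only [MixedFun.D_sub])
  -- On a fracture the limit `g` takes values in the plane; its component along `basisVec` is the
  -- tangential derivative. The projection does not increase distances to fields along `basisVec`,
  -- so convergence persists.
  set v : MixedFun ι := ((fun x => f (mat x), fun x => g (mat x)),
    (fun l t => f (frac l t), fun l t => inner ℝ basisVec (g (frac l t)))) with hv
  have hvU : ∀ z, v.U z = f z := by
    intro z; rcases z with x | ⟨l, t⟩ <;> rfl
  have hvD : ∀ n z, ‖(u n).D z - v.D z‖ ≤ ‖(u n).D z - g z‖ := by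
    intro n z
    rcases z with x | ⟨l, t⟩
    · exact le_rfl
    · change ‖(u n).fgrad l t • basisVec - (inner ℝ basisVec (g (frac l t)) : ℝ) • basisVec‖ ≤
        ‖(u n).fgrad l t • basisVec - g (frac l t)‖
      have h1 : (u n).fgrad l t - inner ℝ basisVec (g (frac l t)) =
          inner ℝ basisVec ((u n).fgrad l t • basisVec - g (frac l t)) := by
        rw [inner_sub_right, inner_smul_right, real_inner_self_eq_norm_sq, norm_basisVec]; simp
      rw [← sub_smul, norm_smul, norm_basisVec, mul_one, h1]
      simpa [norm_basisVec] using
        norm_inner_le_norm (𝕜 := ℝ) basisVec ((u n).fgrad l t • basisVec - g (frac l t))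
  have hvs : G.SqIntegrable S v := by
    rw [memLp_mixedMeasure_iff] at hf hg
    exact ⟨hf.1, hg.1, fun l => ⟨hf.2 l, (hg.2 l).const_inner (𝕜 := ℝ) basisVec⟩⟩
  have hsv : ∀ n, G.SqIntegrable S (u n - v) := fun n => (hs n).sub hvs
  have htend : Tendsto (fun n => G.normSq S (u n - v)) atTop (nhds 0) := by
    have h0 := hft.add hgt
    rw [add_zero] at h0
    refine squeeze_zero (fun n => (hsv n).normSq_nonneg) (fun n => ?_) h0
    rw [(hsv n).normSq_eq, integral_add (hsv n).integrable_U_sq (hsv n).integrable_norm_D_sq]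
    refine add_le_add (le_of_eq ?_) ?_
    · refine integral_congr_ae (ae_of_all _ fun z => ?_)
      simp only [MixedFun.U_sub, Real.norm_eq_abs, sq_abs, hvU]
    · refine integral_mono (hsv n).integrable_norm_D_sq ?_ fun z => ?_
      · have h2 := (G.sqIntegrable_iff.1 (hs n)).2.sub hg
        exact (memLp_two_iff_integrable_sq_norm h2.1).1 h2
      · simp only [MixedFun.D_sub]
        exact pow_le_pow_left₀ (norm_nonneg _) (hvD n z) 2
  refine ⟨v, MemClosure.of_approx hvs fun ε hε => ?_, htend⟩
  obtain ⟨n, hn⟩ := (htend.eventually_lt_const hε).exists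
  refine ⟨u n, hu n, ?_⟩
  have : v - u n = (-1 : ℝ) • (u n - v) := by rw [neg_smul, one_smul, neg_sub]
  rw [this, (hsv n).normSq_smul]
  simpa using hn

theorem γ_convex_comb (l : ι) {a b : ℝ} (hab : a + b = 1) (s t : ℝ) :
    G.γ l (a • s + b • t) = a • G.γ l s + b • G.γ l t := by
  obtain rfl : b = 1 - a := by linarith
  simp only [γ, smul_eq_mul, add_div, mul_div_assoc]
  module

variable (G) in
theorem convex_fracIn (l : ι) (j : J) : Convex ℝ (G.fracIn l (G.K j)) := by
  intro s hs t ht a b ha hb hab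
  refine ⟨convex_Ioo _ _ hs.1 ht.1 ha hb hab, ?_⟩
  rw [γ_convex_comb l hab]
  exact G.convex_K j hs.2 ht.2 ha hb hab

variable (G) in
theorem measurableSet_fracIn (l : ι) (j : J) : MeasurableSet (G.fracIn l (G.K j)) :=
  measurableSet_Ioo.inter ((G.isClosed_K j).preimage (G.continuous_γ l)).measurableSet

variable (G) in
theorem isBounded_fracIn (l : ι) (j : J) : Bornology.IsBounded (G.fracIn l (G.K j)) :=
  (Metric.isBounded_Ioo _ _).subset fun _ h => h.1

theorem contDiff_γ (l : ι) : ContDiff ℝ 1 (G.γ l) := by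
  unfold γ; fun_prop

theorem norm_le_sum_abs_proj (x : Plane) :
    ‖x‖ ≤ ∑ i, |(EuclideanSpace.proj i : Plane →L[ℝ] ℝ) x| := by
  change ‖x‖ ≤ ∑ i, |x i|
  rw [EuclideanSpace.norm_eq, Real.sqrt_le_left (by positivity)]
  simp only [Fin.sum_univ_two, Real.norm_eq_abs]
  nlinarith [abs_nonneg (x 0), abs_nonneg (x 1), mul_nonneg (abs_nonneg (x 0)) (abs_nonneg (x 1))]

open Filter in
-- Each `u n` is replaced by a test function, and the Rellich theorem is applied on the convex set
-- `K_j` and on the convex parameter set of each fracture inside it. The shares add up as `3 (ε/12 +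
-- ε/12 + ε/6) = ε`.
theorem MemClosure.exists_mem_hyperfilter {j : J} {u : ℕ → MixedFun ι}
    (hu : ∀ n, G.MemClosure (G.K j) G.Ω (u n)) {M : ℝ} (hM : ∀ n, G.normSq (G.K j) (u n) ≤ M)
    {ε : ℝ} (hε : 0 < ε) : ∃ A ∈ hyperfilter ℕ, ∀ m ∈ A, ∀ n ∈ A,
      ∫ z, (u m - u n).U z ^ 2 ∂G.mixedMeasure (G.K j) < ε := by
  set S := G.K j with hS
  choose f hf hfε using fun n => (hu n).2 (ε / 12) (by positivity)
  have hs : ∀ n, G.SqIntegrable S (u n) := fun n => (hu n).1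
  have hfs : ∀ n, G.SqIntegrable S (G.lift (f n)) := fun n => (hf n).sqIntegrable_lift
  have hfd : ∀ n, ContDiff ℝ 1 (f n) := fun n => (hf n).1.of_le (by exact_mod_cast le_top)
  have hfM : ∀ n, G.normSq S (G.lift (f n)) ≤ 2 * M + 2 * ε := by
    intro n
    have h1 := (hs n).normSq_add_le (((hs n).sub (hfs n)).smul (-1))
    rw [((hs n).sub (hfs n)).normSq_smul] at h1
    have h2 : u n + (-1 : ℝ) • (u n - G.lift (f n)) = G.lift (f n) := by
      rw [neg_smul, one_smul]; abel
    rw [h2] at h1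
    linarith [hM n, hfε n]
  have hterm : ∀ n, (∫ x in S, ((f n x) ^ 2 + ‖fderiv ℝ (f n) x‖ ^ 2)) ≤ 2 * M + 2 * ε ∧
      ∀ l, (∫ t in G.fracIn l S, ((f n (G.γ l t)) ^ 2 +
        ‖fderiv ℝ (fun r => f n (G.γ l r)) t‖ ^ 2)) ≤ 2 * M + 2 * ε := by
    intro n
    have h1 : G.normSq S (G.lift (f n)) = (∫ x in S, ((f n x) ^ 2 + ‖fderiv ℝ (f n) x‖ ^ 2)) +
      ∑ l, ∫ t in G.fracIn l S, ((f n (G.γ l t)) ^ 2 +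
        ‖fderiv ℝ (fun r => f n (G.γ l r)) t‖ ^ 2) := by
      have h2 : ∀ x, ‖gradient (f n) x‖ = ‖fderiv ℝ (f n) x‖ := fun x => by
        rw [gradient]; exact LinearIsometryEquiv.norm_map _ _
      have h3 : ∀ l t, (deriv (fun r => f n (G.γ l r)) t) ^ 2 =
          ‖fderiv ℝ (fun r => f n (G.γ l r)) t‖ ^ 2 := fun l t => by
        rw [← norm_deriv_eq_norm_fderiv, Real.norm_eq_abs, sq_abs]
      simp only [← h2, ← h3]
      rfl
    have h4 := hfM n
    rw [h1] at h4
    have h5 : 0 ≤ ∫ x in S, ((f n x) ^ 2 + ‖fderiv ℝ (f n) x‖ ^ 2) :=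
      integral_nonneg fun x => by positivity
    have h6 : ∀ l, 0 ≤ ∫ t in G.fracIn l S, ((f n (G.γ l t)) ^ 2 +
        ‖fderiv ℝ (fun r => f n (G.γ l r)) t‖ ^ 2) := fun l => integral_nonneg fun x => by positivity
    have h7 := Finset.sum_nonneg fun l (_ : l ∈ Finset.univ) => h6 l
    refine ⟨by linarith, fun l => ?_⟩
    have h8 := Finset.single_le_sum (fun l _ => h6 l) (Finset.mem_univ l)
    linarith
  set c : ℝ := 1 + Fintype.card ι with hc
  have hc0 : 0 < c := by positivity
  have hδ : 0 < ε / (6 * c) := by positivity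
  obtain ⟨A₀, hA₀, h₀⟩ := exists_mem_hyperfilter_integral_sub_sq_lt volume norm_le_sum_abs_proj
    (G.convex_K j) (G.isClosed_K j).measurableSet (G.isCompact_K j).isBounded hfd
    (fun n => (hterm n).1) hδ
  have hfr := fun l => exists_mem_hyperfilter_integral_sub_sq_lt (α := Unit) volume
    (e := fun _ => ContinuousLinearMap.id ℝ ℝ) (fun x => by simp)
    (G.convex_fracIn l j) (G.measurableSet_fracIn l j) (G.isBounded_fracIn l j)
    (fun n => (hfd n).comp (contDiff_γ l)) (fun n => (hterm n).2 l) hδ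
  choose A hA hAs using hfr
  refine ⟨A₀ ∩ ⋂ l, A l, inter_mem hA₀ (iInter_mem.2 hA), fun m hm n hn => ?_⟩
  have hd : G.SqIntegrable S (G.lift (f m) - G.lift (f n)) := (hfs m).sub (hfs n)
  have h1 : ∫ z, (G.lift (f m) - G.lift (f n)).U z ^ 2 ∂G.mixedMeasure S ≤ ε / 6 := by
    rw [G.integral_mixedMeasure hd.integrable_U_sq]
    have e1 : (∫ x in S, (G.lift (f m) - G.lift (f n)).U (mat x) ^ 2) =
        ∫ x in S, (f m x - f n x) ^ 2 := by
      simp only [MixedFun.U_sub, U_lift, pt_mat]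
    have e2 : ∀ l, (∫ t in G.fracIn l S, (G.lift (f m) - G.lift (f n)).U (frac l t) ^ 2) =
        ∫ t in G.fracIn l S, ((f m ∘ G.γ l) t - (f n ∘ G.γ l) t) ^ 2 := by
      intro l
      simp only [MixedFun.U_sub, U_lift, pt_frac, Function.comp_apply]
    rw [e1]
    simp only [e2]
    have h2 := (h₀ m hm.1 n hn.1).le
    have h3 : ∑ l, ∫ t in G.fracIn l S, ((f m ∘ G.γ l) t - (f n ∘ G.γ l) t) ^ 2 ≤
        ∑ _l : ι, ε / (6 * c) := Finset.sum_le_sum fun l _ =>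
      (hAs l m (mem_iInter.1 hm.2 l) n (mem_iInter.1 hn.2 l)).le
    rw [Finset.sum_const, Finset.card_univ, nsmul_eq_mul] at h3
    refine (add_le_add h2 h3).trans_eq ?_
    rw [← one_add_mul, ← hc]
    field_simp
  have hpt : ∀ z, (u m - u n).U z ^ 2 ≤ 3 * ((u m - G.lift (f m)).U z ^ 2 +
      (u n - G.lift (f n)).U z ^ 2 + (G.lift (f m) - G.lift (f n)).U z ^ 2) := by
    intro z
    simp only [MixedFun.U_sub]
    set a := (u m).U z - (G.lift (f m)).U z with ha
    set b := (u n).U z - (G.lift (f n)).U z with hb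
    set d := (G.lift (f m)).U z - (G.lift (f n)).U z with hd
    have : (u m).U z - (u n).U z = a - b + d := by rw [ha, hb, hd]; ring
    rw [this]
    nlinarith [sq_nonneg (a + b), sq_nonneg (a - d), sq_nonneg (b + d)]
  have hi1 := ((hs m).sub (hfs m)).integrable_U_sq
  have hi2 := ((hs n).sub (hfs n)).integrable_U_sq
  have h2 := integral_mono ((hs m).sub (hs n)).integrable_U_sq
    (((hi1.add hi2).add hd.integrable_U_sq).const_mul 3) hpt
  refine h2.trans_lt ?_
  rw [integral_const_mul]
  simp only [Pi.add_apply]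
  have hi12 : Integrable (fun z => (u m - G.lift (f m)).U z ^ 2 + (u n - G.lift (f n)).U z ^ 2)
    (G.mixedMeasure S) := hi1.add hi2
  rw [integral_add hi12 hd.integrable_U_sq, integral_add hi1 hi2]
  have h3 := ((hs m).sub (hfs m)).integral_U_sq_le
  have h4 := ((hs n).sub (hfs n)).integral_U_sq_le
  linarith [hfε m, hfε n]

end Geometry


namespace Medium

open Geometry

variable {J N ι : Type*} {G : Geometry J N ι} (M : Medium G)

/-! ### The local forms as bilinear maps -/

theorem aDens_comm (p v : DualFun ι) (z : MixedPt ι) : M.aDens p v z = M.aDens v p z := by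
  simp only [aDens, real_inner_comm, mul_comm ((v 0).U z - (v 1).U z)]

theorem aDens_add_smul_left (p p' v : DualFun ι) (c : ℝ) (z : MixedPt ι) :
    M.aDens (p + c • p') v z = M.aDens p v z + c * M.aDens p' v z := by
  simp only [aDens, Pi.add_apply, Pi.smul_apply, MixedFun.U_add, MixedFun.U_smul, MixedFun.D_add,
    MixedFun.D_smul, inner_add_left, inner_smul_left, Fin.sum_univ_two, conj_trivial]
  ring

theorem aDens_self (p : DualFun ι) (z : MixedPt ι) : M.aDens p p z =
    ∑ i, M.kap i z * ‖(p i).D z‖ ^ 2 + M.exch z * ((p 0).U z - (p 1).U z) ^ 2 := by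
  simp only [aDens, real_inner_self_eq_norm_sq]
  ring

theorem sum_kap_mul_nonneg {z : MixedPt ι} (hz : G.pt z ∈ G.Ω) {f : Fin 2 → ℝ} (hf : ∀ i, 0 ≤ f i) :
    0 ≤ ∑ i, M.kap i z * f i :=
  Finset.sum_nonneg fun i _ => mul_nonneg (M.kap_pos i hz).le (hf i)

theorem sum_kap_le_aDens (p : DualFun ι) (z : MixedPt ι) :
    ∑ i, M.kap i z * ‖(p i).D z‖ ^ 2 ≤ M.aDens p p z := by
  rw [aDens_self]
  exact le_add_of_nonneg_right (mul_nonneg (M.exch_nonneg z) (sq_nonneg _))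

theorem aDens_self_nonneg (p : DualFun ι) {z : MixedPt ι} (hz : G.pt z ∈ G.Ω) :
    0 ≤ M.aDens p p z :=
  (M.sum_kap_mul_nonneg hz fun _ => by positivity).trans (M.sum_kap_le_aDens p z)

section

variable [Fintype N]

theorem sDens_comm (p v : DualFun ι) (z : MixedPt ι) : M.sDens p v z = M.sDens v p z := by
  simp only [sDens, mul_comm ((v _).U z)]

theorem sDens_add_smul_left (p p' v : DualFun ι) (c : ℝ) (z : MixedPt ι) :
    M.sDens (p + c • p') v z = M.sDens p v z + c * M.sDens p' v z := by
  simp only [sDens, Pi.add_apply, Pi.smul_apply, MixedFun.U_add, MixedFun.U_smul, Fin.sum_univ_two]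
  ring

theorem sDens_self (p : DualFun ι) (z : MixedPt ι) : M.sDens p p z =
    ∑ i, M.kap i z * (G.hatW z * (p i).U z ^ 2) := by
  simp only [sDens, pow_two, mul_assoc]

theorem sDens_self_nonneg [Fintype J] (p : DualFun ι) {z : MixedPt ι} (hz : G.pt z ∈ G.Ω) :
    0 ≤ M.sDens p p z := by
  rw [sDens_self]
  exact M.sum_kap_mul_nonneg hz fun i => mul_nonneg (G.hatW_nonneg z) (sq_nonneg _)

end

variable [Fintype J] [Fintype N] [Fintype ι] (j : J) {p p' v : DualFun ι}

theorem aQLoc_comm (hp : G.DualSqIntegrable (G.K j) p) (hv : G.DualSqIntegrable (G.K j) v) :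
    M.aQLoc j p v = M.aQLoc j v p := by
  rw [M.aQLoc_eq j hp hv, M.aQLoc_eq j hv hp]
  simp only [M.aDens_comm p v]

theorem sLoc_comm (hp : G.DualSqIntegrable (G.K j) p) (hv : G.DualSqIntegrable (G.K j) v) :
    M.sLoc j p v = M.sLoc j v p := by
  rw [M.sLoc_eq j hp hv, M.sLoc_eq j hv hp]
  simp only [M.sDens_comm p v]

theorem _root_.Geometry.DualSqIntegrable.add_smul {S : Set Plane}
    (hp : G.DualSqIntegrable S p) (hp' : G.DualSqIntegrable S p') (c : ℝ) :
    G.DualSqIntegrable S (p + c • p') := fun i => (hp i).add ((hp' i).smul c)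

theorem aQLoc_add_smul_left (hp : G.DualSqIntegrable (G.K j) p)
    (hp' : G.DualSqIntegrable (G.K j) p') (hv : G.DualSqIntegrable (G.K j) v) (c : ℝ) :
    M.aQLoc j (p + c • p') v = M.aQLoc j p v + c * M.aQLoc j p' v := by
  rw [M.aQLoc_eq j hp hv, M.aQLoc_eq j hp' hv, M.aQLoc_eq j (hp.add_smul hp' c) hv]
  simp only [aDens_add_smul_left]
  rw [integral_add (M.integrable_aDens (G.ae_mem_Ω j) hp hv)
    ((M.integrable_aDens (G.ae_mem_Ω j) hp' hv).const_mul c), integral_const_mul]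

theorem sLoc_add_smul_left (hp : G.DualSqIntegrable (G.K j) p)
    (hp' : G.DualSqIntegrable (G.K j) p') (hv : G.DualSqIntegrable (G.K j) v) (c : ℝ) :
    M.sLoc j (p + c • p') v = M.sLoc j p v + c * M.sLoc j p' v := by
  rw [M.sLoc_eq j hp hv, M.sLoc_eq j hp' hv, M.sLoc_eq j (hp.add_smul hp' c) hv]
  simp only [sDens_add_smul_left]
  rw [integral_add (M.integrable_sDens j hp hv)
    ((M.integrable_sDens j hp' hv).const_mul c), integral_const_mul]

variable (G) in
/-- The space `V(K_j)` as a submodule. -/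
abbrev _root_.Geometry.locSpace (j : J) : Submodule ℝ (DualFun ι) := G.dualClosure (G.K j) G.Ω

theorem _root_.Geometry.locSpace_sq (p : G.locSpace j) : G.DualSqIntegrable (G.K j) p.1 :=
  fun i => (p.2 i).1

/-- A function of two variables that is linear in the first one and symmetric, as a bilinear
map. -/
def _root_.bilinOfSymm {X : Type*} [AddCommGroup X] [Module ℝ X] (B : X → X → ℝ)
    (hs : ∀ u v, B u v = B v u) (hl : ∀ u v w (c : ℝ), B (u + c • v) w = B u w + c * B v w) :
    X →ₗ[ℝ] X →ₗ[ℝ] ℝ :=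
  have h0 : ∀ w, B 0 w = 0 := fun w => by
    have := hl 0 0 w 1
    rw [smul_zero, add_zero] at this
    linarith
  have ha : ∀ u v w, B (u + v) w = B u w + B v w := fun u v w => by
    simpa using hl u v w 1
  have hc : ∀ (c : ℝ) u w, B (c • u) w = c • B u w := fun c u w => by
    simpa [h0] using hl 0 u w c
  LinearMap.mk₂ ℝ B ha hc (fun u v w => by rw [hs, ha, hs v, hs w])
    (fun c u w => by rw [hs, hc, hs w])

/-- The form `a_Q^{(j)}` on `V(K_j)`. -/
def aBil : G.locSpace j →ₗ[ℝ] G.locSpace j →ₗ[ℝ] ℝ :=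
  bilinOfSymm (fun p v => M.aQLoc j p.1 v.1)
    (fun p v => M.aQLoc_comm j (locSpace_sq j p) (locSpace_sq j v))
    fun p p' v c => M.aQLoc_add_smul_left j (locSpace_sq j p) (locSpace_sq j p') (locSpace_sq j v) c

/-- The form `s^{(j)}` on `V(K_j)`. -/
def sBil : G.locSpace j →ₗ[ℝ] G.locSpace j →ₗ[ℝ] ℝ :=
  bilinOfSymm (fun p v => M.sLoc j p.1 v.1)
    (fun p v => M.sLoc_comm j (locSpace_sq j p) (locSpace_sq j v))
    fun p p' v c => M.sLoc_add_smul_left j (locSpace_sq j p) (locSpace_sq j p') (locSpace_sq j v) c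

theorem aBil_apply (p v : G.locSpace j) : M.aBil j p v = M.aQLoc j p.1 v.1 := rfl

theorem sBil_apply (p v : G.locSpace j) : M.sBil j p v = M.sLoc j p.1 v.1 := rfl

theorem aBil_symm (p v : G.locSpace j) : M.aBil j p v = M.aBil j v p :=
  M.aQLoc_comm j (locSpace_sq j p) (locSpace_sq j v)

theorem sBil_symm (p v : G.locSpace j) : M.sBil j p v = M.sBil j v p :=
  M.sLoc_comm j (locSpace_sq j p) (locSpace_sq j v)

theorem aBil_nonneg (p : G.locSpace j) : 0 ≤ M.aBil j p p := by
  rw [aBil_apply, M.aQLoc_eq j (locSpace_sq j p) (locSpace_sq j p)]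
  exact integral_nonneg_of_ae ((G.ae_mem_Ω j).mono fun z hz => M.aDens_self_nonneg _ hz)

theorem sBil_nonneg (p : G.locSpace j) : 0 ≤ M.sBil j p p := by
  rw [sBil_apply, M.sLoc_eq j (locSpace_sq j p) (locSpace_sq j p)]
  exact integral_nonneg_of_ae ((G.ae_mem_Ω j).mono fun z hz => M.sDens_self_nonneg _ hz)

/-- Coercivity of `a + s` for the `H¹` norm: `a` dominates the gradients, and `s` dominates the
values by the lower bound of its weight. So the hypotheses of the abstract gap can be checked in
`H¹`. -/
theorem exists_normSq_le : ∃ C, 0 ≤ C ∧ ∀ j, ∀ p : G.locSpace j, ∀ i,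
    G.normSq (G.K j) (p.1 i) ≤ C * (M.aBil j + M.sBil j) p p := by
  obtain ⟨c, hc, hw⟩ := G.exists_le_hatW
  refine ⟨1 / (M.κlo * min 1 c), by have := M.κlo_pos; positivity, fun j p i => ?_⟩
  have hm : 0 < M.κlo * min 1 c := mul_pos M.κlo_pos (by positivity)
  rw [div_mul_eq_mul_div, one_mul, le_div_iff₀ hm]
  have hp := locSpace_sq j p
  have hia := M.integrable_aDens (G.ae_mem_Ω j) hp hp
  have his := M.integrable_sDens j hp hp
  change _ ≤ M.aQLoc j p.1 p.1 + M.sLoc j p.1 p.1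
  rw [M.aQLoc_eq j hp hp, M.sLoc_eq j hp hp, (hp i).normSq_eq, ← integral_add hia his, mul_comm,
    ← integral_const_mul]
  refine integral_mono_ae ((hp i).integrable_normSq.const_mul _) (hia.add his) ?_
  filter_upwards [G.ae_mem_Ω j, G.ae_mem_interior j] with z hz hzi
  have h1 := M.sum_kap_le_aDens p.1 z
  have h2 := M.sDens_self p.1 z
  have h3 : M.kap i z * ‖(p.1 i).D z‖ ^ 2 ≤ ∑ i, M.kap i z * ‖(p.1 i).D z‖ ^ 2 :=
    Finset.single_le_sum (f := fun i => M.kap i z * ‖(p.1 i).D z‖ ^ 2)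
      (fun i _ => mul_nonneg (M.kap_pos i hz).le (by positivity)) (Finset.mem_univ i)
  have h4 : M.kap i z * (G.hatW z * (p.1 i).U z ^ 2) ≤ M.sDens p.1 p.1 z := by
    rw [h2]
    exact Finset.single_le_sum (f := fun i => M.kap i z * (G.hatW z * (p.1 i).U z ^ 2))
      (fun i _ => mul_nonneg (M.kap_pos i hz).le
        (mul_nonneg (G.hatW_nonneg z) (sq_nonneg _))) (Finset.mem_univ i)
  have hk := (M.kap_bounds i hz).1
  have hk0 := M.κlo_pos
  have hk1 := (M.kap_pos i hz).le
  have h5 : M.κlo * min 1 c * ‖(p.1 i).D z‖ ^ 2 ≤ M.kap i z * ‖(p.1 i).D z‖ ^ 2 := by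
    gcongr
    exact (mul_le_of_le_one_right hk0.le (min_le_left _ _)).trans hk
  have h6 : M.κlo * min 1 c * (p.1 i).U z ^ 2 ≤ M.kap i z * (G.hatW z * (p.1 i).U z ^ 2) := by
    rw [← mul_assoc]
    gcongr
    exact (min_le_right _ _).trans (hw j z hzi)
  change M.κlo * min 1 c * ((p.1 i).U z ^ 2 + ‖(p.1 i).D z‖ ^ 2) ≤
    M.aDens p.1 p.1 z + M.sDens p.1 p.1 z
  linarith

theorem exists_sBil_le : ∃ C, 0 ≤ C ∧ ∀ j, ∀ p : G.locSpace j,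
    M.sBil j p p ≤ C * ∑ i, ∫ z, (p.1 i).U z ^ 2 ∂G.mixedMeasure (G.K j) := by
  obtain ⟨c, hc, hw⟩ := G.exists_hatW_le
  refine ⟨max M.κhi 0 * c, by positivity, fun j p => ?_⟩
  have hp := locSpace_sq j p
  rw [sBil_apply, M.sLoc_eq j hp hp, ← integral_finsetSum _ fun i _ => (hp i).integrable_U_sq,
    ← integral_const_mul]
  refine integral_mono_ae (M.integrable_sDens j hp hp)
    ((integrable_finsetSum _ fun i _ => (hp i).integrable_U_sq).const_mul _) ?_
  filter_upwards [G.ae_mem_Ω j, G.ae_mem_interior j] with z hz hzi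
  rw [sDens_self, Finset.mul_sum]
  refine Finset.sum_le_sum fun i _ => ?_
  rw [← mul_assoc]
  have := (M.kap_bounds i hz).2
  have h1 := (M.kap_pos i hz).le
  have h2 := G.hatW_nonneg z
  gcongr
  · exact this.trans (le_max_left _ _)
  · exact hw j z hzi

theorem exists_aBil_le : ∃ C, 0 ≤ C ∧ ∀ j, ∀ p : G.locSpace j,
    M.aBil j p p ≤ C * ∑ i, G.normSq (G.K j) (p.1 i) := by
  have hρσ : 0 ≤ M.ρ * M.σ := mul_nonneg M.ρ_nonneg M.σ_nonneg
  refine ⟨max M.κhi 0 + 2 * (M.ρ * M.σ), by positivity, fun j p => ?_⟩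
  have hp := locSpace_sq j p
  simp only [(hp _).normSq_eq]
  rw [aBil_apply, M.aQLoc_eq j hp hp, ← integral_finsetSum _ fun i _ => (hp i).integrable_normSq,
    ← integral_const_mul]
  refine integral_mono_ae (M.integrable_aDens (G.ae_mem_Ω j) hp hp)
    ((integrable_finsetSum _ fun i _ => (hp i).integrable_normSq).const_mul _) ?_
  filter_upwards [G.ae_mem_Ω j] with z hz
  rw [aDens_self]
  simp only [Fin.sum_univ_two]
  have hm : (0 : ℝ) ≤ max M.κhi 0 := le_max_right _ _
  have h0 : M.kap 0 z * ‖(p.1 0).D z‖ ^ 2 ≤ max M.κhi 0 * ‖(p.1 0).D z‖ ^ 2 := by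
    gcongr; exact (M.kap_bounds 0 hz).2.trans (le_max_left _ _)
  have h1 : M.kap 1 z * ‖(p.1 1).D z‖ ^ 2 ≤ max M.κhi 0 * ‖(p.1 1).D z‖ ^ 2 := by
    gcongr; exact (M.kap_bounds 1 hz).2.trans (le_max_left _ _)
  have h2 : M.exch z * ((p.1 0).U z - (p.1 1).U z) ^ 2 ≤
      M.ρ * M.σ * (2 * (p.1 0).U z ^ 2 + 2 * (p.1 1).U z ^ 2) := by
    refine mul_le_mul (M.exch_le z) ?_ (sq_nonneg _) hρσ
    nlinarith [sq_nonneg ((p.1 0).U z + (p.1 1).U z)]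
  nlinarith [mul_nonneg hm (sq_nonneg ((p.1 0).U z)), mul_nonneg hm (sq_nonneg ((p.1 1).U z)),
    mul_nonneg hρσ (sq_nonneg ‖(p.1 0).D z‖), mul_nonneg hρσ (sq_nonneg ‖(p.1 1).D z‖)]

/-! ### The spectral bound -/

open Filter in
-- The form `a + s` is equivalent to the `H¹` norm, which turns completeness of the closure and
-- Rellich compactness on `K_j` and its fractures into the two hypotheses of `spectral_gap`.
theorem IsEigenSystem.spectral_bound {lam : ℕ → ℝ} {φ : ℕ → DualFun ι}
    (h : M.IsEigenSystem j lam φ) {L : ℕ} (w : G.locSpace j)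
    (hw : ∀ k < L, M.sLoc j w.1 (φ k) = 0) : lam L * M.sBil j w w ≤ M.aBil j w w := by
  obtain ⟨C, hC0, hC⟩ := M.exists_normSq_le
  obtain ⟨Cs, hCs0, hCs⟩ := M.exists_sBil_le
  obtain ⟨Ca, hCa0, hCa⟩ := M.exists_aBil_le
  let Φ : ℕ → G.locSpace j := fun k => ⟨φ k, (h.eigenpair k).1⟩
  refine spectral_gap (φ := Φ) (lam := lam) (M.aBil j) (M.sBil j) (M.aBil_symm j) (M.sBil_symm j)
    (M.aBil_nonneg j) (M.sBil_nonneg j) ?_ ?_ (fun k v => (h.eigenpair k).2 v.1 v.2)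
    h.orthonormal h.ascending (fun μ u hu hk => h.exhaustive μ u.1 ⟨u.2, fun v hv => hu ⟨v, hv⟩⟩ hk)
    hw
  · intro u hu
    have hcau : ∀ i, ∀ ε > 0, ∃ K, ∀ m ≥ K, ∀ n ≥ K,
        G.normSq (G.K j) ((u m).1 i - (u n).1 i) < ε := by
      intro i ε hε
      obtain ⟨K, hK⟩ := hu (ε / (C + 1)) (by positivity)
      refine ⟨K, fun m hm n hn => (hC j (u m - u n) i).trans_lt ?_⟩
      have h1 := hK m hm n hn
      rw [lt_div_iff₀ (by positivity)] at h1
      have h2 := add_nonneg (M.aBil_nonneg j (u m - u n)) (M.sBil_nonneg j (u m - u n))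
      change 0 ≤ (M.aBil j + M.sBil j) (u m - u n) (u m - u n) at h2
      linarith
    choose v hv hvt using fun i => MemClosure.exists_tendsto (fun n => (u n).2 i) (hcau i)
    let w : G.locSpace j := ⟨v, hv⟩
    refine ⟨w, ?_⟩
    have ht : Tendsto (fun n => ∑ i, G.normSq (G.K j) ((u n).1 i - v i)) atTop (nhds 0) := by
      have := tendsto_finsetSum Finset.univ fun i _ => hvt i
      simpa using this
    have ht2 := ht.const_mul (Ca + Cs)
    rw [mul_zero] at ht2
    refine squeeze_zero (fun n => add_nonneg (M.aBil_nonneg j _) (M.sBil_nonneg j _))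
      (fun n => ?_) ht2
    have h1 := hCa j (u n - w)
    have h2 := hCs j (u n - w)
    have h3 : Cs * ∑ i, ∫ z, ((u n - w).1 i).U z ^ 2 ∂G.mixedMeasure (G.K j) ≤
        Cs * ∑ i, G.normSq (G.K j) ((u n - w).1 i) := by
      gcongr with i
      exact (locSpace_sq j (u n - w) i).integral_U_sq_le
    rw [add_mul]
    exact add_le_add h1 (h2.trans h3)
  · intro u hu ε hε
    have h1 : ∀ i, ∃ A ∈ hyperfilter ℕ, ∀ m ∈ A, ∀ n ∈ A,
        ∫ z, ((u m).1 i - (u n).1 i).U z ^ 2 ∂G.mixedMeasure (G.K j) < ε / (2 * (Cs + 1)) :=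
      fun i => MemClosure.exists_mem_hyperfilter (fun n => (u n).2 i)
        (fun n => (hC j (u n) i).trans (mul_le_mul_of_nonneg_left (hu n) hC0)) (by positivity)
    choose A hA hAs using h1
    refine ⟨⋂ i, A i, iInter_mem.2 hA, fun m hm n hn => (hCs j (u m - u n)).trans_lt ?_⟩
    have h2 := fun i => hAs i m (mem_iInter.1 hm i) n (mem_iInter.1 hn i)
    have h3 : ∑ i, ∫ z, ((u m - u n).1 i).U z ^ 2 ∂G.mixedMeasure (G.K j) < ε / (Cs + 1) := by
      rw [Fin.sum_univ_two]
      refine (add_lt_add (h2 0) (h2 1)).trans_eq ?_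
      field_simp
      ring
    rw [lt_div_iff₀ (by positivity)] at h3
    have h4 : 0 ≤ ∑ i, ∫ z, ((u m - u n).1 i).U z ^ 2 ∂G.mixedMeasure (G.K j) :=
      Finset.sum_nonneg fun i _ => integral_nonneg fun z => sq_nonneg _
    linarith

end Medium


/-! ### Positive forms on finite dimensional spaces -/

section Forms

variable {X : Type*} [AddCommGroup X] [Module ℝ X] {n : ℕ}

theorem form_sum_sum (B : X →ₗ[ℝ] X →ₗ[ℝ] ℝ) (φ : Fin n → X) (x y : Fin n → ℝ) :
    B (∑ k, x k • φ k) (∑ k, y k • φ k) = ∑ k, ∑ l, x k * y l * B (φ k) (φ l) := by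
  simp only [map_sum, LinearMap.sum_apply, map_smul, LinearMap.smul_apply, smul_eq_mul,
    Finset.mul_sum, mul_assoc]
  rw [Finset.sum_comm]
  exact Finset.sum_congr rfl fun k _ => Finset.sum_congr rfl fun l _ => by ring

/-- A form that is positive on a finite dimensional space is coercive. -/
theorem exists_pos_le_form (B : X →ₗ[ℝ] X →ₗ[ℝ] ℝ) (φ : Fin n → X)
    (hpos : ∀ x : Fin n → ℝ, x ≠ 0 → 0 < B (∑ k, x k • φ k) (∑ k, x k • φ k)) :
    ∃ c > 0, ∀ x : Fin n → ℝ, c * ∑ k, x k ^ 2 ≤ B (∑ k, x k • φ k) (∑ k, x k • φ k) := by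
  set q : EuclideanSpace ℝ (Fin n) → ℝ := fun x => B (∑ k, x k • φ k) (∑ k, x k • φ k) with hq
  have hqc : Continuous q := by
    have : q = fun x => ∑ k, ∑ l, x k * x l * B (φ k) (φ l) :=
      funext fun x => form_sum_sum B φ x x
    rw [this]
    fun_prop
  have hnorm : ∀ x : EuclideanSpace ℝ (Fin n), ‖x‖ ^ 2 = ∑ k, x k ^ 2 := fun x => by
    rw [EuclideanSpace.norm_sq_eq]; simp only [Real.norm_eq_abs, sq_abs]
  have hscale : ∀ (r : ℝ) (x : EuclideanSpace ℝ (Fin n)), q (r • x) = r ^ 2 * q x := by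
    intro r x
    have : ∑ k, (r • x) k • φ k = r • ∑ k, x k • φ k := by
      rw [Finset.smul_sum]
      exact Finset.sum_congr rfl fun k _ => by rw [PiLp.smul_apply, smul_assoc]
    simp only [hq, this, map_smul, LinearMap.smul_apply, smul_eq_mul]
    ring
  obtain ⟨c, hc, hcq⟩ : ∃ c > 0, ∀ x ∈ Metric.sphere (0 : EuclideanSpace ℝ (Fin n)) 1,
      c ≤ q x := by
    -- The sphere is empty if there are no vectors, and then any constant works.
    rcases (Metric.sphere (0 : EuclideanSpace ℝ (Fin n)) 1).eq_empty_or_nonempty with h | h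
    · exact ⟨1, one_pos, fun x hx => by simp [h] at hx⟩
    · obtain ⟨x₀, hx₀, hmin⟩ := (isCompact_sphere _ _).exists_isMinOn h hqc.continuousOn
      refine ⟨q x₀, hpos _ fun h0 => ?_, fun x hx => hmin hx⟩
      have : x₀ = 0 := by ext k; exact congrFun h0 k
      rw [this] at hx₀
      simp at hx₀
  refine ⟨c, hc, fun x => ?_⟩
  set y : EuclideanSpace ℝ (Fin n) := WithLp.toLp 2 x with hy
  have hgoal : c * ‖y‖ ^ 2 ≤ q y := by
    rcases eq_or_ne y 0 with h0 | h0
    · rw [h0]; simp [hq]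
    · have h1 : ‖y‖ ≠ 0 := norm_ne_zero_iff.2 h0
      have h2 : ‖y‖⁻¹ • y ∈ Metric.sphere (0 : EuclideanSpace ℝ (Fin n)) 1 := by
        simp [norm_smul, h1]
      have h3 := hcq _ h2
      rw [hscale] at h3
      have h4 := mul_le_mul_of_nonneg_right h3 (sq_nonneg ‖y‖)
      have h5 : ‖y‖⁻¹ ^ 2 * q y * ‖y‖ ^ 2 = q y := by field_simp
      linarith
  rw [hnorm] at hgoal
  exact hgoal

/-- A form that is positive on a finite dimensional space represents every functional. -/
theorem exists_form_eq (B : X →ₗ[ℝ] X →ₗ[ℝ] ℝ) (φ : Fin n → X)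
    (hpos : ∀ x : Fin n → ℝ, x ≠ 0 → 0 < B (∑ k, x k • φ k) (∑ k, x k • φ k))
    (c : Fin n → ℝ) : ∃ x : Fin n → ℝ, ∀ k, B (∑ l, x l • φ l) (φ k) = c k := by
  let T : (Fin n → ℝ) →ₗ[ℝ] (Fin n → ℝ) :=
    { toFun := fun x k => B (∑ l, x l • φ l) (φ k)
      map_add' := fun x y => by
        funext k
        simp only [Pi.add_apply, add_smul, Finset.sum_add_distrib, map_add, LinearMap.add_apply]
      map_smul' := fun r x => by
        funext k
        simp only [Pi.smul_apply, smul_assoc, ← Finset.smul_sum, map_smul, LinearMap.smul_apply,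
          RingHom.id_apply] }
  have hinj : Function.Injective T := by
    refine (injective_iff_map_eq_zero T).2 fun x hx => ?_
    by_contra hne
    refine (hpos x hne).ne' ?_
    rw [map_sum]
    refine Finset.sum_eq_zero fun k _ => ?_
    rw [map_smul, show B (∑ l, x l • φ l) (φ k) = T x k from rfl, hx]
    simp
  obtain ⟨x, hx⟩ := LinearMap.injective_iff_surjective.1 hinj c
  exact ⟨x, fun k => congrFun hx k⟩

end Forms

/-- The weight of `a²` can be taken arbitrarily close to `1`, so that constants survive
approximation arguments unchanged. -/
theorem add_sq_le_weighted (a b : ℝ) {t : ℝ} (ht : 0 < t) :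
    (a + b) ^ 2 ≤ (1 + t) * a ^ 2 + (1 + t⁻¹) * b ^ 2 := by
  have h : (t * a - b) ^ 2 * t⁻¹ = t * a ^ 2 - 2 * (a * b) + t⁻¹ * b ^ 2 := by
    field_simp
    ring
  have h2 : 0 ≤ (t * a - b) ^ 2 * t⁻¹ := by positivity
  nlinarith

namespace Geometry

variable {J N ι : Type*} {G : Geometry J N ι} [Fintype ι]

open MixedPt Filter

/-! ### The Poincaré inequality for functions that vanish on the boundary of an element -/

theorem integral_val_sq_le {S : Set Plane} {u : MixedFun ι} (hu : G.SqIntegrable S u) :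
    ∫ x in S, u.val x ^ 2 ≤ G.normSq S u := by
  have h := hu.integral_U_sq_le
  rw [G.integral_mixedMeasure hu.integrable_U_sq] at h
  exact (le_add_of_nonneg_right (Finset.sum_nonneg fun l _ =>
    integral_nonneg fun t => sq_nonneg _)).trans h

theorem integral_grad_sq_le {S : Set Plane} {u : MixedFun ι} (hu : G.SqIntegrable S u) :
    ∫ x in S, ‖u.grad x‖ ^ 2 ≤ G.normSq S u := by
  have h := hu.integral_norm_D_sq_le
  rw [G.integral_mixedMeasure hu.integrable_norm_D_sq] at h
  exact (le_add_of_nonneg_right (Finset.sum_nonneg fun l _ =>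
    integral_nonneg fun t => sq_nonneg _)).trans h

theorem integral_val_sq_weighted {S : Set Plane} {u v : MixedFun ι} (hu : G.SqIntegrable S u)
    (hv : G.SqIntegrable S v) {t : ℝ} (ht : 0 < t) :
    ∫ x in S, u.val x ^ 2 ≤ (1 + t) * (∫ x in S, v.val x ^ 2) + (1 + t⁻¹) * G.normSq S (u - v) := by
  have h1 := integral_val_sq_le (hu.sub hv)
  have h2 : ∫ x in S, u.val x ^ 2 ≤ ∫ x in S, ((1 + t) * v.val x ^ 2 +
      (1 + t⁻¹) * (u - v).val x ^ 2) := by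
    refine integral_mono hu.1.integrable_sq
      ((hv.1.integrable_sq.const_mul _).add ((hu.sub hv).1.integrable_sq.const_mul _)) fun x => ?_
    have := add_sq_le_weighted (v.val x) ((u - v).val x) ht
    change u.val x ^ 2 ≤ _
    have e : u.val x = v.val x + (u - v).val x := by
      change u.val x = v.val x + (u.val x - v.val x); ring
    rwa [← e] at this
  rw [integral_add (hv.1.integrable_sq.const_mul _) ((hu.sub hv).1.integrable_sq.const_mul _),
    integral_const_mul, integral_const_mul] at h2
  have : 0 ≤ 1 + t⁻¹ := by positivity
  nlinarith

theorem integral_grad_sq_weighted {S : Set Plane} {u v : MixedFun ι} (hu : G.SqIntegrable S u)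
    (hv : G.SqIntegrable S v) {t : ℝ} (ht : 0 < t) :
    ∫ x in S, ‖v.grad x‖ ^ 2 ≤
      (1 + t) * (∫ x in S, ‖u.grad x‖ ^ 2) + (1 + t⁻¹) * G.normSq S (u - v) := by
  have h1 := integral_grad_sq_le (hu.sub hv)
  have hi : ∀ {w : MixedFun ι}, G.SqIntegrable S w →
      Integrable (fun x => ‖w.grad x‖ ^ 2) (volume.restrict S) := fun hw =>
    (memLp_two_iff_integrable_sq_norm hw.2.1.1).1 hw.2.1
  have h2 : ∫ x in S, ‖v.grad x‖ ^ 2 ≤ ∫ x in S, ((1 + t) * ‖u.grad x‖ ^ 2 +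
      (1 + t⁻¹) * ‖(u - v).grad x‖ ^ 2) := by
    refine integral_mono (hi hv)
      (((hi hu).const_mul _).add ((hi (hu.sub hv)).const_mul _)) fun x => ?_
    have h3 := add_sq_le_weighted ‖u.grad x‖ ‖(u - v).grad x‖ ht
    have h4 : ‖v.grad x‖ ≤ ‖u.grad x‖ + ‖(u - v).grad x‖ := by
      have e : v.grad x = u.grad x - (u - v).grad x := by
        change v.grad x = u.grad x - (u.grad x - v.grad x); abel
      rw [e]; exact norm_sub_le _ _
    exact (pow_le_pow_left₀ (norm_nonneg _) h4 2).trans h3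
  rw [integral_add ((hi hu).const_mul _) ((hi (hu.sub hv)).const_mul _),
    integral_const_mul, integral_const_mul] at h2
  have : 0 ≤ 1 + t⁻¹ := by positivity
  nlinarith

/-- The inequality for test functions passes to the closure with the loss `(1 + t)²`, and then `t →
0`. -/
theorem IsPoincareConst.integral_val_sq_le {C : ℝ} (hC : G.IsPoincareConst C) {j : J}
    {u : MixedFun ι} (hu : G.MemClosure (G.K j) (interior (G.K j)) u) :
    ∫ x in G.K j, u.val x ^ 2 ≤ C ^ 2 * ∫ x in G.K j, ‖u.grad x‖ ^ 2 := by
  set P := ∫ x in G.K j, u.val x ^ 2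
  set Q := ∫ x in G.K j, ‖u.grad x‖ ^ 2
  have key : ∀ t > 0, P ≤ (1 + t) * (C ^ 2 * ((1 + t) * Q)) := by
    intro t ht
    refine le_of_forall_pos_lt_add fun ε hε => ?_
    have hb : 0 < (1 + t) * C ^ 2 * (1 + t⁻¹) + (1 + t⁻¹) := by positivity
    obtain ⟨f, hf, hfε⟩ := hu.2 (ε / ((1 + t) * C ^ 2 * (1 + t⁻¹) + (1 + t⁻¹))) (by positivity)
    have hfs : G.SqIntegrable (G.K j) (G.lift f) := hf.sqIntegrable_lift
    have h1 := integral_val_sq_weighted hu.1 hfs ht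
    have h2 := integral_grad_sq_weighted hu.1 hfs ht
    have h3 : ∫ x in G.K j, (G.lift f).val x ^ 2 ≤
        C ^ 2 * ∫ x in G.K j, ‖(G.lift f).grad x‖ ^ 2 := hC.2 j f hf
    rw [lt_div_iff₀ hb] at hfε
    have h4 := mul_le_mul_of_nonneg_left h2 (sq_nonneg C)
    have h5 := mul_le_mul_of_nonneg_left (h3.trans h4) (by positivity : 0 ≤ 1 + t)
    linarith
  have hlim : Tendsto (fun t : ℝ => (1 + t) * (C ^ 2 * ((1 + t) * Q)))
      (nhdsWithin 0 (Ioi 0)) (nhds (C ^ 2 * Q)) := by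
    have : ContinuousAt (fun t : ℝ => (1 + t) * (C ^ 2 * ((1 + t) * Q))) 0 := by fun_prop
    have h := this.tendsto.mono_left (nhdsWithin_le_nhds (s := Ioi (0 : ℝ)))
    simpa using h
  exact ge_of_tendsto hlim (eventually_mem_nhdsWithin.mono key)

/-! ### Multiplication with the bubble function -/

theorem mul_add_smul (b : Plane → ℝ) (u v : MixedFun ι) (c : ℝ) :
    G.mul b (u + c • v) = G.mul b u + c • G.mul b v := by
  refine Prod.ext (Prod.ext ?_ ?_) (Prod.ext ?_ ?_)
  · funext x
    change b x * (u.val x + c * v.val x) = b x * u.val x + c * (b x * v.val x)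
    ring
  · funext x
    change b x • (u.grad x + c • v.grad x) + (u.val x + c * v.val x) • gradient b x =
      b x • u.grad x + u.val x • gradient b x + c • (b x • v.grad x + v.val x • gradient b x)
    module
  · funext l t
    change b (G.γ l t) * (u.fval l t + c * v.fval l t) =
      b (G.γ l t) * u.fval l t + c * (b (G.γ l t) * v.fval l t)
    ring
  · funext l t
    change b (G.γ l t) * (u.fgrad l t + c * v.fgrad l t) + (u.fval l t + c * v.fval l t) *
      deriv (fun r => b (G.γ l r)) t = b (G.γ l t) * u.fgrad l t + u.fval l t *
      deriv (fun r => b (G.γ l r)) t + c * (b (G.γ l t) * v.fgrad l t + v.fval l t *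
      deriv (fun r => b (G.γ l r)) t)
    ring

variable [Fintype J] [Fintype N]

variable (G) in
/-- The product of a pair with the bubble function of `K_j`. -/
def bubbleMul (j : J) (p : DualFun ι) : DualFun ι := fun i => G.mul (G.bubble j) (p i)

theorem memClosure_bubbleMul {j : J} (p : G.locSpace j) (i : Fin 2) :
    G.MemClosure (G.K j) (interior (G.K j)) (G.bubbleMul j p.1 i) :=
  (G.isCutoff_bubble j).memClosure_mul isOpen_interior
    ((G.ae_mem_interior j).mono fun _ h => ⟨j, h⟩) (p.2 i)

/-- The product with the bubble function as an element of `V(K_j)`. -/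
def bubbleLoc (j : J) (p : G.locSpace j) : G.locSpace j :=
  ⟨G.bubbleMul j p.1, fun i => (memClosure_bubbleMul p i).mono (G.interior_subset j)⟩

theorem bubbleLoc_add_smul (j : J) (p v : G.locSpace j) (c : ℝ) :
    bubbleLoc j (p + c • v) = bubbleLoc j p + c • bubbleLoc j v :=
  Subtype.ext (funext fun i => mul_add_smul _ (p.1 i) (v.1 i) c)

end Geometry

/-! ### The form `s` weighted with the bubble function -/

namespace Medium

open Geometry

variable {J N ι : Type*} {G : Geometry J N ι} (M : Medium G) [Fintype J] [Fintype N] [Fintype ι]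
  (j : J)

theorem sDens_bubbleMul (p v : DualFun ι) (z : MixedPt ι) :
    M.sDens (G.bubbleMul j p) v z = G.bubble j (G.pt z) * M.sDens p v z := by
  simp only [sDens, bubbleMul, U_mul, Finset.mul_sum]
  exact Finset.sum_congr rfl fun i _ => by ring

/-- The form `s^{(j)}(B_j p, v)`. -/
def bubbleBil : G.locSpace j →ₗ[ℝ] G.locSpace j →ₗ[ℝ] ℝ :=
  bilinOfSymm (fun p v => M.sBil j (bubbleLoc j p) v)
    (fun p v => by
      rw [sBil_apply, sBil_apply, M.sLoc_eq j (locSpace_sq j _) (locSpace_sq j _),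
        M.sLoc_eq j (locSpace_sq j _) (locSpace_sq j _)]
      simp only [bubbleLoc, sDens_bubbleMul, M.sDens_comm p.1 v.1])
    fun p p' v c => by
      rw [bubbleLoc_add_smul, map_add, map_smul]; rfl

theorem bubbleBil_eq_integral (p v : G.locSpace j) : M.bubbleBil j p v =
    ∫ z, G.bubble j (G.pt z) * M.sDens p.1 v.1 z ∂G.mixedMeasure (G.K j) := by
  change M.sLoc j (bubbleLoc j p).1 v.1 = _
  rw [M.sLoc_eq j (locSpace_sq j (bubbleLoc j p)) (locSpace_sq j _)]
  simp only [bubbleLoc, sDens_bubbleMul]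

theorem integrable_bubble_mul_sDens (p v : G.locSpace j) :
    Integrable (fun z => G.bubble j (G.pt z) * M.sDens p.1 v.1 z) (G.mixedMeasure (G.K j)) := by
  have := M.integrable_sDens j (locSpace_sq j (bubbleLoc j p)) (locSpace_sq j v)
  refine this.congr (ae_of_all _ fun z => ?_)
  exact M.sDens_bubbleMul j p.1 v.1 z

theorem bubbleBil_le (p : G.locSpace j) : M.bubbleBil j p p ≤ M.sBil j p p := by
  rw [bubbleBil_eq_integral, sBil_apply, M.sLoc_eq j (locSpace_sq j _) (locSpace_sq j _)]
  refine integral_mono_ae (M.integrable_bubble_mul_sDens j p p)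
    (M.integrable_sDens j (locSpace_sq j _) (locSpace_sq j _)) ?_
  filter_upwards [G.ae_mem_Ω j] with z hz
  exact mul_le_of_le_one_left (M.sDens_self_nonneg _ hz) (G.bubble_le_one _ _)

/-- The bubble function is positive in the interior of `K_j`, which has full measure in the matrix
and on the fractures; a vanishing weighted integral would make the density of `s(p, p)` vanish
almost everywhere. -/
theorem bubbleBil_pos {p : G.locSpace j} (hp : M.sBil j p p ≠ 0) : 0 < M.bubbleBil j p p := by
  have hi := M.integrable_bubble_mul_sDens j p p
  have hnn : 0 ≤ᵐ[G.mixedMeasure (G.K j)]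
      fun z => G.bubble j (G.pt z) * M.sDens p.1 p.1 z := by
    filter_upwards [G.ae_mem_Ω j] with z hz
    exact mul_nonneg (G.bubble_nonneg _ _) (M.sDens_self_nonneg _ hz)
  rw [bubbleBil_eq_integral]
  refine (integral_nonneg_of_ae hnn).lt_of_ne fun h => hp ?_
  rw [sBil_apply, M.sLoc_eq j (locSpace_sq j _) (locSpace_sq j _)]
  refine integral_eq_zero_of_ae ?_
  filter_upwards [(integral_eq_zero_iff_of_nonneg_ae hnn hi).1 h.symm, G.ae_mem_interior j]
    with z hz hzi
  exact (mul_eq_zero.1 hz).resolve_left (G.bubble_pos_of_mem_interior hzi).ne'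

end Medium


namespace Medium

open Geometry

variable {J N ι : Type*} {G : Geometry J N ι} (M : Medium G) [Fintype J] [Fintype N] [Fintype ι]
  (j : J)

/-! ### Auxiliary spaces and the constant `C_π` -/

theorem mem_auxSpace_iff {φ : ℕ → DualFun ι} {n : ℕ} {ν : DualFun ι} :
    ν ∈ auxSpace φ n ↔ ∃ x : Fin n → ℝ, ν = ∑ k, x k • φ k := by
  have h : φ '' Iio n = range fun k : Fin n => φ k := by
    ext v
    constructor
    · rintro ⟨k, hk, rfl⟩; exact ⟨⟨k, hk⟩, rfl⟩
    · rintro ⟨k, rfl⟩; exact ⟨k, k.2, rfl⟩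
  rw [auxSpace, h, Submodule.mem_span_range_iff_exists_fun]
  simp only [eq_comm]

variable {M j} {lam : ℕ → ℝ} {φ : ℕ → DualFun ι}

/-- The eigenfunctions as elements of `V(K_j)`. -/
def IsEigenSystem.fn (h : M.IsEigenSystem j lam φ) (k : ℕ) : G.locSpace j :=
  ⟨φ k, (h.eigenpair k).1⟩

/-- Elements of the auxiliary space. -/
def IsEigenSystem.comb (h : M.IsEigenSystem j lam φ) {n : ℕ} (x : Fin n → ℝ) : G.locSpace j :=
  ∑ k, x k • h.fn k

theorem IsEigenSystem.coe_comb (h : M.IsEigenSystem j lam φ) {n : ℕ} (x : Fin n → ℝ) :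
    (h.comb x).1 = ∑ k, x k • φ k := by
  rw [comb, AddSubmonoidClass.coe_finsetSum]; rfl

theorem IsEigenSystem.sBil_fn (h : M.IsEigenSystem j lam φ) (k l : ℕ) :
    M.sBil j (h.fn k) (h.fn l) = if k = l then 1 else 0 := h.orthonormal k l

theorem IsEigenSystem.aBil_fn (h : M.IsEigenSystem j lam φ) (k : ℕ) (v : G.locSpace j) :
    M.aBil j (h.fn k) v = lam k * M.sBil j (h.fn k) v := (h.eigenpair k).2 v.1 v.2

theorem IsEigenSystem.sBil_comb_fn (h : M.IsEigenSystem j lam φ) {n : ℕ} (x : Fin n → ℝ)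
    (k : Fin n) : M.sBil j (h.comb x) (h.fn k) = x k := by
  simp only [comb, map_sum, LinearMap.sum_apply, map_smul, LinearMap.smul_apply, smul_eq_mul,
    h.sBil_fn, Fin.val_inj]
  simp

theorem IsEigenSystem.sBil_comb (h : M.IsEigenSystem j lam φ) {n : ℕ} (x : Fin n → ℝ) :
    M.sBil j (h.comb x) (h.comb x) = ∑ k, x k ^ 2 := by
  conv_lhs => rw [show h.comb x = ∑ k, x k • h.fn k from rfl, map_sum]
  exact Finset.sum_congr rfl fun k _ => by
    rw [map_smul]
    have := h.sBil_comb_fn x k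
    rw [comb] at this
    rw [this, smul_eq_mul, sq]

theorem IsEigenSystem.aBil_comb (h : M.IsEigenSystem j lam φ) {n : ℕ} (x : Fin n → ℝ) :
    M.aBil j (h.comb x) (h.comb x) = ∑ k : Fin n, lam k * x k ^ 2 := by
  conv_lhs => rw [show h.comb x = ∑ k, x k • h.fn k from rfl, map_sum]
  refine Finset.sum_congr rfl fun k _ => ?_
  have := h.sBil_comb_fn x k
  rw [comb] at this
  rw [map_smul, M.aBil_symm, h.aBil_fn, M.sBil_symm, this, smul_eq_mul]
  ring

theorem IsEigenSystem.bubbleBil_comb_pos (h : M.IsEigenSystem j lam φ) {n : ℕ} (x : Fin n → ℝ)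
    (hx : x ≠ 0) : 0 < M.bubbleBil j (h.comb x) (h.comb x) := by
  refine M.bubbleBil_pos j fun h0 => hx ?_
  rw [h.sBil_comb, Finset.sum_eq_zero_iff_of_nonneg fun _ _ => sq_nonneg _] at h0
  funext k
  exact pow_eq_zero_iff two_ne_zero |>.1 (h0 k (Finset.mem_univ k))

variable {lam : J → ℕ → ℝ} {φ : J → ℕ → DualFun ι} (L : J → ℕ)

/-- The real `sSup` of an unbounded set is `0`, so `C_π` is an upper bound only after boundedness is
known. On each of the finitely many auxiliary spaces the weighted form is coercive, since these
spaces have finite dimension. -/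
theorem bddAbove_Cpi (h : ∀ j, M.IsEigenSystem j (lam j) (φ j)) :
    BddAbove {r | ∃ j, ∃ ν ∈ auxSpace (φ j) (L j), M.sLoc j ν ν ≠ 0 ∧
      r = M.sLoc j ν ν / M.sLoc j (fun i => G.mul (G.bubble j) (ν i)) ν} := by
  choose c hc hcle using fun j => exists_pos_le_form (n := L j) (M.bubbleBil j)
    (fun k => (h j).fn k) (fun x hx => (h j).bubbleBil_comb_pos x hx)
  refine ⟨∑ j, (c j)⁻¹, ?_⟩
  rintro r ⟨j, ν, hν, hs, rfl⟩
  obtain ⟨x, hx⟩ := mem_auxSpace_iff.1 hν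
  have hν' : ν = ((h j).comb x).1 := by rw [hx, (h j).coe_comb]
  have h1 := hcle j x
  change _ ≤ M.bubbleBil j ((h j).comb x) ((h j).comb x) at h1
  have h2 := (h j).sBil_comb x
  rw [← h2] at h1
  have h3 : (c j)⁻¹ ≤ ∑ j, (c j)⁻¹ :=
    Finset.single_le_sum (fun i _ => (inv_pos.2 (hc i)).le) (Finset.mem_univ j)
  refine le_trans ?_ h3
  rw [hν'] at hs ⊢
  have h4 := M.bubbleBil_pos j (p := (h j).comb x) hs
  change M.sBil j ((h j).comb x) ((h j).comb x) /
    M.bubbleBil j ((h j).comb x) ((h j).comb x) ≤ _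
  rw [div_le_iff₀ h4, inv_mul_eq_div, le_div_iff₀ (hc j)]
  linarith

theorem sBil_le_Cpi (h : ∀ j, M.IsEigenSystem j (lam j) (φ j)) (x : Fin (L j) → ℝ) :
    M.sBil j ((h j).comb x) ((h j).comb x) ≤
      M.Cpi L φ * M.bubbleBil j ((h j).comb x) ((h j).comb x) := by
  by_cases hs : M.sBil j ((h j).comb x) ((h j).comb x) = 0
  · have h1 := M.bubbleBil_le j ((h j).comb x)
    have h2 : x = 0 := by
      by_contra hx
      have := (h j).bubbleBil_comb_pos x hx
      linarith
    subst h2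
    simp [IsEigenSystem.comb]
  · have h4 := M.bubbleBil_pos j (p := (h j).comb x) hs
    rw [← div_le_iff₀ h4]
    exact le_csSup (bddAbove_Cpi L h)
      ⟨j, ((h j).comb x).1, mem_auxSpace_iff.2 ⟨x, (h j).coe_comb x⟩, hs, rfl⟩

theorem one_le_Cpi (h : ∀ j, M.IsEigenSystem j (lam j) (φ j)) {k : ℕ} (hk : k < L j) :
    1 ≤ M.Cpi L φ := by
  set x : Fin (L j) → ℝ := fun _ => 1
  have hx : x ≠ 0 := fun h0 => one_ne_zero (congrFun h0 ⟨k, hk⟩)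
  have h1 := sBil_le_Cpi L h (j := j) x
  have h2 := M.bubbleBil_le j ((h j).comb x)
  have h3 := (h j).bubbleBil_comb_pos x hx
  by_contra! hlt
  nlinarith

theorem le_lamMax {k : ℕ} (hk : k < L j) : lam j k ≤ lamMax L lam :=
  (le_ciSup (f := fun k : Fin (L j) => lam j k) (Finite.bddAbove_range _) ⟨k, hk⟩).trans
    (le_ciSup (f := fun j => ⨆ k : Fin (L j), lam j k) (Finite.bddAbove_range _) j)

theorem Lam_le (j : J) : Lam L lam ≤ lam j (L j) :=
  ciInf_le (f := fun j => lam j (L j)) (Finite.bddBelow_range _) j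

/-! ### Functions in the elements with prescribed moments -/

/-- The exchange term contains values and no gradients. Both components vanish on the boundary of
the element, so the Poincaré inequality bounds them by gradients; the factor `2` comes from the
square of the difference. -/
theorem exch_integral_le {C : ℝ} (hC : G.IsPoincareConst C) {p : DualFun ι}
    (hp : ∀ i, G.MemClosure (G.K j) (interior (G.K j)) (p i)) :
    ∫ z, M.exch z * ((p 0).U z - (p 1).U z) ^ 2 ∂G.mixedMeasure (G.K j) ≤
      2 * C ^ 2 * M.ρ * M.σ * M.κlo⁻¹ *
        ∫ z, ∑ i, M.kap i z * ‖(p i).D z‖ ^ 2 ∂G.mixedMeasure (G.K j) := by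
  have hs := fun i => (hp i).1
  have hρσ : 0 ≤ M.ρ * M.σ := mul_nonneg M.ρ_nonneg M.σ_nonneg
  have hi : Integrable (fun z => M.exch z * ((p 0).U z - (p 1).U z) ^ 2)
      (G.mixedMeasure (G.K j)) := by
    have h1 := (G.sqIntegrable_iff.1 ((hs 0).sub (hs 1))).1
    have h2 := M.integrable_exch_mul h1 h1
    refine h2.congr (ae_of_all _ fun z => ?_)
    simp only [MixedFun.U_sub, sq]
  have hik : ∀ i, Integrable (fun z => M.kap i z * ‖(p i).D z‖ ^ 2) (G.mixedMeasure (G.K j)) := by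
    intro i
    have := M.integrable_kap_inner (G.ae_mem_Ω j) i (hs i) (hs i)
    simpa only [real_inner_self_eq_norm_sq] using this
  have hgrad : ∀ i, M.κlo * ∫ x in G.K j, ‖(p i).grad x‖ ^ 2 ≤
      ∫ z, M.kap i z * ‖(p i).D z‖ ^ 2 ∂G.mixedMeasure (G.K j) := by
    intro i
    have h1 : M.κlo * ∫ z, ‖(p i).D z‖ ^ 2 ∂G.mixedMeasure (G.K j) ≤
        ∫ z, M.kap i z * ‖(p i).D z‖ ^ 2 ∂G.mixedMeasure (G.K j) := by
      rw [← integral_const_mul]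
      refine integral_mono_ae ((hs i).integrable_norm_D_sq.const_mul _) (hik i) ?_
      filter_upwards [G.ae_mem_Ω j] with z hz
      exact mul_le_mul_of_nonneg_right (M.kap_bounds i hz).1 (sq_nonneg _)
    refine le_trans ?_ h1
    refine mul_le_mul_of_nonneg_left ?_ M.κlo_pos.le
    rw [G.integral_mixedMeasure (hs i).integrable_norm_D_sq]
    exact le_add_of_nonneg_right (Finset.sum_nonneg fun l _ =>
      integral_nonneg fun t => sq_nonneg _)
  rw [integral_finsetSum _ fun i _ => hik i, G.integral_mixedMeasure hi]
  have hfr : ∀ l, ∫ t in G.fracIn l (G.K j), M.exch (MixedPt.frac l t) *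
      ((p 0).U (MixedPt.frac l t) - (p 1).U (MixedPt.frac l t)) ^ 2 = 0 := by
    intro l
    refine integral_eq_zero_of_ae (ae_of_all _ fun t => ?_)
    change 0 * _ = 0
    rw [zero_mul]
  have hmat : ∫ x in G.K j, M.exch (MixedPt.mat x) *
      ((p 0).U (MixedPt.mat x) - (p 1).U (MixedPt.mat x)) ^ 2 =
      M.ρ * M.σ * ∫ x in G.K j, ((p 0).val x - (p 1).val x) ^ 2 := by
    rw [← integral_const_mul]; rfl
  rw [Finset.sum_eq_zero fun l _ => hfr l, add_zero, hmat]
  have hsq : ∫ x in G.K j, ((p 0).val x - (p 1).val x) ^ 2 ≤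
      2 * (∫ x in G.K j, (p 0).val x ^ 2) + 2 * ∫ x in G.K j, (p 1).val x ^ 2 := by
    rw [← integral_const_mul, ← integral_const_mul,
      ← integral_add ((hs 0).1.integrable_sq.const_mul _) ((hs 1).1.integrable_sq.const_mul _)]
    refine integral_mono ((hs 0).1.sub (hs 1).1).integrable_sq
      (((hs 0).1.integrable_sq.const_mul _).add ((hs 1).1.integrable_sq.const_mul _)) fun x => ?_
    change ((p 0).val x - (p 1).val x) ^ 2 ≤ 2 * (p 0).val x ^ 2 + 2 * (p 1).val x ^ 2
    nlinarith [sq_nonneg ((p 0).val x + (p 1).val x)]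
  have h0 := hC.integral_val_sq_le (hp 0)
  have h1 := hC.integral_val_sq_le (hp 1)
  have hκ := M.κlo_pos
  have g0 := hgrad 0
  have g1 := hgrad 1
  rw [Fin.sum_univ_two]
  calc M.ρ * M.σ * ∫ x in G.K j, ((p 0).val x - (p 1).val x) ^ 2
      ≤ M.ρ * M.σ * (2 * C ^ 2 * M.κlo⁻¹ * (M.κlo * (∫ x in G.K j, ‖(p 0).grad x‖ ^ 2) +
          M.κlo * ∫ x in G.K j, ‖(p 1).grad x‖ ^ 2)) := by
        refine mul_le_mul_of_nonneg_left ?_ hρσ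
        have : 2 * C ^ 2 * M.κlo⁻¹ * (M.κlo * (∫ x in G.K j, ‖(p 0).grad x‖ ^ 2) +
          M.κlo * ∫ x in G.K j, ‖(p 1).grad x‖ ^ 2) =
          2 * (C ^ 2 * ∫ x in G.K j, ‖(p 0).grad x‖ ^ 2) +
          2 * (C ^ 2 * ∫ x in G.K j, ‖(p 1).grad x‖ ^ 2) := by field_simp
        rw [this]
        linarith
    _ ≤ M.ρ * M.σ * (2 * C ^ 2 * M.κlo⁻¹ *
          ((∫ z, M.kap 0 z * ‖(p 0).D z‖ ^ 2 ∂G.mixedMeasure (G.K j)) +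
          ∫ z, M.kap 1 z * ‖(p 1).D z‖ ^ 2 ∂G.mixedMeasure (G.K j))) := by
        gcongr
    _ = _ := by ring

theorem integrable_sum_kap {S : Set Plane} (hS : ∀ᵐ z ∂G.mixedMeasure S, G.pt z ∈ G.Ω)
    {p : DualFun ι} (hp : G.DualSqIntegrable S p) :
    Integrable (fun z => ∑ i, M.kap i z * ‖(p i).D z‖ ^ 2) (G.mixedMeasure S) := by
  refine integrable_finsetSum _ fun i _ => ?_
  have := M.integrable_kap_inner hS i (hp i) (hp i)
  simpa only [real_inner_self_eq_norm_sq] using this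

/-- Product rule with `B_j ≤ 1` and `|∇B_j|² ≤ 4 ∑ |∇χ_k|²`: the gradient of the bubble falls on the
weight of `s`. -/
theorem sum_kap_bubbleMul_le (p : DualFun ι) {z : MixedPt ι} (hz : G.pt z ∈ interior (G.K j)) :
    ∑ i, M.kap i z * ‖(G.bubbleMul j p i).D z‖ ^ 2 ≤
      2 * M.aDens p p z + 8 * M.sDens p p z := by
  have hΩ : G.pt z ∈ G.Ω := G.interior_subset j hz
  refine le_trans ?_ (add_le_add_left (mul_le_mul_of_nonneg_left (M.sum_kap_le_aDens p z)
    zero_le_two) _)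
  rw [sDens_self, Finset.mul_sum, Finset.mul_sum, ← Finset.sum_add_distrib]
  refine Finset.sum_le_sum fun i _ => ?_
  have hk := (M.kap_pos i hΩ).le
  have hb := G.norm_D_bubble_sq_le j hz
  have h1 : ‖(G.bubbleMul j p i).D z‖ ≤
      ‖(p i).D z‖ + |(p i).U z| * ‖(G.lift (G.bubble j)).D z‖ := by
    rw [bubbleMul, D_mul]
    refine (norm_add_le _ _).trans ?_
    rw [norm_smul, norm_smul, Real.norm_eq_abs, Real.norm_eq_abs]
    gcongr
    refine mul_le_of_le_one_left (norm_nonneg _) ?_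
    rw [abs_of_nonneg (G.bubble_nonneg _ _)]
    exact G.bubble_le_one _ _
  have h2 : ‖(G.bubbleMul j p i).D z‖ ^ 2 ≤
      2 * ‖(p i).D z‖ ^ 2 + 8 * (G.hatW z * (p i).U z ^ 2) := by
    refine (pow_le_pow_left₀ (norm_nonneg _) h1 2).trans ?_
    have h3 := mul_le_mul_of_nonneg_left hb (sq_nonneg ((p i).U z))
    have h4 := sq_abs ((p i).U z)
    nlinarith [sq_nonneg (‖(p i).D z‖ - |(p i).U z| * ‖(G.lift (G.bubble j)).D z‖)]
  have := mul_le_mul_of_nonneg_left h2 hk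
  linarith

theorem aQLoc_bubbleMul_le {C : ℝ} (hC : G.IsPoincareConst C) (p : G.locSpace j) :
    M.aQLoc j (G.bubbleMul j p.1) (G.bubbleMul j p.1) ≤
      (1 + 2 * C ^ 2 * M.ρ * M.σ * M.κlo⁻¹) * (2 * M.aBil j p p + 8 * M.sBil j p p) := by
  have hp := locSpace_sq j p
  have hb := fun i => memClosure_bubbleMul p i
  have hbs : G.DualSqIntegrable (G.K j) (G.bubbleMul j p.1) := fun i => (hb i).1
  have h1 := exch_integral_le (M := M) hC hb
  have hi := integrable_sum_kap (M := M) (G.ae_mem_Ω j) hbs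
  have h2 : ∫ z, ∑ i, M.kap i z * ‖(G.bubbleMul j p.1 i).D z‖ ^ 2 ∂G.mixedMeasure (G.K j) ≤
      2 * M.aBil j p p + 8 * M.sBil j p p := by
    rw [aBil_apply, sBil_apply, M.aQLoc_eq j hp hp, M.sLoc_eq j hp hp, ← integral_const_mul,
      ← integral_const_mul]
    have ha := (M.integrable_aDens (G.ae_mem_Ω j) hp hp).const_mul 2
    have hs := (M.integrable_sDens j hp hp).const_mul 8
    rw [← integral_add ha hs]
    exact integral_mono_ae hi (ha.add hs)
      ((G.ae_mem_interior j).mono fun z hz => sum_kap_bubbleMul_le p.1 hz)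
  rw [M.aQLoc_eq j hbs hbs]
  simp only [aDens_self]
  rw [integral_add hi]
  · have hρσ : 0 ≤ 2 * C ^ 2 * M.ρ * M.σ * M.κlo⁻¹ := by
      have := M.ρ_nonneg
      have := M.σ_nonneg
      have := M.κlo_pos
      positivity
    nlinarith
  · have h3 := (G.sqIntegrable_iff.1 ((hbs 0).sub (hbs 1))).1
    refine (M.integrable_exch_mul h3 h3).congr (ae_of_all _ fun z => ?_)
    simp only [MixedFun.U_sub, sq]

/-- Functions in `K_j` with prescribed moments, with an energy estimate. -/
theorem exists_lift (h : ∀ j, M.IsEigenSystem j (lam j) (φ j)) {C : ℝ} (hC : G.IsPoincareConst C)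
    (j : J) (c : ℕ → ℝ) : ∃ v : DualFun ι,
      (∀ i, G.MemClosure G.Ω (interior (G.K j)) (v i)) ∧
      (∀ z, G.pt z ∉ G.K j → ∀ i, (v i).U z = 0 ∧ (v i).D z = 0) ∧
      (∀ k < L j, M.sLoc j v (φ j k) = c k) ∧
      M.aQLoc j v v ≤ M.Dconst C L lam φ * ∑ k ∈ Finset.range (L j), c k ^ 2 := by
  -- The moments of `B_j μ` are the values of the positive definite form `s(B_j μ, φ_k)`, so every
  -- vector of moments is attained by a combination `μ` of the `φ_k`.
  obtain ⟨x, hx⟩ := exists_form_eq (n := L j) (M.bubbleBil j) (fun k => (h j).fn k)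
    (fun x hx => (h j).bubbleBil_comb_pos x hx) (fun k => c k)
  set μ := (h j).comb x with hμ
  have hz : ∀ z, G.pt z ∉ G.K j → ∀ i, (G.bubbleMul j μ.1 i).U z = 0 ∧
      (G.bubbleMul j μ.1 i).D z = 0 := fun z hz i => G.mul_bubble_eq_zero j _ hz
  refine ⟨G.bubbleMul j μ.1, fun i => (memClosure_bubbleMul μ i).extend fun z hz' => hz z hz' i,
    hz, fun k hk => hx ⟨k, hk⟩, ?_⟩
  set A := ∑ k, x k ^ 2 with hA
  set B := ∑ k ∈ Finset.range (L j), c k ^ 2 with hB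
  have hB' : B = ∑ k : Fin (L j), c k ^ 2 := Finset.sum_range _
  have hA0 : 0 ≤ A := Finset.sum_nonneg fun _ _ => sq_nonneg _
  have hB0 : 0 ≤ B := Finset.sum_nonneg fun _ _ => sq_nonneg _
  have hs : M.sBil j μ μ = A := (h j).sBil_comb x
  have ha : M.aBil j μ μ ≤ lamMax L lam * A := by
    rw [(h j).aBil_comb, hA, Finset.mul_sum]
    exact Finset.sum_le_sum fun k _ =>
      mul_le_mul_of_nonneg_right (le_lamMax L k.2) (sq_nonneg _)
  have ht : M.bubbleBil j μ μ = ∑ k, x k * c k := by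
    conv_lhs => rw [hμ, IsEigenSystem.comb, map_sum]
    refine Finset.sum_congr rfl fun k _ => ?_
    rw [map_smul, hx k, smul_eq_mul]
  have hCS : M.bubbleBil j μ μ ^ 2 ≤ A * B := by
    rw [ht, hB']; exact Finset.sum_mul_sq_le_sq_mul_sq _ _ _
  -- With `T = s(B_j μ, μ)` there is `A ≤ C_π T`, while `T² ≤ A B` by Cauchy–Schwarz for
  -- coefficients and moments; eliminating `T` gives the square of `C_π`.
  have hAB : A ≤ M.Cpi L φ ^ 2 * B := by
    have h1 := sBil_le_Cpi L h (j := j) x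
    rw [← hμ, hs] at h1
    rcases hA0.eq_or_lt with h0 | h0
    · rw [← h0]; positivity
    · have h2 : A ^ 2 ≤ M.Cpi L φ ^ 2 * (A * B) := by
        refine (pow_le_pow_left₀ hA0 h1 2).trans ?_
        rw [mul_pow]
        gcongr
      have h3 : A * A ≤ A * (M.Cpi L φ ^ 2 * B) := by linarith
      exact le_of_mul_le_mul_left h3 h0
  have h1 := aQLoc_bubbleMul_le (M := M) hC μ
  refine h1.trans ?_
  have hρσ : 0 ≤ 1 + 2 * C ^ 2 * M.ρ * M.σ * M.κlo⁻¹ := by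
    have := M.ρ_nonneg
    have := M.σ_nonneg
    have := M.κlo_pos
    positivity
  have h2 : 2 * M.aBil j μ μ + 8 * M.sBil j μ μ ≤
      2 * (4 ^ 2 + lamMax L lam ^ 2) * (M.Cpi L φ ^ 2 * B) := by
    refine le_trans (b := 2 * (4 ^ 2 + lamMax L lam ^ 2) * A) ?_ (by gcongr)
    rw [hs]
    have h3 : 0 ≤ 2 * (4 ^ 2 + lamMax L lam ^ 2) - (2 * lamMax L lam + 8) := by
      nlinarith [sq_nonneg (lamMax L lam - 1)]
    nlinarith [mul_nonneg h3 hA0]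
  refine (mul_le_mul_of_nonneg_left h2 hρσ).trans_eq ?_
  rw [Dconst]
  ring

/-- The factors of `D` are bounded below by `2`, `1`, `4²` and `1`, the last because `B_j ≤ 1`. The
decay argument uses only that `D ≥ 1`. -/
theorem le_Dconst (h : ∀ j, M.IsEigenSystem j (lam j) (φ j)) {C : ℝ} {k : ℕ} (hk : k < L j) :
    32 ≤ M.Dconst C L lam φ := by
  have h1 := one_le_Cpi L h hk
  have h2 : 0 ≤ 2 * C ^ 2 * M.ρ * M.σ * M.κlo⁻¹ := by
    have := M.ρ_nonneg
    have := M.σ_nonneg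
    have := M.κlo_pos
    positivity
  rw [Dconst]
  calc (32 : ℝ) = 2 * (1 + 0) * (4 ^ 2 + 0) * 1 ^ 2 := by norm_num
    _ ≤ _ := by gcongr; positivity

end Medium


namespace Medium

open Geometry

variable {J N ι : Type*} {G : Geometry J N ι} (M : Medium G) [Fintype J] [Fintype N] [Fintype ι]

/-! ### The local forms on the global space -/

variable (G) in
/-- The space `V` as a submodule. -/
abbrev _root_.Geometry.globSpace : Submodule ℝ (DualFun ι) := G.dualClosure G.Ω G.Ω

/-- Restriction to an element. -/
def _root_.Geometry.res (i : J) : G.globSpace →ₗ[ℝ] G.locSpace i :=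
  Submodule.inclusion fun _ hu k => (hu k).mono_left (G.mixedMeasure_K_le i)

theorem _root_.Geometry.coe_res (i : J) (u : G.globSpace) : (res i u).1 = u.1 :=
  Submodule.coe_inclusion _ u

/-- The form `a_Q^{(i)}` on `V`. -/
def aGlob (i : J) : G.globSpace →ₗ[ℝ] G.globSpace →ₗ[ℝ] ℝ := (M.aBil i).compl₁₂ (res i) (res i)

/-- The form `s^{(i)}` on `V`. -/
def sGlob (i : J) : G.globSpace →ₗ[ℝ] G.globSpace →ₗ[ℝ] ℝ := (M.sBil i).compl₁₂ (res i) (res i)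

theorem aGlob_apply (i : J) (u v : G.globSpace) : M.aGlob i u v = M.aQLoc i u.1 v.1 := by
  rw [aGlob, LinearMap.compl₁₂_apply, aBil_apply, coe_res, coe_res]

theorem sGlob_apply (i : J) (u v : G.globSpace) : M.sGlob i u v = M.sLoc i u.1 v.1 := by
  rw [sGlob, LinearMap.compl₁₂_apply, sBil_apply, coe_res, coe_res]

theorem aGlob_symm (i : J) (u v : G.globSpace) : M.aGlob i u v = M.aGlob i v u :=
  M.aBil_symm i _ _

theorem aGlob_nonneg (i : J) (u : G.globSpace) : 0 ≤ M.aGlob i u u := M.aBil_nonneg i _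

theorem aGlob_sq_le (i : J) (u v : G.globSpace) :
    M.aGlob i u v ^ 2 ≤ M.aGlob i u u * M.aGlob i v v :=
  form_sq_le _ (M.aGlob_symm i) (M.aGlob_nonneg i) u v

/-- By Cauchy–Schwarz, a function without energy in an element is invisible to the local form there.
This serves in place of support arguments below. -/
theorem aGlob_eq_zero {i : J} {v : G.globSpace} (hv : M.aGlob i v v ≤ 0) (u : G.globSpace) :
    M.aGlob i u v = 0 := by
  have h := M.aGlob_sq_le i u v
  have h1 : M.aGlob i v v = 0 := le_antisymm hv (M.aGlob_nonneg i v)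
  rw [h1, mul_zero] at h
  exact pow_eq_zero_iff two_ne_zero |>.1 (le_antisymm h (sq_nonneg _))

theorem aQ_eq_sum_aGlob (u v : G.globSpace) : M.aQ u.1 v.1 = ∑ i, M.aGlob i u v := by
  simp only [aGlob_apply]
  exact M.aQ_eq_sum (fun i => (u.2 i).1) (fun i => (v.2 i).1)

/-- The form `a_Q` on `V`. -/
def aTot : G.globSpace →ₗ[ℝ] G.globSpace →ₗ[ℝ] ℝ := ∑ i, M.aGlob i

theorem aTot_apply (u v : G.globSpace) : M.aTot u v = ∑ i, M.aGlob i u v := by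
  simp only [aTot, LinearMap.sum_apply]

theorem aQ_eq_aTot (u v : G.globSpace) : M.aQ u.1 v.1 = M.aTot u v := by
  rw [aTot_apply, aQ_eq_sum_aGlob]

theorem aTot_symm (u v : G.globSpace) : M.aTot u v = M.aTot v u := by
  simp only [aTot_apply, M.aGlob_symm _ u v]

theorem aTot_nonneg (u : G.globSpace) : 0 ≤ M.aTot u u := by
  rw [aTot_apply]; exact Finset.sum_nonneg fun i _ => M.aGlob_nonneg i u

variable {M}

theorem _root_.Geometry.sq_of_glob (u : G.globSpace) (i : J) : G.DualSqIntegrable (G.K i) u.1 := by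
  have := locSpace_sq i (res i u)
  rwa [coe_res] at this

theorem aQLoc_congr {i : J} {p p' : G.globSpace}
    (h : ∀ᵐ z ∂G.mixedMeasure (G.K i), ∀ k, (p.1 k).U z = (p'.1 k).U z ∧
      (p.1 k).D z = (p'.1 k).D z) (v : G.globSpace) : M.aGlob i p v = M.aGlob i p' v := by
  rw [aGlob_apply, aGlob_apply, M.aQLoc_eq i (sq_of_glob p i) (sq_of_glob v i),
    M.aQLoc_eq i (sq_of_glob p' i) (sq_of_glob v i)]
  refine integral_congr_ae (h.mono fun z hz => ?_)
  simp only [aDens, (hz _).1, (hz _).2]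

theorem sLoc_congr {i : J} {p p' : G.globSpace}
    (h : ∀ᵐ z ∂G.mixedMeasure (G.K i), ∀ k, (p.1 k).U z = (p'.1 k).U z)
    {v : DualFun ι} (hv : v ∈ G.locSpace i) : M.sLoc i p.1 v = M.sLoc i p'.1 v := by
  have hv' := locSpace_sq i ⟨v, hv⟩
  rw [M.sLoc_eq i (sq_of_glob p i) hv', M.sLoc_eq i (sq_of_glob p' i) hv']
  refine integral_congr_ae (h.mono fun z hz => ?_)
  simp only [sDens, hz]

variable {lam : J → ℕ → ℝ} {φ : J → ℕ → DualFun ι} {L : J → ℕ}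

/-- The moments of `u` with respect to the auxiliary functions. -/
def moment (h : ∀ j, M.IsEigenSystem j (lam j) (φ j)) (i : J) (k : ℕ) :
    G.globSpace →ₗ[ℝ] ℝ := ((M.sBil i).flip ((h i).fn k)).comp (res i)

theorem moment_apply (h : ∀ j, M.IsEigenSystem j (lam j) (φ j)) (i : J) (k : ℕ)
    (u : G.globSpace) : moment h i k u = M.sLoc i u.1 (φ i k) := by
  rw [moment, LinearMap.comp_apply, LinearMap.flip_apply, sBil_apply, coe_res]
  rfl

/-- Bessel's inequality: subtract the `s`-projection onto the first `n` eigenfunctions. -/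
theorem sum_moment_sq_le (h : ∀ j, M.IsEigenSystem j (lam j) (φ j)) (i : J) (u : G.globSpace)
    (n : ℕ) : ∑ k ∈ Finset.range n, moment h i k u ^ 2 ≤ M.sGlob i u u := by
  set c : Fin n → ℝ := fun k => moment h i k u with hc
  set y := (h i).comb c with hy
  have h1 := M.sBil_nonneg i (res i u - y)
  have h2 : M.sBil i (res i u) y = ∑ k, c k ^ 2 := by
    rw [hy, IsEigenSystem.comb, map_sum]
    refine Finset.sum_congr rfl fun k _ => ?_
    rw [map_smul, smul_eq_mul, sq]
    rfl
  have h3 := (h i).sBil_comb c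
  simp only [map_sub, LinearMap.sub_apply] at h1
  rw [M.sBil_symm i y (res i u), h2, h3] at h1
  have h4 : M.sGlob i u u = M.sBil i (res i u) (res i u) := rfl
  rw [Finset.sum_range (fun k => moment h i k u ^ 2), h4]
  linarith

theorem Lam_mul_sGlob_le (h : ∀ j, M.IsEigenSystem j (lam j) (φ j)) {i : J} {u : G.globSpace}
    (hu : ∀ k < L i, moment h i k u = 0) : Lam L lam * M.sGlob i u u ≤ M.aGlob i u u :=
  (mul_le_mul_of_nonneg_right (Lam_le L i) (M.sBil_nonneg i (res i u))).trans
    (IsEigenSystem.spectral_bound M i (h i) (res i u) fun k hk => by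
      rw [coe_res, ← moment_apply h, hu k hk])

/-! ### Functions with prescribed moments in several elements -/

open Classical in
-- The lifts of different elements vanish outside their own elements, so they are superposed without
-- interaction: in each element the sum has the moments and the energy of its own lift.
theorem exists_lift_sum (h : ∀ j, M.IsEigenSystem j (lam j) (φ j)) {C : ℝ}
    (hC : G.IsPoincareConst C) (P : Set J) (c : J → ℕ → ℝ)
    (hc : ∀ i ∉ P, ∀ k < L i, c i k = 0) : ∃ v : G.globSpace,
      (∀ k, G.MemClosure G.Ω (interior (⋃ i ∈ P, G.K i) ∩ G.Ω) (v.1 k)) ∧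
      (∀ i, ∀ k < L i, moment h i k v = c i k) ∧
      ∀ i, M.aGlob i v v ≤ M.Dconst C L lam φ * ∑ k ∈ Finset.range (L i), c i k ^ 2 := by
  choose v hvc hv0 hvm hva using fun i => exists_lift L h hC i (c i)
  set W := interior (⋃ i ∈ P, G.K i) ∩ G.Ω with hW
  have hmem : ∀ i ∈ P, v i ∈ G.dualClosure G.Ω W := fun i hi k =>
    (hvc i k).mono (subset_inter (interior_mono (subset_biUnion_of_mem (u := G.K) hi))
      (G.interior_subset i))
  set w : DualFun ι := ∑ i with i ∈ P, v i with hw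
  have hwW : w ∈ G.dualClosure G.Ω W :=
    Submodule.sum_mem _ fun i hi => hmem i (Finset.mem_filter.1 hi).2
  have hglob : ∀ i, v i ∈ G.globSpace := fun i k => (hvc i k).mono (G.interior_subset i)
  let w' : G.globSpace := ⟨w, fun k => (hwW k).mono inter_subset_right⟩
  let v' : J → G.globSpace := fun i => ⟨v i, hglob i⟩
  have hw' : w' = ∑ i with i ∈ P, v' i := by
    refine Subtype.ext ?_
    rw [AddSubmonoidClass.coe_finsetSum]
  have hzero : ∀ {i i'}, i' ≠ i → ∀ᵐ z ∂G.mixedMeasure (G.K i), ∀ k,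
      ((v' i').1 k).U z = ((0 : G.globSpace).1 k).U z ∧
      ((v' i').1 k).D z = ((0 : G.globSpace).1 k).D z := by
    intro i i' hii'
    filter_upwards [G.ae_mem_interior i] with z hz k
    have h1 : G.pt z ∉ G.K i' := fun hz' => G.notMem_interior_of_mem hii'.symm hz' hz
    have h2 := hv0 i' z h1 k
    refine ⟨h2.1.trans ?_, h2.2.trans ?_⟩
    · rcases z with x | ⟨l, t⟩ <;> rfl
    · rcases z with x | ⟨l, t⟩
      · rfl
      · change (0 : Plane) = (0 : ℝ) • basisVec
        rw [zero_smul]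
  have hm0 : ∀ {i i'}, i' ≠ i → ∀ k, moment h i k (v' i') = 0 := by
    intro i i' hii' k
    rw [moment_apply, sLoc_congr ((hzero hii').mono fun z hz k => (hz k).1) ((h i).eigenpair k).1,
      ← moment_apply h, map_zero]
  have ha0 : ∀ {i i'}, i' ≠ i → ∀ u, M.aGlob i (v' i') u = 0 := by
    intro i i' hii' u
    rw [aQLoc_congr (hzero hii'), map_zero, LinearMap.zero_apply]
  refine ⟨w', hwW, fun i k hk => ?_, fun i => ?_⟩
  · rw [hw', map_sum]
    by_cases hi : i ∈ P
    · rw [Finset.sum_eq_single i (fun i' _ hi' => hm0 hi' k)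
        (fun hi' => absurd (Finset.mem_filter.2 ⟨Finset.mem_univ _, hi⟩) hi')]
      exact hvm i k hk
    · rw [hc i hi k hk]
      refine Finset.sum_eq_zero fun i' hi' => hm0 ?_ k
      rintro rfl
      exact hi (Finset.mem_filter.1 hi').2
  · by_cases hi : i ∈ P
    · have h1 : ∀ u, M.aGlob i w' u = M.aGlob i (v' i) u := by
        intro u
        rw [hw', map_sum, LinearMap.sum_apply]
        exact Finset.sum_eq_single i (fun i' _ hi' => ha0 hi' u)
          (fun hi' => absurd (Finset.mem_filter.2 ⟨Finset.mem_univ _, hi⟩) hi')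
      rw [h1, M.aGlob_symm, h1]
      exact hva i
    · have h1 : M.aGlob i w' w' = 0 := by
        rw [hw', map_sum (M.aGlob i), LinearMap.sum_apply]
        refine Finset.sum_eq_zero fun i' hi' => ha0 ?_ _
        rintro rfl
        exact hi (Finset.mem_filter.1 hi').2
      rw [h1, Finset.sum_eq_zero, mul_zero]
      intro k hk
      rw [hc i hi k (Finset.mem_range.1 hk)]
      norm_num

/-! ### Multiplication with the cutoff functions -/

/-- The product with the cutoff function of `K_{j,n}`. -/
def cutMul (j : J) (n : ℕ) (u : G.globSpace) : DualFun ι :=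
  fun k => G.mul (G.cutoff (G.patch j n)) (u.1 k)

theorem memClosure_cutMul (j : J) (n : ℕ) (u : G.globSpace) (k : Fin 2) :
    G.MemClosure G.Ω (interior (G.patchSet j (n + 1)) ∩ G.Ω) (cutMul j n u k) := by
  refine (G.isCutoff_cutoff j n).memClosure_mul (isOpen_interior.inter G.isOpen_Ω) ?_ (u.2 k)
  rw [G.mixedMeasure_Ω, ae_finsetSum_measure_iff]
  intro i _
  exact (G.ae_mem_interior i).mono fun z hz => ⟨i, hz⟩

/-- The product with the cutoff function of `K_{j,n}` as an element of `V`. -/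
def cutGlob (j : J) (n : ℕ) (u : G.globSpace) : G.globSpace :=
  ⟨cutMul j n u, fun k => (memClosure_cutMul j n u k).mono inter_subset_right⟩

theorem U_cutGlob (j : J) (n : ℕ) (u : G.globSpace) (k : Fin 2) (z : MixedPt ι) :
    ((cutGlob j n u).1 k).U z = G.cutoff (G.patch j n) (G.pt z) * (u.1 k).U z :=
  G.U_mul _ _ _

theorem D_cutGlob (j : J) (n : ℕ) (u : G.globSpace) (k : Fin 2) (z : MixedPt ι) :
    ((cutGlob j n u).1 k).D z = G.cutoff (G.patch j n) (G.pt z) • (u.1 k).D z +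
      (u.1 k).U z • (G.lift (G.cutoff (G.patch j n))).D z :=
  G.D_mul _ _ _

theorem cutGlob_ae_eq_self {j i : J} {n : ℕ} (hi : i ∈ G.patch j n) (u : G.globSpace) :
    ∀ᵐ z ∂G.mixedMeasure (G.K i), ∀ k, ((cutGlob j n u).1 k).U z = (u.1 k).U z ∧
      ((cutGlob j n u).1 k).D z = (u.1 k).D z := by
  filter_upwards [G.ae_mem_interior i] with z hz k
  rw [U_cutGlob, D_cutGlob, G.cutoff_eq_one hi (_root_.interior_subset hz),
    G.D_lift_cutoff_eq_zero_of_mem hi hz, one_mul, one_smul, smul_zero, add_zero]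
  exact ⟨rfl, rfl⟩

theorem cutGlob_ae_eq_zero {j i : J} {n : ℕ} (hi : i ∉ G.patch j (n + 1)) (u : G.globSpace) :
    ∀ᵐ z ∂G.mixedMeasure (G.K i), ∀ k,
      ((cutGlob j n u).1 k).U z = ((0 : G.globSpace).1 k).U z ∧
      ((cutGlob j n u).1 k).D z = ((0 : G.globSpace).1 k).D z := by
  filter_upwards [G.ae_mem_interior i] with z hz k
  rw [U_cutGlob, D_cutGlob, G.cutoff_eq_zero_of_notMem hi (_root_.interior_subset hz),
    G.D_lift_cutoff_eq_zero_of_notMem hi hz, zero_mul, zero_smul, smul_zero, add_zero]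
  constructor
  · rcases z with x | ⟨l, t⟩ <;> rfl
  · rcases z with x | ⟨l, t⟩
    · rfl
    · change (0 : Plane) = (0 : ℝ) • basisVec
      rw [zero_smul]

theorem sGlob_cutGlob_le (j i : J) (n : ℕ) (u : G.globSpace) :
    M.sGlob i (cutGlob j n u) (cutGlob j n u) ≤ M.sGlob i u u := by
  have h1 := sq_of_glob (cutGlob j n u) i
  have h2 := sq_of_glob u i
  rw [sGlob_apply, sGlob_apply, M.sLoc_eq i h1 h1, M.sLoc_eq i h2 h2]
  refine integral_mono_ae (M.integrable_sDens i h1 h1) (M.integrable_sDens i h2 h2) ?_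
  filter_upwards [G.ae_mem_Ω i] with z hz
  rw [sDens_self, sDens_self]
  refine Finset.sum_le_sum fun k _ => ?_
  refine mul_le_mul_of_nonneg_left (mul_le_mul_of_nonneg_left ?_ (G.hatW_nonneg z))
    (M.kap_pos k hz).le
  rw [U_cutGlob, mul_pow]
  refine mul_le_of_le_one_left (sq_nonneg _) ?_
  exact pow_le_one₀ (G.cutoff_nonneg _ _) (G.cutoff_le_one _ _)

theorem aDens_sub_cutGlob_le (j : J) {i : J} (n : ℕ) (u : G.globSpace) {z : MixedPt ι}
    (hz : G.pt z ∈ interior (G.K i)) :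
    M.aDens (u - cutGlob j n u).1 (u - cutGlob j n u).1 z ≤
      2 * M.aDens u.1 u.1 z + 8 * M.sDens u.1 u.1 z := by
  have hΩ : G.pt z ∈ G.Ω := G.interior_subset i hz
  set χ := G.cutoff (G.patch j n) (G.pt z) with hχ
  have hχ0 : 0 ≤ χ := G.cutoff_nonneg _ _
  have hχ1 : χ ≤ 1 := G.cutoff_le_one _ _
  have hU : ∀ k, ((u - cutGlob j n u).1 k).U z = (1 - χ) * (u.1 k).U z := fun k => by
    change (u.1 k - (cutGlob j n u).1 k).U z = _
    rw [MixedFun.U_sub, U_cutGlob]; ring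
  have hD : ∀ k, ((u - cutGlob j n u).1 k).D z = (1 - χ) • (u.1 k).D z -
      (u.1 k).U z • (G.lift (G.cutoff (G.patch j n))).D z := fun k => by
    change (u.1 k - (cutGlob j n u).1 k).D z = _
    rw [MixedFun.D_sub, D_cutGlob]; module
  have hb := G.norm_D_cutoff_sq_le (G.patch j n) hz
  rw [aDens_self, aDens_self, sDens_self, hU, hU, mul_add, Finset.mul_sum, Finset.mul_sum,
    add_right_comm, ← Finset.sum_add_distrib]
  refine add_le_add (Finset.sum_le_sum fun k _ => ?_) ?_
  · have hk := (M.kap_pos k hΩ).le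
    have h1 : ‖((u - cutGlob j n u).1 k).D z‖ ≤
        ‖(u.1 k).D z‖ + |(u.1 k).U z| * ‖(G.lift (G.cutoff (G.patch j n))).D z‖ := by
      rw [hD]
      refine (norm_sub_le _ _).trans ?_
      rw [norm_smul, norm_smul, Real.norm_eq_abs, Real.norm_eq_abs]
      gcongr
      refine mul_le_of_le_one_left (norm_nonneg _) ?_
      rw [abs_of_nonneg (by linarith)]
      linarith
    have h2 : ‖((u - cutGlob j n u).1 k).D z‖ ^ 2 ≤
        2 * ‖(u.1 k).D z‖ ^ 2 + 8 * (G.hatW z * (u.1 k).U z ^ 2) := by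
      refine (pow_le_pow_left₀ (norm_nonneg _) h1 2).trans ?_
      have h3 := mul_le_mul_of_nonneg_left hb (sq_nonneg ((u.1 k).U z))
      have h4 := sq_abs ((u.1 k).U z)
      nlinarith [sq_nonneg (‖(u.1 k).D z‖ -
        |(u.1 k).U z| * ‖(G.lift (G.cutoff (G.patch j n))).D z‖)]
    have := mul_le_mul_of_nonneg_left h2 hk
    linarith
  · rw [← mul_sub, mul_pow]
    have h3 : (1 - χ) ^ 2 ≤ 1 := pow_le_one₀ (by linarith) (by linarith)
    have h4 := mul_nonneg (M.exch_nonneg z) (sq_nonneg ((u.1 0).U z - (u.1 1).U z))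
    nlinarith

theorem aGlob_sub_cutGlob_le (j i : J) (n : ℕ) (u : G.globSpace) :
    M.aGlob i (u - cutGlob j n u) (u - cutGlob j n u) ≤
      2 * M.aGlob i u u + 8 * M.sGlob i u u := by
  have h1 := sq_of_glob (u - cutGlob j n u) i
  have h2 := sq_of_glob u i
  have ha := (M.integrable_aDens (G.ae_mem_Ω i) h2 h2).const_mul 2
  have hs := (M.integrable_sDens i h2 h2).const_mul 8
  rw [aGlob_apply, aGlob_apply, sGlob_apply, M.aQLoc_eq i h1 h1, M.aQLoc_eq i h2 h2,
    M.sLoc_eq i h2 h2, ← integral_const_mul, ← integral_const_mul, ← integral_add ha hs]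
  exact integral_mono_ae (M.integrable_aDens (G.ae_mem_Ω i) h1 h1) (ha.add hs)
    ((G.ae_mem_interior i).mono fun z hz => aDens_sub_cutGlob_le j n u hz)

/-- Testing `u` against `(1 - χ) u` gives nonnegative terms `(1 - χ)|∇u|²` and `(1 - χ)` times the
exchange term. Only the term with `∇χ` can be negative, and Young's inequality splits it; the free
parameter `t` is later matched to the spectral gap. -/
theorem neg_aDens_sub_cutGlob_le (j : J) {i : J} (n : ℕ) (u : G.globSpace) {t : ℝ} (ht : 0 < t)
    {z : MixedPt ι} (hz : G.pt z ∈ interior (G.K i)) :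
    -M.aDens u.1 (u - cutGlob j n u).1 z ≤
      t * M.aDens u.1 u.1 z + t⁻¹ * M.sDens u.1 u.1 z := by
  have hΩ : G.pt z ∈ G.Ω := G.interior_subset i hz
  set χ := G.cutoff (G.patch j n) (G.pt z) with hχ
  have hχ1 : 0 ≤ 1 - χ := sub_nonneg.2 (G.cutoff_le_one _ _)
  have hU : ∀ k, ((u - cutGlob j n u).1 k).U z = (1 - χ) * (u.1 k).U z := fun k => by
    change (u.1 k - (cutGlob j n u).1 k).U z = _
    rw [MixedFun.U_sub, U_cutGlob]; ring
  have hD : ∀ k, ((u - cutGlob j n u).1 k).D z = (1 - χ) • (u.1 k).D z -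
      (u.1 k).U z • (G.lift (G.cutoff (G.patch j n))).D z := fun k => by
    change (u.1 k - (cutGlob j n u).1 k).D z = _
    rw [MixedFun.D_sub, D_cutGlob]; module
  have hb := G.norm_D_cutoff_sq_le (G.patch j n) hz
  have hterm : ∀ k, -(M.kap k z * inner ℝ ((u.1 k).D z) (((u - cutGlob j n u).1 k).D z)) ≤
      t * (M.kap k z * ‖(u.1 k).D z‖ ^ 2) +
        t⁻¹ * (M.kap k z * (G.hatW z * (u.1 k).U z ^ 2)) := by
    intro k
    have hk := (M.kap_pos k hΩ).le
    set d := (G.lift (G.cutoff (G.patch j n))).D z with hd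
    rw [hD, inner_sub_right, inner_smul_right, inner_smul_right, real_inner_self_eq_norm_sq]
    have h1 : (u.1 k).U z * inner ℝ ((u.1 k).D z) d ≤
        |(u.1 k).U z| * (‖(u.1 k).D z‖ * ‖d‖) := by
      refine (le_abs_self _).trans ?_
      rw [abs_mul]
      exact mul_le_mul_of_nonneg_left (abs_real_inner_le_norm _ _) (abs_nonneg _)
    have h2 : |(u.1 k).U z| * (‖(u.1 k).D z‖ * ‖d‖) ≤
        t * ‖(u.1 k).D z‖ ^ 2 + t⁻¹ * (G.hatW z * (u.1 k).U z ^ 2) := by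
      -- The weights are chosen so that the quarter in front of `|∇χ|²` cancels the `4` of
      -- `norm_D_cutoff_sq_le`.
      have h3 : 0 ≤ (2 * t * ‖(u.1 k).D z‖ - |(u.1 k).U z| * ‖d‖) ^ 2 * (4 * t)⁻¹ := by
        positivity
      have h4 : (2 * t * ‖(u.1 k).D z‖ - |(u.1 k).U z| * ‖d‖) ^ 2 * (4 * t)⁻¹ =
          t * ‖(u.1 k).D z‖ ^ 2 - |(u.1 k).U z| * (‖(u.1 k).D z‖ * ‖d‖) +
          t⁻¹ * (|(u.1 k).U z| ^ 2 * ‖d‖ ^ 2 / 4) := by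
        field_simp
        ring
      have h5 : |(u.1 k).U z| ^ 2 * ‖d‖ ^ 2 / 4 ≤ G.hatW z * (u.1 k).U z ^ 2 := by
        rw [sq_abs]
        nlinarith [mul_le_mul_of_nonneg_left hb (sq_nonneg ((u.1 k).U z))]
      have h6 := mul_le_mul_of_nonneg_left h5 (inv_nonneg.2 ht.le)
      linarith
    have h7 : 0 ≤ (1 - χ) * ‖(u.1 k).D z‖ ^ 2 := mul_nonneg hχ1 (sq_nonneg _)
    have h8 := mul_le_mul_of_nonneg_left (h1.trans h2) hk
    have h9 := mul_nonneg hk h7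
    linarith
  have hex : 0 ≤ M.exch z * (((u.1 0).U z - (u.1 1).U z) *
      (((u - cutGlob j n u).1 0).U z - ((u - cutGlob j n u).1 1).U z)) := by
    rw [hU, hU, ← mul_sub]
    refine mul_nonneg (M.exch_nonneg z) ?_
    have := mul_nonneg hχ1 (sq_nonneg ((u.1 0).U z - (u.1 1).U z))
    linarith
  have h10 := M.sum_kap_le_aDens u.1 z
  have h11 := mul_le_mul_of_nonneg_left h10 ht.le
  rw [sDens_self]
  refine le_trans ?_ (add_le_add_left h11 _)
  rw [aDens, Finset.mul_sum, Finset.mul_sum, ← Finset.sum_add_distrib]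
  have h12 := Finset.sum_le_sum fun k (_ : k ∈ Finset.univ) => hterm k
  rw [Finset.sum_neg_distrib] at h12
  linarith

theorem neg_aGlob_sub_cutGlob_le (j i : J) (n : ℕ) (u : G.globSpace) {t : ℝ} (ht : 0 < t) :
    -M.aGlob i u (u - cutGlob j n u) ≤ t * M.aGlob i u u + t⁻¹ * M.sGlob i u u := by
  have h1 := sq_of_glob (u - cutGlob j n u) i
  have h2 := sq_of_glob u i
  have ha := (M.integrable_aDens (G.ae_mem_Ω i) h2 h2).const_mul t
  have hs := (M.integrable_sDens i h2 h2).const_mul t⁻¹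
  rw [aGlob_apply, aGlob_apply, sGlob_apply, M.aQLoc_eq i h2 h1, M.aQLoc_eq i h2 h2,
    M.sLoc_eq i h2 h2, ← integral_const_mul, ← integral_const_mul, ← integral_add ha hs,
    ← integral_neg]
  exact integral_mono_ae (M.integrable_aDens (G.ae_mem_Ω i) h2 h1).neg (ha.add hs)
    ((G.ae_mem_interior i).mono fun z hz => neg_aDens_sub_cutGlob_le j n u ht hz)

end Medium


namespace Medium

open Geometry

variable {J N ι : Type*} {G : Geometry J N ι} {M : Medium G} [Fintype J] [Fintype N] [Fintype ι]
  {lam : J → ℕ → ℝ} {φ : J → ℕ → DualFun ι} {L : J → ℕ}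

/-! ### Exponential decay -/

theorem moment_cutGlob_of_mem (h : ∀ j, M.IsEigenSystem j (lam j) (φ j)) {j i : J} {n : ℕ}
    (hi : i ∈ G.patch j n) (u : G.globSpace) (k : ℕ) :
    moment h i k (cutGlob j n u) = moment h i k u := by
  rw [moment_apply, moment_apply, sLoc_congr
    ((cutGlob_ae_eq_self hi u).mono fun z hz k => (hz k).1) ((h i).eigenpair k).1]

theorem moment_cutGlob_of_notMem (h : ∀ j, M.IsEigenSystem j (lam j) (φ j)) {j i : J} {n : ℕ}
    (hi : i ∉ G.patch j (n + 1)) (u : G.globSpace) (k : ℕ) :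
    moment h i k (cutGlob j n u) = 0 := by
  rw [moment_apply, sLoc_congr
    ((cutGlob_ae_eq_zero hi u).mono fun z hz k => (hz k).1) ((h i).eigenpair k).1,
    ← moment_apply h, map_zero]

theorem aGlob_cutGlob_of_mem {j i : J} {n : ℕ} (hi : i ∈ G.patch j n) (u v : G.globSpace) :
    M.aGlob i (cutGlob j n u) v = M.aGlob i u v := aQLoc_congr (cutGlob_ae_eq_self hi u) v

theorem aGlob_cutGlob_of_notMem {j i : J} {n : ℕ} (hi : i ∉ G.patch j (n + 1))
    (u v : G.globSpace) : M.aGlob i (cutGlob j n u) v = 0 := by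
  rw [aQLoc_congr (cutGlob_ae_eq_zero hi u), map_zero, LinearMap.zero_apply]

/-- The cutoff of a function without moments, corrected so that it has no moments. -/
theorem exists_moment_free_cutoff (h : ∀ j, M.IsEigenSystem j (lam j) (φ j))
    (hΛ : 0 < Lam L lam) {C : ℝ} (hC : G.IsPoincareConst C) (hD : 0 ≤ M.Dconst C L lam φ)
    (j : J) (n : ℕ) {η : G.globSpace} (hη : ∀ i, ∀ k < L i, moment h i k η = 0) :
    ∃ x : G.globSpace, (∀ i, ∀ k < L i, moment h i k x = 0) ∧
      (∀ k, G.MemClosure G.Ω (interior (G.patchSet j (n + 1)) ∩ G.Ω) ((η - x).1 k)) ∧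
      (∀ i ∈ G.patch j n, M.aGlob i x x = 0) ∧
      (∀ i ∉ G.patch j (n + 1), M.aGlob i (η - x) (η - x) = 0) ∧
      (∀ i, -M.aGlob i η x ≤
        (2 + √(M.Dconst C L lam φ)) / √(Lam L lam) * M.aGlob i η η) ∧
      ∀ i, M.aGlob i x x ≤
        (16 + 2 * M.Dconst C L lam φ) * (1 + (Lam L lam)⁻¹) * M.aGlob i η η := by
  set D := M.Dconst C L lam φ with hDdef
  set Λ := Lam L lam with hΛdef
  set w := cutGlob j n η with hw
  -- Only the layer needs a correction: in `K_{j,n}` the cutoff is `1` and `η` has no moments,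
  -- outside `K_{j,n+1}` the cutoff is `0`.
  set P : Set J := G.patch j (n + 1) \ G.patch j n with hP
  have hmom0 : ∀ i ∉ P, ∀ k < L i, moment h i k w = 0 := by
    intro i hi k hk
    by_cases h1 : i ∈ G.patch j n
    · rw [hw, moment_cutGlob_of_mem h h1, hη i k hk]
    · exact moment_cutGlob_of_notMem h (fun h2 => hi ⟨h2, h1⟩) η k
  obtain ⟨v, hvW, hvm, hva⟩ := exists_lift_sum h hC P (fun i k => moment h i k w) hmom0
  have hv0 : ∀ i ∉ P, M.aGlob i v v ≤ 0 := by
    intro i hi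
    refine (hva i).trans_eq ?_
    rw [Finset.sum_eq_zero, mul_zero]
    intro k hk
    rw [hmom0 i hi k (Finset.mem_range.1 hk)]
    norm_num
  have hsη : ∀ i, M.sGlob i η η ≤ Λ⁻¹ * M.aGlob i η η := by
    intro i
    rw [inv_mul_eq_div, le_div_iff₀ hΛ, mul_comm]
    exact Lam_mul_sGlob_le h (hη i)
  have hvη : ∀ i, M.aGlob i v v ≤ D * (Λ⁻¹ * M.aGlob i η η) := fun i =>
    (hva i).trans (mul_le_mul_of_nonneg_left ((sum_moment_sq_le h i w _).trans
      ((sGlob_cutGlob_le j i n η).trans (hsη i))) hD)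
  have hx : η - (η - w + v) = w - v := by abel
  have hΛi : 0 < Λ⁻¹ := inv_pos.2 hΛ
  -- This is `(1 - χ) η` plus the lift of the moments of `χ η`; the complement `η - x = χ η - v`
  -- lives in `K_{j,n+1}`.
  refine ⟨η - w + v, fun i k hk => ?_, fun k => ?_, fun i hi => ?_, fun i hi => ?_, fun i => ?_,
    fun i => ?_⟩
  · rw [map_add, map_sub, hη i k hk, hvm i k hk]; ring
  · rw [hx]
    refine MemClosure.sub (memClosure_cutMul j n η k) ((hvW k).mono ?_)
    exact inter_subset_inter_left _ (interior_mono (biUnion_subset_biUnion_left sdiff_subset))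
  · have h1 : ∀ u, M.aGlob i (η - w) u = 0 := fun u => by
      rw [map_sub, LinearMap.sub_apply, hw, aGlob_cutGlob_of_mem hi, sub_self]
    rw [map_add, M.aGlob_eq_zero (hv0 i fun h2 => h2.2 hi), M.aGlob_symm, h1, add_zero]
  · rw [hx]
    have h1 : ∀ u, M.aGlob i w u = 0 := fun u => aGlob_cutGlob_of_notMem hi η u
    have h2 := M.aGlob_eq_zero (hv0 i fun h2 => hi h2.1)
    rw [map_sub, h2, M.aGlob_symm, h1, sub_zero]
  · have hsq : 0 < √Λ := Real.sqrt_pos.2 hΛ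
    -- The choice `t = Λ^{-1/2}` balances the two terms, as `s ≤ Λ⁻¹ a` for `η`; each contributes
    -- `Λ^{-1/2}`.
    have h1 := neg_aGlob_sub_cutGlob_le (M := M) j i n η (inv_pos.2 hsq)
    rw [inv_inv] at h1
    have h2 : √Λ * M.sGlob i η η ≤ (√Λ)⁻¹ * M.aGlob i η η := by
      have := mul_le_mul_of_nonneg_left (hsη i) hsq.le
      refine this.trans_eq ?_
      have h3 : Λ = √Λ * √Λ := (Real.mul_self_sqrt hΛ.le).symm
      rw [← mul_assoc]
      congr 1
      conv_lhs => rw [h3]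
      rw [Real.sqrt_mul_self (by positivity)]
      field_simp
    -- Cauchy–Schwarz with the bound `(D / Λ) a(η, η)` for the energy of the correction.
    have h4 : -M.aGlob i η v ≤ √D * (√Λ)⁻¹ * M.aGlob i η η := by
      have h5 := M.aGlob_sq_le i η v
      have h6 := mul_le_mul_of_nonneg_left (hvη i) (M.aGlob_nonneg i η)
      refine (neg_le_abs _).trans (abs_le_of_sq_le_sq ?_ ?_)
      · rw [mul_pow, mul_pow, Real.sq_sqrt hD, inv_pow, Real.sq_sqrt hΛ.le]
        refine (h5.trans h6).trans_eq ?_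
        ring
      · have := M.aGlob_nonneg i η
        positivity
    rw [map_add]
    have h7 : (2 + √D) / √Λ * M.aGlob i η η =
      2 * ((√Λ)⁻¹ * M.aGlob i η η) + √D * (√Λ)⁻¹ * M.aGlob i η η := by
      field_simp
    rw [h7]
    linarith
  · have h1 := form_add_self_le (M.aGlob i) (M.aGlob_nonneg i) (η - w) v
    have h2 := aGlob_sub_cutGlob_le (M := M) j i n η
    have h3 := hsη i
    have h4 := hvη i
    have h5 := M.aGlob_nonneg i η
    rw [← hw] at h2
    have h6 := mul_nonneg hΛi.le h5
    have h7 := mul_nonneg hD h5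
    have h8 : (16 + 2 * D) * (1 + Λ⁻¹) * M.aGlob i η η = 16 * M.aGlob i η η +
      16 * (Λ⁻¹ * M.aGlob i η η) + 2 * (D * M.aGlob i η η) +
      2 * (D * (Λ⁻¹ * M.aGlob i η η)) := by ring
    rw [h8]
    linarith

open Classical in
/-- The energy outside of the oversampled region `K_{j,n}`. -/
def outerEnergy (M : Medium G) (j : J) (n : ℕ) (η : G.globSpace) : ℝ :=
  ∑ i, if i ∈ G.patch j n then 0 else M.aGlob i η η

theorem outerEnergy_le (j : J) (n : ℕ) (η : G.globSpace) : outerEnergy M j n η ≤ M.aTot η η := by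
  rw [aTot_apply]
  refine Finset.sum_le_sum fun i _ => ?_
  split_ifs
  exacts [M.aGlob_nonneg i η, le_rfl]

theorem aGlob_eq_of_sub {i : J} {η x : G.globSpace} (hx : M.aGlob i (η - x) (η - x) = 0) :
    M.aGlob i η x = M.aGlob i η η := by
  have := M.aGlob_eq_zero hx.le η
  rw [map_sub] at this
  linarith

/-- Hole filling. The identity `a_Q(η, x) = 0` for the corrected cutoff bounds the energy outside
`K_{j,n+1}` by `c` times the energy in the layer, which is the difference of two outer energies;
moving it to the other side gives a factor less than one. -/
theorem outerEnergy_succ_le (h : ∀ j, M.IsEigenSystem j (lam j) (φ j)) (hΛ : 0 < Lam L lam)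
    {C : ℝ} (hC : G.IsPoincareConst C) (hD : 1 ≤ M.Dconst C L lam φ) {j : J} {n : ℕ}
    {η : G.globSpace} (hη : ∀ i, ∀ k < L i, moment h i k η = 0)
    (horth : ∀ x : G.globSpace, (∀ i, ∀ k < L i, moment h i k x = 0) → M.aGlob j x x = 0 →
      M.aTot η x = 0) :
    outerEnergy M j (n + 1) η * (1 + √(Lam L lam) / (3 * √(M.Dconst C L lam φ))) ≤
      outerEnergy M j n η := by
  obtain ⟨x, hxm, -, hx0, hx1, hx2, -⟩ :=
    exists_moment_free_cutoff h hΛ hC (zero_le_one.trans hD) j n hη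
  set D := M.Dconst C L lam φ
  set Λ := Lam L lam
  have h0 := horth x hxm (hx0 j (G.mem_patch_self j n))
  set c := (2 + √D) / √Λ with hc
  have hterm : outerEnergy M j (n + 1) η - c * (outerEnergy M j n η - outerEnergy M j (n + 1) η) ≤
      M.aTot η x := by
    rw [aTot_apply, outerEnergy, outerEnergy, ← Finset.sum_sub_distrib, Finset.mul_sum,
      ← Finset.sum_sub_distrib]
    refine Finset.sum_le_sum fun i _ => ?_
    by_cases h1 : i ∈ G.patch j n
    · rw [if_pos h1, if_pos (G.patch_subset_succ j n h1), M.aGlob_eq_zero (hx0 i h1).le]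
      simp
    · by_cases h2 : i ∈ G.patch j (n + 1)
      · rw [if_neg h1, if_pos h2]
        linarith [hx2 i]
      · rw [if_neg h1, if_neg h2, aGlob_eq_of_sub (hx1 i h2)]
        simp
  rw [h0] at hterm
  have hsΛ : 0 < √Λ := Real.sqrt_pos.2 hΛ
  have hsD : 1 ≤ √D := Real.one_le_sqrt.2 hD
  have hmono : 0 ≤ outerEnergy M j n η - outerEnergy M j (n + 1) η := by
    rw [outerEnergy, outerEnergy, ← Finset.sum_sub_distrib]
    refine Finset.sum_nonneg fun i _ => ?_
    by_cases h1 : i ∈ G.patch j n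
    · rw [if_pos h1, if_pos (G.patch_subset_succ j n h1), sub_self]
    · rw [if_neg h1]
      split_ifs
      · rw [sub_zero]; exact M.aGlob_nonneg i η
      · rw [sub_self]
  -- Since `D ≥ 1`, the summand `2` is at most `2 √D`.
  have hc3 : c ≤ 3 * √D / √Λ := by rw [hc]; gcongr; linarith
  have h1 : outerEnergy M j (n + 1) η ≤
      3 * √D / √Λ * (outerEnergy M j n η - outerEnergy M j (n + 1) η) := by
    have := mul_le_mul_of_nonneg_right hc3 hmono
    linarith
  have h2 := mul_le_mul_of_nonneg_left h1 (by positivity : 0 ≤ √Λ / (3 * √D))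
  have h3 : √Λ / (3 * √D) * (3 * √D / √Λ * (outerEnergy M j n η - outerEnergy M j (n + 1) η)) =
      outerEnergy M j n η - outerEnergy M j (n + 1) η := by
    field_simp
  rw [h3] at h2
  linarith

theorem outerEnergy_mul_pow_le (h : ∀ j, M.IsEigenSystem j (lam j) (φ j)) (hΛ : 0 < Lam L lam)
    {C : ℝ} (hC : G.IsPoincareConst C) (hD : 1 ≤ M.Dconst C L lam φ) {j : J}
    {η : G.globSpace} (hη : ∀ i, ∀ k < L i, moment h i k η = 0)
    (horth : ∀ x : G.globSpace, (∀ i, ∀ k < L i, moment h i k x = 0) → M.aGlob j x x = 0 →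
      M.aTot η x = 0) (n : ℕ) :
    outerEnergy M j n η * (1 + √(Lam L lam) / (3 * √(M.Dconst C L lam φ))) ^ n ≤
      M.aTot η η := by
  induction n with
  | zero => rw [pow_zero, mul_one]; exact outerEnergy_le j 0 η
  | succ n ih =>
    refine le_trans ?_ ih
    rw [pow_succ', ← mul_assoc]
    exact mul_le_mul_of_nonneg_right (outerEnergy_succ_le h hΛ hC hD hη horth) (by positivity)

theorem isPhiOrthogonal_iff (h : ∀ j, M.IsEigenSystem j (lam j) (φ j)) {j : J} {k : ℕ}
    {u : G.globSpace} : M.IsPhiOrthogonal L φ j k u.1 ↔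
      ∀ i, ∀ l < L i, moment h i l u = (open Classical in if i = j ∧ l = k then 1 else 0) := by
  simp only [IsPhiOrthogonal, moment_apply]
  refine forall_congr' fun i => forall_congr' fun l => forall_congr' fun _ => ?_
  split_ifs with h1
  · simp [h1]
  · simp [h1]

/-- A minimizer is orthogonal to the admissible variations. -/
theorem aTot_eq_zero_of_minimal {ψ x : G.globSpace}
    (hmin : ∀ t : ℝ, M.aTot ψ ψ ≤ M.aTot (ψ + t • x) (ψ + t • x)) : M.aTot ψ x = 0 := by
  have key : ∀ t : ℝ, 0 ≤ M.aTot x x * (t * t) + (2 * M.aTot ψ x) * t + 0 := by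
    intro t
    have h1 := hmin t
    simp only [map_add, map_smul, LinearMap.add_apply, LinearMap.smul_apply, smul_eq_mul,
      M.aTot_symm x ψ] at h1
    linarith
  have h2 := discrim_le_zero key
  rw [discrim] at h2
  nlinarith

end Medium

end

/-! ### The error of the localized basis function -/

theorem lemma3 {J N ι : Type*} [Fintype J] [Fintype N] [Fintype ι]
    (G : Geometry J N ι) (M : Medium G)
    -- the local spectral problems and the numbers of auxiliary functions
    (lam : J → ℕ → ℝ) (φ : J → ℕ → DualFun ι) (L : J → ℕ)
    (hφ : ∀ j, M.IsEigenSystem j (lam j) (φ j))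
    (hΛ : 0 < Medium.Lam L lam)
    (Cp : ℝ) (hCp : G.IsPoincareConst Cp)
    (j : J) (k : ℕ) (hk : k < L j) (m : ℕ) (hm : 2 ≤ m)
    (ψ ψms : DualFun ι)
    (hψ : M.IsMultiscaleBasis G.V L φ j k ψ)
    (hψms : M.IsMultiscaleBasis (G.VZero j m) L φ j k ψms) :
    M.aQ (ψ - ψms) (ψ - ψms) ≤
      24 * M.Dconst Cp L lam φ ^ 2 * (1 + (Medium.Lam L lam)⁻¹) *
        (1 + √(Medium.Lam L lam) / (3 * √(M.Dconst Cp L lam φ))) ^ (1 - (m : ℤ)) *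
        M.sLoc j (φ j k) (φ j k) := by
  classical
  -- One of the `m` layers is reserved for the cutoff of the competitor; the others give `n = m - 1`
  -- decay steps, whence the exponent `1 - m`.
  obtain ⟨n, rfl⟩ : ∃ n, m = n + 1 := ⟨m - 1, by omega⟩
  have hD32 : 32 ≤ M.Dconst Cp L lam φ := Medium.le_Dconst L hφ hk
  have hD1 : 1 ≤ M.Dconst Cp L lam φ := by linarith
  obtain ⟨⟨hψV, hψo⟩, hψmin⟩ := hψ
  obtain ⟨⟨hmsV, hmso⟩, hmsmin⟩ := hψms
  set δ : J → ℕ → ℝ := fun i l => if i = j ∧ l = k then 1 else 0 with hδ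
  set Ψ : G.globSpace := ⟨ψ, hψV⟩ with hΨ
  set Ψms : G.globSpace := ⟨ψms, fun i => (hmsV i).mono inter_subset_right⟩ with hΨms
  have hΨm : ∀ i, ∀ l < L i, Medium.moment hφ i l Ψ = δ i l :=
    (Medium.isPhiOrthogonal_iff hφ).1 hψo
  have hΨmsm : ∀ i, ∀ l < L i, Medium.moment hφ i l Ψms = δ i l :=
    (Medium.isPhiOrthogonal_iff hφ).1 hmso
  have hΨorth : ∀ x : G.globSpace, (∀ i, ∀ l < L i, Medium.moment hφ i l x = 0) →
      M.aTot Ψ x = 0 := by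
    intro x hx
    refine Medium.aTot_eq_zero_of_minimal fun t => ?_
    rw [← Medium.aQ_eq_aTot, ← Medium.aQ_eq_aTot]
    refine hψmin _ (Ψ + t • x).2 ((Medium.isPhiOrthogonal_iff hφ).2 fun i l hl => ?_)
    rw [map_add, map_smul, hx i l hl, hΨm i l hl, smul_zero, add_zero]
  -- A function in `K_j` alone with the moments required of `ψ`. Its energy is at most `D`, the only
  -- nonzero prescribed moment being `1`.
  obtain ⟨f, hfW, hfm, hfa⟩ := Medium.exists_lift_sum hφ hCp {j} δ fun i hi l _ =>
    if_neg fun h => hi h.1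
  have hsum : ∀ i, ∑ l ∈ Finset.range (L i), δ i l ^ 2 = if i = j then 1 else 0 := by
    intro i
    split_ifs with hij
    · subst hij
      rw [Finset.sum_eq_single k]
      · simp [hδ]
      · intro l _ hl; simp [hδ, hl]
      · intro hk'; exact absurd (Finset.mem_range.2 hk) hk'
    · exact Finset.sum_eq_zero fun l _ => by simp [hδ, hij]
  have hf0 : ∀ i, i ≠ j → M.aGlob i f f ≤ 0 := by
    intro i hij
    refine (hfa i).trans_eq ?_
    rw [hsum, if_neg hij, mul_zero]
  have hff : M.aTot f f ≤ M.Dconst Cp L lam φ := by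
    rw [Medium.aTot_apply]
    refine (Finset.sum_le_sum fun i _ => hfa i).trans_eq ?_
    rw [← Finset.mul_sum]
    simp [hsum]
  set η := Ψ - f with hη
  have hηm : ∀ i, ∀ l < L i, Medium.moment hφ i l η = 0 := by
    intro i l hl
    rw [hη, map_sub, hΨm i l hl, hfm i l hl, sub_self]
  -- Pythagoras: `ψ` is orthogonal to `η`, and `f = ψ - η`, so the energy of `f` is the sum of the
  -- energies of `ψ` and `η`.
  have hηη : M.aTot η η ≤ M.Dconst Cp L lam φ := by
    have h1 := hΨorth η hηm
    have h2 := M.aTot_nonneg Ψ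
    have h3 : M.aTot f f = M.aTot Ψ Ψ - 2 * M.aTot Ψ η + M.aTot η η := by
      have : f = Ψ - η := by rw [hη]; abel
      conv_lhs => rw [this]
      simp only [map_sub, LinearMap.sub_apply, M.aTot_symm η Ψ]
      ring
    linarith
  have hηorth : ∀ x : G.globSpace, (∀ i, ∀ l < L i, Medium.moment hφ i l x = 0) →
      M.aGlob j x x = 0 → M.aTot η x = 0 := by
    intro x hx hxj
    -- The part `a_Q(f, x)` splits over elements: in `K_j` the function `x` has no energy, in the
    -- others `f` has none.
    rw [hη, map_sub, LinearMap.sub_apply, hΨorth x hx, zero_sub, neg_eq_zero, Medium.aTot_apply]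
    refine Finset.sum_eq_zero fun i _ => ?_
    by_cases hij : i = j
    · subst hij
      exact M.aGlob_eq_zero hxj.le f
    · rw [M.aGlob_symm]
      exact M.aGlob_eq_zero (hf0 i hij) x
  have hdecay := Medium.outerEnergy_mul_pow_le hφ hΛ hCp hD1 hηm hηorth n
  obtain ⟨x, hxm, hxW, hx0, hx1, -, hx2⟩ :=
    Medium.exists_moment_free_cutoff hφ hΛ hCp (zero_le_one.trans hD1) j n hηm
  set D := M.Dconst Cp L lam φ with hDdef
  set Λ := Medium.Lam L lam with hΛdef
  set B := (16 + 2 * D) * (1 + Λ⁻¹) with hB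
  have hΛi : 0 < Λ⁻¹ := inv_pos.2 hΛ
  have hB1 : 1 ≤ B := by
    rw [hB]
    nlinarith [mul_pos (show 0 < 16 + 2 * D by linarith) hΛi]
  have hxx : M.aTot x x ≤ B * Medium.outerEnergy M j n η := by
    rw [Medium.aTot_apply, Medium.outerEnergy, Finset.mul_sum]
    refine Finset.sum_le_sum fun i _ => ?_
    by_cases h1 : i ∈ G.patch j n
    · rw [hx0 i h1, if_pos h1, mul_zero]
    · rw [if_neg h1]
      exact hx2 i
  -- the competitor in the oversampled region
  set w := Ψ - x with hw
  have hwm : ∀ i, ∀ l < L i, Medium.moment hφ i l w = δ i l := by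
    intro i l hl
    rw [hw, map_sub, hΨm i l hl, hxm i l hl, sub_zero]
  have hwV : w.1 ∈ G.VZero j (n + 1) := by
    intro i
    -- The competitor differs from `ψ` by `x`, but rewritten as `f + (η - x)` both summands vanish
    -- outside the oversampled region.
    have h1 : w.1 i = f.1 i + (1 : ℝ) • (η - x).1 i := by
      have : w = f + (1 : ℝ) • (η - x) := by rw [hw, hη, one_smul]; abel
      rw [this]; rfl
    rw [h1]
    refine ((hfW i).mono (inter_subset_inter_left _ (interior_mono ?_))).add_smul (hxW i) 1
    exact biUnion_subset_biUnion_left (singleton_subset_iff.2 (G.mem_patch_self j (n + 1)))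
  have hmin : M.aTot Ψms Ψms ≤ M.aTot w w := by
    rw [← Medium.aQ_eq_aTot, ← Medium.aQ_eq_aTot]
    exact hmsmin w.1 hwV ((Medium.isPhiOrthogonal_iff hφ).2 hwm)
  have horth : M.aTot Ψ (w - Ψms) = 0 := hΨorth _ fun i l hl => by
    rw [map_sub, hwm i l hl, hΨmsm i l hl, sub_self]
  -- Both `w` and `ψ_ms` have the moments of `ψ`, so `a_Q(ψ, w) = a_Q(ψ, ψ_ms)`, and the comparison
  -- of energies becomes a comparison of distances from `ψ`.
  have hle : M.aTot (Ψ - Ψms) (Ψ - Ψms) ≤ M.aTot x x := by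
    have hx : x = Ψ - w := by rw [hw]; abel
    rw [hx]
    simp only [map_sub, LinearMap.sub_apply, M.aTot_symm Ψms Ψ, M.aTot_symm w Ψ] at horth ⊢
    linarith
  have hφ1 : M.sLoc j (φ j k) (φ j k) = 1 := by rw [(hφ j).orthonormal, if_pos rfl]
  have hgoal : M.aQ (ψ - ψms) (ψ - ψms) = M.aTot (Ψ - Ψms) (Ψ - Ψms) :=
    Medium.aQ_eq_aTot (M := M) (Ψ - Ψms) (Ψ - Ψms)
  rw [hgoal, hφ1, mul_one]
  set θ := 1 + √Λ / (3 * √D) with hθ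
  have hθ0 : 0 < θ := by positivity
  have hexp : θ ^ (1 - ((n + 1 : ℕ) : ℤ)) = (θ ^ n)⁻¹ := by
    rw [show (1 - ((n + 1 : ℕ) : ℤ)) = -(n : ℤ) by push_cast; ring, zpow_neg, zpow_natCast]
  rw [hexp]
  have hout : Medium.outerEnergy M j n η ≤ D * (θ ^ n)⁻¹ := by
    rw [← div_eq_mul_inv, le_div_iff₀ (by positivity)]
    exact hdecay.trans hηη
  calc M.aTot (Ψ - Ψms) (Ψ - Ψms) ≤ B * (D * (θ ^ n)⁻¹) :=
        hle.trans (hxx.trans (mul_le_mul_of_nonneg_left hout (by linarith)))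
    -- `16 + 2 D ≤ 24 D` because `D ≥ 1`. The second factor `D` is the bound for the energy of `η`.
    _ ≤ 24 * D * (1 + Λ⁻¹) * (D * (θ ^ n)⁻¹) := by
        refine mul_le_mul_of_nonneg_right ?_ (by positivity)
        rw [hB]
        refine mul_le_mul_of_nonneg_right ?_ (by positivity)
        linarith
    _ = _ := by ring
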